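/- Let $\ell_1,\ell_2>0$ and $D\in\mathbb R$. Consider the metric graph formed by the rectangular lattice in the plane with spacings $\ell_1$ (horizontal) and $\ell_2$ (vertical), and on the $L^2$ space of this graph the Hamiltonian $\{f_e\}\mapsto\{-f_e''\}$ whose domain consists of the functions that are $H^2$ on the edges and satisfy at every vertex the $\delta'_s$ coupling: the four outward derivatives have a common value $f'$, and the four boundary values satisfy $f_1+f_2+f_3+f_4=Df'$. Let $\sigma(D)$ be its spectrum. A gap of a spectrum means a connected component of its complement in $\mathbb R$. Then: (a) The spectrum has a band structure. If $D\neq0$, the number of gaps is infinite and $\sigma(D)=\bigcup_{r=1}^{\infty}[\alpha_r,\beta_r]$ with real numbers $\alpha_r<\beta_r<\alpha_{r+1}$ for all $r\ge1$. (b) $\sigma(0)=[0,\infty)$. (c) If $D>0$, then each $\alpha_r$ equals $(\pi n/\lambda)^2$ for some $n\in\mathbb Z$ and $\lambda=\ell_1$ or $\lambda=\ell_2$. If $D<0$, then each $\beta_r$ with $r\ge2$ equals $(\pi m/\lambda)^2$ for some $m\in\mathbb Z$ and $\lambda=\ell_1$ or $\lambda=\ell_2$. (d) The bottom $\alpha_1$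 of the spectrum is $\alpha_1=0$ for $D\ge0$, and satisfies $\alpha_1<0$ for $D<0$. (e) If $-\ell_1-\ell_2<D<0$, then $\beta_1<0$ and $\alpha_2=0$. (f) If $|D'|>|D|$ and $DD'\ge0$, then $\sigma(D')\cap[0,\infty)\subset\sigma(D)\cap[0,\infty)$. (g) Every gap of $\sigma(D)$, with the only exception of a bounded gap of the form $(b,0)$ with $b<0$ (such as $(\beta_1,0)$ in (e)), is contained in the intersection $I_1\cap I_2$, where $I_j$ is a gap of the spectrum of the $\delta'$ Kronig–Penney model with spacing $\ell_j$ and coupling constant $D$, that is, of the operator $-d^2/dx^2$ on $L^2(\mathbb R)$ with the conditions $f'(x+)=f'(x-)=:f'(x)$, $f(x+)-f(x-)=Df'(x)$ at all points $x\in\ell_j\mathbb Z$. -/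

import Mathlib

open Real Set MeasureTheory

noncomputable section

/-! ### Second-derivative operators on metric graphs -/

/-- The state space `⨁ₑ L²(0, Lₑ)` of a metric graph whose edges `e : E` have lengths `L e`. -/
abbrev EdgeSpace {E : Type} (L : E → ℝ) : Type :=
  lp (fun e : E => Lp ℂ 2 (volume.restrict (Ioc (0 : ℝ) (L e)))) 2

/-- `F` belongs to the Sobolev space `H²(0, a)` and `G` is its weak second derivative; `f` is the
continuously differentiable representative of `F` on `[0, a]`, and `f'` is the derivative of `f`,
which is absolutely continuous with almost everywhere derivative `G`. -/
def HasSecondDeriv (a : ℝ) (F G : Lp ℂ 2 (volume.restrict (Ioc (0 : ℝ) a))) (f f' : ℝ → ℂ) :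
    Prop :=
  (F =ᵐ[volume.restrict (Ioc (0 : ℝ) a)] f) ∧
  (∀ x ∈ Icc (0 : ℝ) a, HasDerivWithinAt f (f' x) (Icc (0 : ℝ) a) x) ∧
  (∀ x ∈ Icc (0 : ℝ) a, f' x = f' 0 + ∫ t in (0 : ℝ)..x, G t)

theorem Lp_intervalIntegrable {a x : ℝ} (G : Lp ℂ 2 (volume.restrict (Ioc (0 : ℝ) a)))
    (hx : x ∈ Icc (0 : ℝ) a) : IntervalIntegrable G volume 0 x := by
  have h : IntegrableOn G (Ioc (0 : ℝ) a) volume :=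
    (Lp.memLp G).integrable (by norm_num)
  rw [intervalIntegrable_iff_integrableOn_Ioc_of_le hx.1]
  exact h.mono_set (Ioc_subset_Ioc_right hx.2)

theorem HasSecondDeriv.add {a : ℝ} {F G F₂ G₂ : Lp ℂ 2 (volume.restrict (Ioc (0 : ℝ) a))}
    {f f' f₂ f₂' : ℝ → ℂ} (h : HasSecondDeriv a F G f f') (h₂ : HasSecondDeriv a F₂ G₂ f₂ f₂') :
    HasSecondDeriv a (F + F₂) (G + G₂) (f + f₂) (f' + f₂') := by
  refine ⟨?_, fun x hx => (h.2.1 x hx).add (h₂.2.1 x hx), fun x hx => ?_⟩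
  · filter_upwards [Lp.coeFn_add F F₂, h.1, h₂.1] with x hx h1 h2
    rw [hx, Pi.add_apply, Pi.add_apply, h1, h2]
  · have e : ∫ t in (0 : ℝ)..x, (G + G₂) t = ∫ t in (0 : ℝ)..x, (G t + G₂ t) := by
      rw [intervalIntegral.integral_of_le hx.1, intervalIntegral.integral_of_le hx.1]
      refine integral_congr_ae (ae_mono (Measure.restrict_mono (Ioc_subset_Ioc_right hx.2) le_rfl) ?_)
      exact Lp.coeFn_add G G₂
    rw [e, intervalIntegral.integral_add (Lp_intervalIntegrable G hx) (Lp_intervalIntegrable G₂ hx),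
      Pi.add_apply, Pi.add_apply, h.2.2 x hx, h₂.2.2 x hx]
    ring

theorem HasSecondDeriv.smul {a : ℝ} {F G : Lp ℂ 2 (volume.restrict (Ioc (0 : ℝ) a))}
    {f f' : ℝ → ℂ} (c : ℂ) (h : HasSecondDeriv a F G f f') :
    HasSecondDeriv a (c • F) (c • G) (c • f) (c • f') := by
  refine ⟨?_, fun x hx => (h.2.1 x hx).const_smul c, fun x hx => ?_⟩
  · filter_upwards [Lp.coeFn_smul c F, h.1] with x hx h1
    simp [hx, h1]
  · have e : ∫ t in (0 : ℝ)..x, (c • G) t = ∫ t in (0 : ℝ)..x, c • G t := by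
      rw [intervalIntegral.integral_of_le hx.1, intervalIntegral.integral_of_le hx.1]
      refine integral_congr_ae (ae_mono (Measure.restrict_mono (Ioc_subset_Ioc_right hx.2) le_rfl) ?_)
      exact Lp.coeFn_smul c G
    rw [e, intervalIntegral.integral_smul, Pi.smul_apply, Pi.smul_apply, h.2.2 x hx, smul_add]

theorem HasSecondDeriv.zero (a : ℝ) : HasSecondDeriv a 0 0 0 0 := by
  refine ⟨Lp.coeFn_zero _ _ _, fun x _ => hasDerivWithinAt_const x _ (0 : ℂ), fun x hx => ?_⟩
  have e : ∫ t in (0 : ℝ)..x, (0 : Lp ℂ 2 (volume.restrict (Ioc (0 : ℝ) a))) t =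
      ∫ t in (0 : ℝ)..x, (0 : ℂ) := by
    rw [intervalIntegral.integral_of_le hx.1, intervalIntegral.integral_of_le hx.1]
    refine integral_congr_ae (ae_mono (Measure.restrict_mono (Ioc_subset_Ioc_right hx.2) le_rfl) ?_)
    exact Lp.coeFn_zero _ _ _
  rw [e]
  simp

/-- The weak second derivative is determined by the function. -/
theorem HasSecondDeriv.unique_zero {a : ℝ} {G : Lp ℂ 2 (volume.restrict (Ioc (0 : ℝ) a))}
    {f f' : ℝ → ℂ} (h : HasSecondDeriv a 0 G f f') : G = 0 := by
  rcases le_or_gt a 0 with ha | ha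
  · have hm : volume.restrict (Ioc (0 : ℝ) a) = 0 := by
      rw [Ioc_eq_empty (not_lt.mpr ha), Measure.restrict_empty]
    refine (Lp.eq_zero_iff_ae_eq_zero).2 (ae_mono hm.le ?_)
    simp
  have hc : ContinuousOn f (Icc 0 a) := fun x hx => (h.2.1 x hx).continuousWithinAt
  have h0 : f =ᵐ[volume.restrict (Ioo 0 a)] (fun _ => (0 : ℂ)) := by
    refine ae_mono (Measure.restrict_mono Ioo_subset_Ioc_self le_rfl) ?_
    filter_upwards [h.1, Lp.coeFn_zero ℂ 2 (volume.restrict (Ioc (0 : ℝ) a))] with x h1 h2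
    rw [← h1, h2]; rfl
  have hz : EqOn f (fun _ => (0 : ℂ)) (Ioo 0 a) :=
    Measure.eqOn_open_of_ae_eq h0 isOpen_Ioo (hc.mono Ioo_subset_Icc_self) continuousOn_const
  have hzI : EqOn f (fun _ => (0 : ℂ)) (Icc 0 a) := by
    refine hz.of_subset_closure hc continuousOn_const Ioo_subset_Icc_self ?_
    rw [closure_Ioo ha.ne]
  have hf' : ∀ x ∈ Icc 0 a, f' x = 0 := by
    intro x hx
    have h1 : HasDerivWithinAt f 0 (Icc 0 a) x :=
      (hasDerivWithinAt_const x (Icc 0 a) (0 : ℂ)).congr hzI (hzI hx)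
    exact (uniqueDiffOn_Icc ha x hx).eq_deriv _ (h.2.1 x hx) h1
  have hint : ∀ x ∈ Icc 0 a, ∫ t in (0 : ℝ)..x, G t = 0 := by
    intro x hx
    have := h.2.2 x hx
    rw [hf' x hx, hf' 0 ⟨le_rfl, ha.le⟩, zero_add] at this
    exact this.symm
  have key := (Lp_intervalIntegrable G (x := a) ⟨ha.le, le_rfl⟩).ae_hasDerivAt_integral
  refine (Lp.eq_zero_iff_ae_eq_zero).2
    (ae_mono (restrict_Ioo_eq_restrict_Ioc (μ := volume)).ge ?_)
  refine (ae_restrict_iff' measurableSet_Ioo).2 ?_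
  filter_upwards [key] with x hx hxI
  have hxu : x ∈ uIcc 0 a := by rw [uIcc_of_le ha.le]; exact Ioo_subset_Icc_self hxI
  have h1 := hx hxu 0 (by simp)
  have h2 : HasDerivAt (fun x => ∫ t in (0 : ℝ)..x, G t) 0 x := by
    refine (hasDerivAt_const x (0 : ℂ)).congr_of_eventuallyEq ?_
    filter_upwards [Icc_mem_nhds hxI.1 hxI.2] with y hy using hint y hy
  exact h1.unique h2

/-- Boundary data `(f(0+), f(L-), f'(0+), f'(L-))` of a function on the graph, where each component
is a family indexed by the edges. -/
abbrev BoundaryData (E : Type) : Type := (E → ℂ) × (E → ℂ) × (E → ℂ) × (E → ℂ)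

/-- The graph of the operator `{fₑ} ↦ {-fₑ''}` whose domain consists of all families of `H²`
functions on the edges, with `{fₑ}` and `{fₑ''}` in the state space, whose boundary values satisfy
the linear coupling conditions `B`. (If the lengths are bounded below by a positive constant, then
`{fₑ'}` is automatically square summable.) -/
def edgeLaplacianGraph {E : Type} (L : E → ℝ) (B : Submodule ℂ (BoundaryData E)) :
    Submodule ℂ (EdgeSpace L × EdgeSpace L) where
  carrier := {p | ∃ f f' : E → ℝ → ℂ,
    (∀ e, HasSecondDeriv (L e) (p.1 e) (-(p.2 e)) (f e) (f' e)) ∧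
    ((fun e => f e 0, fun e => f e (L e), fun e => f' e 0, fun e => f' e (L e)) :
      BoundaryData E) ∈ B}
  add_mem' := by
    rintro p q ⟨f, f', h, hB⟩ ⟨g, g', k, kB⟩
    refine ⟨f + g, f' + g', fun e => ?_, B.add_mem hB kB⟩
    have := (h e).add (k e)
    rw [← neg_add] at this
    exact this
  zero_mem' := by
    refine ⟨0, 0, fun e => ?_, B.zero_mem⟩
    have := HasSecondDeriv.zero (L e)
    rw [← neg_zero] at this
    simpa using this
  smul_mem' := by
    rintro c p ⟨f, f', h, hB⟩
    refine ⟨c • f, c • f', fun e => ?_, B.smul_mem c hB⟩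
    have := (h e).smul c
    rw [smul_neg] at this
    exact this

/-- The (unbounded) operator `{fₑ} ↦ {-fₑ''}` with coupling conditions `B`. -/
def edgeLaplacian {E : Type} (L : E → ℝ) (B : Submodule ℂ (BoundaryData E)) :
    EdgeSpace L →ₗ.[ℂ] EdgeSpace L :=
  (edgeLaplacianGraph L B).toLinearPMap

theorem edgeLaplacian_graph {E : Type} (L : E → ℝ) (B : Submodule ℂ (BoundaryData E)) :
    (edgeLaplacian L B).graph = edgeLaplacianGraph L B := by
  refine Submodule.toLinearPMap_graph_eq _ ?_
  rintro ⟨F, G⟩ ⟨f, f', h, -⟩ (hF : F = 0)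
  subst hF
  ext1
  funext e
  have := (h e).unique_zero
  simpa using this

/-! ### Spectrum of an unbounded operator -/

/-- The spectrum of an unbounded operator `T`: the complex numbers `z` for which `T - z` does not
have an everywhere defined bounded inverse. -/
def unboundedSpectrum {X : Type} [NormedAddCommGroup X] [NormedSpace ℂ X] (T : X →ₗ.[ℂ] X) :
    Set ℂ :=
  {z | ¬ ∃ R : X →L[ℂ] X,
    (∀ h : X, ∃ hd : R h ∈ T.domain, T ⟨R h, hd⟩ - z • R h = h) ∧
    (∀ f : T.domain, R (T f - z • (f : X)) = f)}

/-- A gap of a closed set `S` of energies: a connected component of its complement in `ℝ`. -/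
def IsGap (S I : Set ℝ) : Prop := ∃ x ∈ Sᶜ, I = connectedComponentIn Sᶜ x

/-! ### The rectangular lattice with `δ'ₛ` coupling -/

/-- Edges of the rectangular lattice with vertices `(n ℓ₁, m ℓ₂)`: `Sum.inl (n, m)` is the
horizontal edge from vertex `(n, m)` to vertex `(n + 1, m)`, and `Sum.inr (n, m)` is the vertical
edge from vertex `(n, m)` to vertex `(n, m + 1)`. -/
abbrev LatticeEdge : Type := (ℤ × ℤ) ⊕ (ℤ × ℤ)

/-- Horizontal edges have length `ℓ₁` and vertical ones have length `ℓ₂`. -/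
def latticeLength (l₁ l₂ : ℝ) : LatticeEdge → ℝ :=
  Sum.elim (fun _ => l₁) (fun _ => l₂)

/-- The `δ'ₛ` coupling at every vertex: the four outward derivatives coincide, and the sum of the
four boundary values is `D` times their common value. The data are
`(f(0+), f(L-), f'(0+), f'(L-))`, so the outward derivative at the right end is `-f'(L-)`. -/
def deltaPrimeSLattice (D : ℝ) : Submodule ℂ (BoundaryData LatticeEdge) where
  carrier := {b | ∀ n m : ℤ,
    b.2.2.1 (Sum.inl (n, m)) = -b.2.2.2 (Sum.inl (n - 1, m)) ∧
    b.2.2.1 (Sum.inl (n, m)) = b.2.2.1 (Sum.inr (n, m)) ∧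
    b.2.2.1 (Sum.inl (n, m)) = -b.2.2.2 (Sum.inr (n, m - 1)) ∧
    b.1 (Sum.inl (n, m)) + b.2.1 (Sum.inl (n - 1, m)) +
      b.1 (Sum.inr (n, m)) + b.2.1 (Sum.inr (n, m - 1)) =
        (D : ℂ) * b.2.2.1 (Sum.inl (n, m))}
  add_mem' := by
    intro a b ha hb n m
    obtain ⟨h1, h2, h3, h4⟩ := ha n m
    obtain ⟨k1, k2, k3, k4⟩ := hb n m
    simp only [Prod.fst_add, Prod.snd_add, Pi.add_apply]
    exact ⟨by linear_combination h1 + k1, by linear_combination h2 + k2,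
      by linear_combination h3 + k3, by linear_combination h4 + k4⟩
  zero_mem' := by
    intro n m
    simp
  smul_mem' := by
    intro c a ha n m
    obtain ⟨h1, h2, h3, h4⟩ := ha n m
    simp only [Prod.smul_fst, Prod.smul_snd, Pi.smul_apply, smul_eq_mul]
    exact ⟨by linear_combination c * h1, by linear_combination c * h2,
      by linear_combination c * h3, by linear_combination c * h4⟩

/-- The spectrum of the `δ'ₛ` lattice Hamiltonian with spacings `l₁`, `l₂` and coupling `D`. -/
def latticeSpectrum (l₁ l₂ D : ℝ) : Set ℂ :=
  unboundedSpectrum (edgeLaplacian (latticeLength l₁ l₂) (deltaPrimeSLattice D))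

/-- The real part of the spectrum, as a set of real energies. -/
def latticeEnergies (l₁ l₂ D : ℝ) : Set ℝ :=
  {E | (E : ℂ) ∈ latticeSpectrum l₁ l₂ D}

/-! ### The `δ'` Kronig–Penney model -/

/-- The line is cut at the points `n l` (`n : ℤ`), edge `n` being `(n l, (n + 1) l)`. At every such
point there is a `δ'` interaction: `f'₊ = f'₋ = f'` and `f₊ - f₋ = D f'`. -/
def deltaPrimeArray (D : ℝ) : Submodule ℂ (BoundaryData ℤ) where
  carrier := {b | ∀ n : ℤ,
    b.2.2.1 n = b.2.2.2 (n - 1) ∧ b.1 n - b.2.1 (n - 1) = (D : ℂ) * b.2.2.1 n}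
  add_mem' := by
    intro a b ha hb n
    obtain ⟨h1, h2⟩ := ha n
    obtain ⟨k1, k2⟩ := hb n
    simp only [Prod.fst_add, Prod.snd_add, Pi.add_apply]
    exact ⟨by linear_combination h1 + k1, by linear_combination h2 + k2⟩
  zero_mem' := by
    intro n
    simp
  smul_mem' := by
    intro c a ha n
    obtain ⟨h1, h2⟩ := ha n
    simp only [Prod.smul_fst, Prod.smul_snd, Pi.smul_apply, smul_eq_mul]
    exact ⟨by linear_combination c * h1, by linear_combination c * h2⟩

/-- The (real) energies in the spectrum of the `δ'` Kronig–Penney Hamiltonian with spacing `l` and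
coupling constant `D`. -/
def kronigPenneyEnergies (l D : ℝ) : Set ℝ :=
  {E | (E : ℂ) ∈ unboundedSpectrum (edgeLaplacian (fun _ : ℤ => l) (deltaPrimeArray D))}

end

/-! ### Symmetric operators with a real point in the resolvent set -/

section SymmetricOperator

variable {X : Type} [NormedAddCommGroup X] [InnerProductSpace ℂ X]

/-! A function on the graph that solves the edge equation at energy `k ^ 2` is determined, as long
as no `sin (k ℓ)` vanishes, by the common derivatives `a v` at the vertices. The condition on the
boundary values then becomes a translation invariant difference equation for `a`, with diagonal
coefficient `A₁ + A₂ - D` and neighbour coefficients of modulus `|x₁|`, `|x₂|`, where `A = 2 cot (k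
ℓ) / k` and `x = 1 / (k sin (k ℓ))`. On ℓ² its symbol vanishes somewhere exactly when `|A₁ + A₂ - D|
≤ 2 (|x₁| + |x₂|)`, and this decides membership in the spectrum (`mem_latticeSpectrum_iff_and`). If
the inequality fails, a Neumann series solves the vertex equation and the operator is onto
(`IsDerivCoupling.surjective`); being symmetric, it then has a bounded resolvent there. If it holds,
a Bloch wave with slowly decaying amplitude is an approximate eigenvector
(`IsDerivCoupling.mem_spectrum_of_bloch`). Energies at which a sine vanishes always belong to the
spectrum.

Half-angle formulas split the inequality into `D k ≤ 2 ∑ cot u` and `-D k ≤ 2 ∑ tan u` with `u ∈ (0,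
π / 2)` (`IsDirichletInterval.sq_mem_iff`); at energy `-κ ^ 2` they give `2 ∑ tanh ≤ -D κ ≤ 2 ∑
coth`. For `D > 0` only the cotangents matter, and they decrease, so each interval between
consecutive zeros of the sines carries one band attached to its left end. For `D < 0` only the
tangents matter, and `tan u / k` increases, so the band is attached to the right end; one further
band lies at negative energies and closes strictly below zero exactly when `D > -ℓ₁ - ℓ₂`. Merging
the bands that touch gives the final enumeration, which is infinite because there are points off the
spectrum at arbitrarily high energies (`exists_gt_notMem_latticeEnergies`).

The remaining parts are read off the same inequalities. Decreasing `|D|` relaxes them. The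
Kronig–Penney condition contains one of the two nonnegative summands in place of their sum, so a
violation of `D k ≤ 2 ∑ cot u`, `-D k ≤ 2 ∑ tan u` or `-D κ ≤ 2 ∑ coth` persists. Only a violation
of `2 ∑ tanh ≤ -D κ` need not persist when `D < 0`, and it produces the exceptional gap ending at
zero. -/

theorem LinearPMap.eq_zero_of_symmetric_of_surjective (T : X →ₗ.[ℂ] X)
    (hT : ∀ x y : T.domain, inner ℂ (T x) (y : X) = inner ℂ (x : X) (T y)) (E : ℝ)
    (hs : ∀ h, ∃ x : T.domain, T x - (E : ℂ) • (x : X) = h) (x : T.domain)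
    (hx : T x - (E : ℂ) • (x : X) = 0) : x = 0 := by
  obtain ⟨y, hy⟩ := hs x
  have h : inner ℂ (x : X) (x : X) = (0 : ℂ) := by
    nth_rewrite 2 [← hy]
    rw [inner_sub_right, ← hT, inner_smul_right, sub_eq_zero.1 hx, inner_smul_left]
    simp
  exact Subtype.ext (inner_self_eq_zero.1 h)

variable [CompleteSpace X]

/-- A symmetric operator `T` with `T - E` surjective for a real `E` has a self-adjoint resolvent
at `E`. -/
theorem LinearPMap.exists_selfAdjoint_resolvent (T : X →ₗ.[ℂ] X)
    (hT : ∀ x y : T.domain, inner ℂ (T x) (y : X) = inner ℂ (x : X) (T y)) (E : ℝ)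
    (hs : ∀ h, ∃ x : T.domain, T x - (E : ℂ) • (x : X) = h) :
    ∃ R : X →L[ℂ] X, IsSelfAdjoint R ∧
      (∀ h : X, ∃ hd : R h ∈ T.domain, T ⟨R h, hd⟩ - (E : ℂ) • R h = h) ∧
      (∀ f : T.domain, R (T f - (E : ℂ) • (f : X)) = f) := by
  have h0 := T.eq_zero_of_symmetric_of_surjective hT E hs
  have inj : ∀ x y : T.domain, T x - (E : ℂ) • (x : X) = T y - (E : ℂ) • (y : X) → x = y := by
    intro x y hxy
    refine sub_eq_zero.1 (h0 (x - y) ?_)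
    have : T (x - y) = T x - T y := T.toFun.map_sub x y
    rw [this, Submodule.coe_sub, smul_sub]
    rw [sub_sub_sub_comm, hxy, sub_self]
  choose r hr using hs
  let R₀ : X →ₗ[ℂ] X :=
    { toFun := fun h => r h
      map_add' := fun h k => by
        have : r (h + k) = r h + r k := by
          apply inj
          have e : T (r h + r k) = T (r h) + T (r k) := T.toFun.map_add _ _
          rw [hr, e, Submodule.coe_add, smul_add]
          nth_rewrite 1 [← hr h, ← hr k]
          abel
        rw [this, Submodule.coe_add]
      map_smul' := fun c h => by
        have : r (c • h) = c • r h := by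
          apply inj
          have e : T (c • r h) = c • T (r h) := T.toFun.map_smul _ _
          rw [hr, e, Submodule.coe_smul, smul_comm, ← smul_sub, hr]
        rw [this, Submodule.coe_smul, RingHom.id_apply] }
  have hsym : R₀.IsSymmetric := by
    intro h k
    change inner ℂ (r h : X) k = inner ℂ h (r k : X)
    nth_rewrite 1 [← hr k]
    nth_rewrite 2 [← hr h]
    rw [inner_sub_right, inner_sub_left, hT, inner_smul_left, inner_smul_right]
    simp
  -- Hellinger–Toeplitz: an everywhere defined symmetric operator is bounded, so no resolvent
  -- estimate is needed.
  refine ⟨⟨R₀, hsym.continuous⟩, ?_, fun h => ⟨(r h).2, hr h⟩, fun f => ?_⟩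
  · rw [ContinuousLinearMap.isSelfAdjoint_iff_isSymmetric]
    exact hsym
  · exact congrArg Subtype.val (inj (r (T f - (E : ℂ) • (f : X))) f (hr _))

theorem notMem_unboundedSpectrum_of_surjective (T : X →ₗ.[ℂ] X)
    (hT : ∀ x y : T.domain, inner ℂ (T x) (y : X) = inner ℂ (x : X) (T y)) (E : ℝ)
    (hs : ∀ h, ∃ x : T.domain, T x - (E : ℂ) • (x : X) = h) :
    (E : ℂ) ∉ unboundedSpectrum T := by
  obtain ⟨R, -, h1, h2⟩ := T.exists_selfAdjoint_resolvent hT E hs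
  exact fun h => h ⟨R, h1, h2⟩

/-- For nonreal `z` the number `w = (z - E)⁻¹` is nonreal, hence outside the spectrum of the bounded
self-adjoint `R = (T - E)⁻¹`. The resolvent at `z` is then `w R (w - R)⁻¹`. -/
theorem unboundedSpectrum_im_eq_zero (T : X →ₗ.[ℂ] X)
    (hT : ∀ x y : T.domain, inner ℂ (T x) (y : X) = inner ℂ (x : X) (T y)) (E : ℝ)
    (hs : ∀ h, ∃ x : T.domain, T x - (E : ℂ) • (x : X) = h) {z : ℂ}
    (hz : z ∈ unboundedSpectrum T) : z.im = 0 := by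
  by_contra him
  obtain ⟨R, hR, h1, h2⟩ := T.exists_selfAdjoint_resolvent hT E hs
  have hzE : z - E ≠ 0 := by
    intro h
    apply him
    rw [sub_eq_zero.1 h, Complex.ofReal_im]
  set w : ℂ := (z - E)⁻¹ with hw
  have hwz : (z - E) * w = 1 := mul_inv_cancel₀ hzE
  have hwim : w.im ≠ 0 := by
    rw [hw, Complex.inv_im]
    simp [him, hzE]
  have hwR : w ∉ spectrum ℂ R := by
    intro h
    have := hR.mem_spectrum_eq_re h
    apply hwim
    rw [this, Complex.ofReal_im]
  rw [spectrum.notMem_iff] at hwR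
  obtain ⟨u, hu⟩ := hwR
  set Q : X →L[ℂ] X := (↑u⁻¹ : X →L[ℂ] X) with hQ
  have uQ : ∀ h, w • Q h - R (Q h) = h := by
    intro h
    have : ((u : X →L[ℂ] X) * Q) h = h := by rw [hQ, Units.mul_inv]; rfl
    rw [hu] at this
    simpa [Algebra.algebraMap_eq_smul_one] using this
  have Qu : ∀ h, Q (w • h - R h) = h := by
    intro h
    have : (Q * (u : X →L[ℂ] X)) h = h := by rw [hQ, Units.inv_mul]; rfl
    rw [hu] at this
    simpa [Algebra.algebraMap_eq_smul_one] using this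
  have comm : ∀ h, Q (R h) = R (Q h) := by
    intro h
    have e1 : R h = w • R (Q h) - R (R (Q h)) := by
      rw [← map_smul, ← map_sub, uQ]
    rw [e1, Qu]
  apply hz
  -- Writing the candidate as `R` applied to a vector puts its values into the domain of `T`.
  have key : ∀ h, (w • R (Q h) : X) = R (h + R (Q h)) := by
    intro h
    rw [map_add, ← map_smul, ← map_add]
    congr 1
    nth_rewrite 2 [← uQ h]
    abel
  refine ⟨w • (R.comp Q), fun h => ?_, fun f => ?_⟩
  · have e : (w • R.comp Q) h = R (h + R (Q h)) := key h
    obtain ⟨hd, hk⟩ := h1 (h + R (Q h))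
    refine ⟨by rw [e]; exact hd, ?_⟩
    have e' : T ⟨(w • R.comp Q) h, by rw [e]; exact hd⟩ = T ⟨R (h + R (Q h)), hd⟩ := by
      congr 1
      exact Subtype.ext e
    rw [e', e]
    have hk' : T ⟨R (h + R (Q h)), hd⟩ = h + R (Q h) + (E : ℂ) • R (h + R (Q h)) :=
      sub_eq_iff_eq_add.1 hk
    rw [hk']
    have : R (Q h) = (z - E) • R (h + R (Q h)) := by
      rw [← key, smul_smul, hwz, one_smul]
    rw [sub_smul] at this
    rw [add_assoc, add_sub_assoc]
    nth_rewrite 1 [this]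
    simp
  · change w • R (Q (T f - z • (f : X))) = f
    have e : T f - z • (f : X) = (T f - (E : ℂ) • (f : X)) - (z - E) • (f : X) := by
      rw [sub_smul]; abel
    have e2 : R (T f - z • (f : X)) = f - (z - E) • R f := by
      rw [e, map_sub, h2, map_smul]
    rw [← comm, e2, ← map_smul, smul_sub, smul_smul, mul_comm w, hwz, one_smul, Qu]

end SymmetricOperator

/-- Weyl's criterion: approximate eigenvectors put `z` into the spectrum. -/
theorem mem_unboundedSpectrum_of_approx {X : Type} [NormedAddCommGroup X] [NormedSpace ℂ X]
    (T : X →ₗ.[ℂ] X) (z : ℂ)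
    (h : ∀ ε > 0, ∃ x : T.domain, (x : X) ≠ 0 ∧ ‖T x - z • (x : X)‖ ≤ ε * ‖(x : X)‖) :
    z ∈ unboundedSpectrum T := by
  rintro ⟨R, -, h2⟩
  obtain ⟨x, hx, hle⟩ := h (1 / (2 * (‖R‖ + 1))) (by positivity)
  have hx' : 0 < ‖(x : X)‖ := norm_pos_iff.2 hx
  have : ‖(x : X)‖ ≤ ‖R‖ * (1 / (2 * (‖R‖ + 1)) * ‖(x : X)‖) := by
    calc ‖(x : X)‖ = ‖R (T x - z • (x : X))‖ := by rw [h2]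
      _ ≤ ‖R‖ * ‖T x - z • (x : X)‖ := R.le_opNorm _
      _ ≤ _ := by gcongr
  have h3 : ‖R‖ * (1 / (2 * (‖R‖ + 1)) * ‖(x : X)‖) ≤ 1 / 2 * ‖(x : X)‖ := by
    rw [← mul_assoc]
    gcongr
    rw [mul_one_div, div_le_div_iff₀ (by positivity) (by norm_num)]
    nlinarith [norm_nonneg R]
  linarith

/-! ### Analysis on a single edge -/

theorem eq_add_integral_of_hasDerivWithinAt {a : ℝ} {f f' : ℝ → ℂ}
    (hf : ∀ x ∈ Icc (0 : ℝ) a, HasDerivWithinAt f (f' x) (Icc (0 : ℝ) a) x)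
    (hc : ContinuousOn f' (Icc 0 a)) {x : ℝ} (hx : x ∈ Icc 0 a) :
    f x = f 0 + ∫ t in (0 : ℝ)..x, f' t := by
  have hs : Icc 0 x ⊆ Icc 0 a := Icc_subset_Icc_right hx.2
  rw [intervalIntegral.integral_eq_sub_of_hasDerivAt_of_le hx.1
    (fun y hy => ((hf y (hs hy)).continuousWithinAt).mono hs)
    (fun y hy => (hf y (hs (Ioo_subset_Icc_self hy))).hasDerivAt
      (Icc_mem_nhds hy.1 (hy.2.trans_le hx.2)))
    ((hc.mono hs).intervalIntegrable_of_Icc hx.1)]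
  ring

/-- Real and imaginary parts are treated separately and recombined as multiples of the constants `1`
and `I`. -/
theorem absolutelyContinuousOnInterval_add_intervalIntegral {a : ℝ} {K : ℝ → ℂ} (c : ℂ)
    (hK : IntervalIntegrable K volume 0 a) :
    AbsolutelyContinuousOnInterval (fun x => c + ∫ t in (0 : ℝ)..x, K t) 0 a := by
  have hc : ∀ c : ℂ, AbsolutelyContinuousOnInterval (fun _ : ℝ => c) 0 a := fun c =>
    (LipschitzWith.const c).lipschitzOnWith.absolutelyContinuousOnInterval
  have h0 : (0 : ℝ) ∈ uIcc 0 a := left_mem_uIcc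
  have hre : IntervalIntegrable (fun t => (K t).re) volume 0 a := ⟨hK.1.re, hK.2.re⟩
  have him : IntervalIntegrable (fun t => (K t).im) volume 0 a := ⟨hK.1.im, hK.2.im⟩
  have key : AbsolutelyContinuousOnInterval (fun x => c + ((∫ t in (0 : ℝ)..x, (K t).re) • (1 : ℂ)
      + (∫ t in (0 : ℝ)..x, (K t).im) • Complex.I)) 0 a :=
    (hc c).add (((hre.absolutelyContinuousOnInterval_intervalIntegral h0).smul (hc 1)).add
      ((him.absolutelyContinuousOnInterval_intervalIntegral h0).smul (hc Complex.I)))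
  have hcongr : ∀ x ∈ uIcc 0 a, c + ((∫ t in (0 : ℝ)..x, (K t).re) • (1 : ℂ)
      + (∫ t in (0 : ℝ)..x, (K t).im) • Complex.I) = c + ∫ t in (0 : ℝ)..x, K t := by
    intro x hx
    have hs : uIcc 0 x ⊆ uIcc 0 a := uIcc_subset_uIcc h0 hx
    rw [← intervalIntegral.integral_smul_const, ← intervalIntegral.integral_smul_const,
      ← intervalIntegral.integral_add]
    · simp only [Complex.real_smul, mul_one, Complex.re_add_im]
    · exact ⟨(hre.mono_set hs).1.smul_const _, (hre.mono_set hs).2.smul_const _⟩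
    · exact ⟨(him.mono_set hs).1.smul_const _, (him.mono_set hs).2.smul_const _⟩
  -- Absolute continuity is a limit statement about sums of increments within the interval, so it
  -- passes to a function that agrees there.
  refine Filter.Tendsto.congr' ?_ key
  rw [Filter.EventuallyEq, Filter.eventually_inf_principal]
  filter_upwards with p hp
  refine Finset.sum_congr rfl (fun i hi => ?_)
  rw [hcongr _ (hp.1 i hi).1, hcongr _ (hp.1 i hi).2]

/-- Integration by parts for two functions which are integrals of integrable functions. -/
theorem integral_by_parts_of_primitive {a : ℝ} (ha : 0 ≤ a) {u v G K : ℝ → ℂ}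
    (hG : IntervalIntegrable G volume 0 a) (hK : IntervalIntegrable K volume 0 a)
    (hu : ∀ x ∈ Icc (0 : ℝ) a, u x = u 0 + ∫ t in (0 : ℝ)..x, G t)
    (hv : ∀ x ∈ Icc (0 : ℝ) a, v x = v 0 + ∫ t in (0 : ℝ)..x, K t) :
    IntervalIntegrable (fun t => G t * v t) volume 0 a ∧
    IntervalIntegrable (fun t => u t * K t) volume 0 a ∧
    (∫ t in (0 : ℝ)..a, G t * v t) + ∫ t in (0 : ℝ)..a, u t * K t = u a * v a - u 0 * v 0 := by
  have hI : uIcc 0 a = Icc 0 a := uIcc_of_le ha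
  have h0 : (0 : ℝ) ∈ uIcc 0 a := left_mem_uIcc
  obtain ⟨U, hU⟩ : ∃ U : ℝ → ℂ, U = fun x => u 0 + ∫ t in (0 : ℝ)..x, G t := ⟨_, rfl⟩
  obtain ⟨V, hV⟩ : ∃ V : ℝ → ℂ, V = fun x => v 0 + ∫ t in (0 : ℝ)..x, K t := ⟨_, rfl⟩
  have aU : AbsolutelyContinuousOnInterval U 0 a := by
    rw [hU]; exact absolutelyContinuousOnInterval_add_intervalIntegral _ hG
  have aV : AbsolutelyContinuousOnInterval V 0 a := by
    rw [hV]; exact absolutelyContinuousOnInterval_add_intervalIntegral _ hK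
  have eU : ∀ x ∈ Icc 0 a, u x = U x := fun x hx => by rw [hu x hx, hU]
  have eV : ∀ x ∈ Icc 0 a, v x = V x := fun x hx => by rw [hv x hx, hV]
  have i1 : IntervalIntegrable (fun t => G t * V t) volume 0 a :=
    hG.mul_continuousOn aV.continuousOn
  have i2 : IntervalIntegrable (fun t => U t * K t) volume 0 a :=
    hK.continuousOn_mul aU.continuousOn
  have e1 : EqOn (fun t => G t * V t) (fun t => G t * v t) (uIcc 0 a) := fun t ht => by
    simp only [eV t (hI ▸ ht)]
  have e2 : EqOn (fun t => U t * K t) (fun t => u t * K t) (uIcc 0 a) := fun t ht => by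
    simp only [eU t (hI ▸ ht)]
  refine ⟨i1.congr (e1.mono uIoc_subset_uIcc), i2.congr (e2.mono uIoc_subset_uIcc), ?_⟩
  rw [← intervalIntegral.integral_congr e1, ← intervalIntegral.integral_congr e2,
    ← intervalIntegral.integral_add i1 i2]
  have iI := i1.add i2
  obtain ⟨W, hW⟩ : ∃ W : ℝ → ℂ, W = fun x => 0 + ∫ t in (0 : ℝ)..x, (G t * V t + U t * K t) :=
    ⟨_, rfl⟩
  have aW : AbsolutelyContinuousOnInterval W 0 a := by
    rw [hW]; exact absolutelyContinuousOnInterval_add_intervalIntegral _ iI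
  -- Both factors are only differentiable almost everywhere. The product minus the integral of its
  -- formal derivative is absolutely continuous with vanishing derivative almost everywhere, hence
  -- constant.
  have ae0 : ∀ᵐ x, x ∈ uIcc 0 a → HasDerivAt (U • V - W) 0 x := by
    filter_upwards [hG.ae_hasDerivAt_integral, hK.ae_hasDerivAt_integral,
      iI.ae_hasDerivAt_integral] with x h1 h2 h3 hx
    have d1 : HasDerivAt U (G x) x := by rw [hU]; exact (h1 hx 0 h0).const_add _
    have d2 : HasDerivAt V (K x) x := by rw [hV]; exact (h2 hx 0 h0).const_add _
    have d3 : HasDerivAt W (G x * V x + U x * K x) x := by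
      rw [hW]; exact (h3 hx 0 h0).const_add _
    have := (d1.mul d2).sub d3
    rw [sub_self] at this
    exact this
  obtain ⟨C, hC⟩ := ((aU.smul aV).sub aW).const_of_ae_hasDerivAt_zero ae0
  have hCa := hC a right_mem_uIcc
  rw [← hC 0 h0] at hCa
  rw [eU a ⟨ha, le_rfl⟩, eV a ⟨ha, le_rfl⟩, eU 0 ⟨le_rfl, ha⟩, eV 0 ⟨le_rfl, ha⟩]
  have eW : W a = ∫ t in (0 : ℝ)..a, (G t * V t + U t * K t) := by
    simp only [hW, zero_add]
  have eW0 : W 0 = 0 := by simp [hW]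
  simp only [Pi.sub_apply, Pi.mul_apply, smul_eq_mul, eW0, eW, sub_zero] at hCa
  linear_combination -hCa

/-- Green's identity for functions with integrable second derivatives. -/
theorem integral_green {a : ℝ} (ha : 0 ≤ a) {f f' G g g' H : ℝ → ℂ}
    (hG : IntervalIntegrable G volume 0 a) (hH : IntervalIntegrable H volume 0 a)
    (hf : ∀ x ∈ Icc (0 : ℝ) a, HasDerivWithinAt f (f' x) (Icc (0 : ℝ) a) x)
    (hf' : ∀ x ∈ Icc (0 : ℝ) a, f' x = f' 0 + ∫ t in (0 : ℝ)..x, G t)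
    (hg : ∀ x ∈ Icc (0 : ℝ) a, HasDerivWithinAt g (g' x) (Icc (0 : ℝ) a) x)
    (hg' : ∀ x ∈ Icc (0 : ℝ) a, g' x = g' 0 + ∫ t in (0 : ℝ)..x, H t) :
    ∫ t in (0 : ℝ)..a, (G t * g t - f t * H t) =
      (f' a * g a - f a * g' a) - (f' 0 * g 0 - f 0 * g' 0) := by
  have cont : ∀ {w K : ℝ → ℂ}, IntervalIntegrable K volume 0 a →
      (∀ x ∈ Icc (0 : ℝ) a, w x = w 0 + ∫ t in (0 : ℝ)..x, K t) → ContinuousOn w (Icc 0 a) := by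
    intro w K hK hw
    refine ContinuousOn.congr ?_ hw
    rw [← uIcc_of_le ha]
    exact (absolutelyContinuousOnInterval_add_intervalIntegral _ hK).continuousOn
  have cf := cont hG hf'
  have cg := cont hH hg'
  obtain ⟨i1, -, h1⟩ := integral_by_parts_of_primitive ha hG (cg.intervalIntegrable_of_Icc ha) hf'
    (fun x hx => eq_add_integral_of_hasDerivWithinAt hg cg hx)
  obtain ⟨-, i2, h2⟩ := integral_by_parts_of_primitive ha (cf.intervalIntegrable_of_Icc ha) hH
    (fun x hx => eq_add_integral_of_hasDerivWithinAt hf cf hx) hg'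
  rw [intervalIntegral.integral_sub i1 i2]
  linear_combination h1 - h2

theorem HasSecondDeriv.inner_sub_inner {a : ℝ} (ha : 0 ≤ a)
    {F G F₂ G₂ : Lp ℂ 2 (volume.restrict (Ioc (0 : ℝ) a))} {f f' f₂ f₂' : ℝ → ℂ}
    (h : HasSecondDeriv a F G f f') (h₂ : HasSecondDeriv a F₂ G₂ f₂ f₂') :
    inner ℂ G F₂ - inner ℂ F G₂ =
      (starRingEnd ℂ (f' a) * f₂ a - starRingEnd ℂ (f a) * f₂' a) -
      (starRingEnd ℂ (f' 0) * f₂ 0 - starRingEnd ℂ (f 0) * f₂' 0) := by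
  have ma : a ∈ Icc 0 a := ⟨ha, le_rfl⟩
  have hG := Lp_intervalIntegrable G ma
  have hG₂ := Lp_intervalIntegrable G₂ ma
  have hGc : IntervalIntegrable (fun t => starRingEnd ℂ (G t)) volume 0 a :=
    ⟨(Complex.conjCLE.toContinuousLinearMap.integrable_comp hG.1),
      (Complex.conjCLE.toContinuousLinearMap.integrable_comp hG.2)⟩
  rw [L2.inner_def, L2.inner_def, ← integral_sub (L2.integrable_inner _ _) (L2.integrable_inner _ _)]
  rw [← integral_green ha (f := fun t => starRingEnd ℂ (f t)) (f' := fun t => starRingEnd ℂ (f' t))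
    hGc hG₂ (fun x hx => ?_) (fun x hx => ?_) h₂.2.1 h₂.2.2,
    intervalIntegral.integral_of_le ha]
  · refine integral_congr_ae ?_
    filter_upwards [h.1, h₂.1] with x h1 h2
    simp only [RCLike.inner_apply, h1, h2]
    ring
  · exact (h.2.1 x hx).star
  · rw [h.2.2 x hx, map_add, intervalIntegral.integral_of_le hx.1,
      intervalIntegral.integral_of_le hx.1, integral_conj]

/-- A continuous function as an element of `L²(0, a)`. -/
noncomputable def edgeLp (a : ℝ) (u : ℝ → ℂ) (hu : Continuous u) :
    Lp ℂ 2 (volume.restrict (Ioc (0 : ℝ) a)) :=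
  MemLp.toLp u <| by
    obtain ⟨M, hM⟩ := (isCompact_Icc (a := (0 : ℝ)) (b := a)).exists_bound_of_continuousOn
      hu.continuousOn
    refine MemLp.of_bound hu.aestronglyMeasurable M ?_
    exact (ae_restrict_iff' measurableSet_Ioc).2
      (Filter.Eventually.of_forall fun x hx => hM x (Ioc_subset_Icc_self hx))

theorem edgeLp_coeFn (a : ℝ) (u : ℝ → ℂ) (hu : Continuous u) :
    edgeLp a u hu =ᵐ[volume.restrict (Ioc (0 : ℝ) a)] u :=
  MemLp.coeFn_toLp _

theorem norm_le_of_ae_bound_Ioc {a : ℝ} (ha : 0 ≤ a)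
    (F : Lp ℂ 2 (volume.restrict (Ioc (0 : ℝ) a))) {u : ℝ → ℂ}
    (hF : F =ᵐ[volume.restrict (Ioc (0 : ℝ) a)] u) {M : ℝ} (hM0 : 0 ≤ M)
    (hM : ∀ x ∈ Icc 0 a, ‖u x‖ ≤ M) : ‖F‖ ≤ √a * M := by
  have h : ∀ᵐ x ∂(volume.restrict (Ioc (0 : ℝ) a)), ‖F x‖ ≤ M := by
    filter_upwards [hF, ae_restrict_mem measurableSet_Ioc] with x h1 h2
    rw [h1]
    exact hM x (Ioc_subset_Icc_self h2)
  have := Lp.norm_le_of_ae_bound hM0 h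
  refine this.trans (le_of_eq ?_)
  rw [Real.sqrt_eq_rpow]
  have e : ((measureUnivNNReal (volume.restrict (Ioc (0 : ℝ) a)) : NNReal) : ℝ) = a := by
    simp only [measureUnivNNReal, Measure.restrict_apply_univ, Real.volume_Ioc, sub_zero]
    exact ENNReal.toReal_ofReal ha
  rw [e]
  norm_num

theorem hasSecondDeriv_edgeLp {a : ℝ} {u u' u'' : ℝ → ℂ}
    (hu : ∀ x, HasDerivAt u (u' x) x) (hu' : ∀ x, HasDerivAt u' (u'' x) x)
    (hc : Continuous u) (hc'' : Continuous u'') :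
    HasSecondDeriv a (edgeLp a u hc) (edgeLp a u'' hc'') u u' := by
  refine ⟨edgeLp_coeFn a u hc, fun x _ => (hu x).hasDerivWithinAt, fun x hx => ?_⟩
  have e : ∫ t in (0 : ℝ)..x, edgeLp a u'' hc'' t = ∫ t in (0 : ℝ)..x, u'' t := by
    rw [intervalIntegral.integral_of_le hx.1, intervalIntegral.integral_of_le hx.1]
    exact integral_congr_ae (ae_mono (Measure.restrict_mono (Ioc_subset_Ioc_right hx.2) le_rfl)
      (edgeLp_coeFn a u'' hc''))
  rw [e, intervalIntegral.integral_eq_sub_of_hasDerivAt (fun y _ => hu' y)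
    (hc''.intervalIntegrable _ _)]
  ring

/-- Cubic Hermite interpolation. -/
theorem exists_hermite {a : ℝ} (ha : 0 < a) (p q r s : ℂ) : ∃ u u' u'' : ℝ → ℂ,
    (∀ x, HasDerivAt u (u' x) x) ∧ (∀ x, HasDerivAt u' (u'' x) x) ∧ Continuous u ∧
    Continuous u'' ∧ u 0 = p ∧ u' 0 = q ∧ u a = r ∧ u' a = s := by
  have ha' : (a : ℂ) ≠ 0 := by exact_mod_cast ha.ne'
  set c : ℂ := 3 * (r - p - q * a) / a ^ 2 - (s - q) / a with hc
  set d : ℂ := (s - q) / a ^ 2 - 2 * (r - p - q * a) / a ^ 3 with hd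
  have hid : ∀ x : ℝ, HasDerivAt (fun x : ℝ => (x : ℂ)) 1 x := fun x =>
    Complex.ofRealCLM.hasDerivAt
  refine ⟨fun x => p + q * x + c * x ^ 2 + d * x ^ 3, fun x => q + 2 * c * x + 3 * d * x ^ 2,
    fun x => 2 * c + 6 * d * x, fun x => ?_, fun x => ?_, by fun_prop, by fun_prop, by simp,
    by simp, ?_, ?_⟩
  · have := ((((hid x).const_mul q).const_add p).add (((hid x).pow 2).const_mul c)).add
      (((hid x).pow 3).const_mul d)
    refine this.congr_deriv ?_
    push_cast
    ring
  · have := (((hid x).const_mul (2 * c)).const_add q).add (((hid x).pow 2).const_mul (3 * d))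
    refine this.congr_deriv ?_
    push_cast
    ring
  · simp only [hc, hd]; field_simp; ring
  · simp only [hc, hd]; field_simp; ring

/-- Boundary values are bounded functionals on `H²(0, a)`. -/
theorem exists_trace_bound {a : ℝ} (ha : 0 < a) : ∃ C : ℝ, 0 ≤ C ∧
    ∀ (F G : Lp ℂ 2 (volume.restrict (Ioc (0 : ℝ) a))) (f f' : ℝ → ℂ),
      HasSecondDeriv a F G f f' →
      ‖f 0‖ ≤ C * (‖F‖ + ‖G‖) ∧ ‖f a‖ ≤ C * (‖F‖ + ‖G‖) ∧
      ‖f' 0‖ ≤ C * (‖F‖ + ‖G‖) ∧ ‖f' a‖ ≤ C * (‖F‖ + ‖G‖) := by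
  -- Green's identity against a fixed cubic with boundary data `p, q, r, s` turns this combination
  -- of boundary values into two inner products, which Cauchy–Schwarz bounds.
  have key : ∀ p q r s : ℂ, ∃ C : ℝ, 0 ≤ C ∧
      ∀ (F G : Lp ℂ 2 (volume.restrict (Ioc (0 : ℝ) a))) (f f' : ℝ → ℂ),
      HasSecondDeriv a F G f f' →
      ‖(starRingEnd ℂ (f' a) * r - starRingEnd ℂ (f a) * s) -
        (starRingEnd ℂ (f' 0) * p - starRingEnd ℂ (f 0) * q)‖ ≤ C * (‖F‖ + ‖G‖) := by
    intro p q r s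
    obtain ⟨u, u', u'', h1, h2, h3, h4, rfl, rfl, rfl, rfl⟩ := exists_hermite ha p q r s
    have hs := hasSecondDeriv_edgeLp (a := a) h1 h2 h3 h4
    refine ⟨‖edgeLp a u h3‖ + ‖edgeLp a u'' h4‖, by positivity, fun F G f f' h => ?_⟩
    rw [← h.inner_sub_inner ha.le hs]
    refine (norm_sub_le _ _).trans ?_
    have i1 := norm_inner_le_norm (𝕜 := ℂ) G (edgeLp a u h3)
    have i2 := norm_inner_le_norm (𝕜 := ℂ) F (edgeLp a u'' h4)
    nlinarith [norm_nonneg F, norm_nonneg G, norm_nonneg (edgeLp a u h3),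
      norm_nonneg (edgeLp a u'' h4)]
  -- A single nonzero datum of the test function isolates one of the four boundary values.
  obtain ⟨C1, p1, h1⟩ := key 0 1 0 0
  obtain ⟨C2, p2, h2⟩ := key 0 0 0 1
  obtain ⟨C3, p3, h3⟩ := key 1 0 0 0
  obtain ⟨C4, p4, h4⟩ := key 0 0 1 0
  refine ⟨C1 + C2 + C3 + C4, by positivity, fun F G f f' h => ?_⟩
  have k1 := h1 F G f f' h
  have k2 := h2 F G f f' h
  have k3 := h3 F G f f' h
  have k4 := h4 F G f f' h
  simp only [mul_zero, mul_one, sub_zero, zero_sub, sub_neg_eq_add, zero_add, norm_neg,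
    RCLike.norm_conj] at k1 k2 k3 k4
  have hn : 0 ≤ ‖F‖ + ‖G‖ := by positivity
  refine ⟨k1.trans ?_, k2.trans ?_, k3.trans ?_, k4.trans ?_⟩ <;> gcongr <;> linarith

theorem integral_norm_le_sqrt_mul_norm {a : ℝ} (ha : 0 ≤ a)
    (h : Lp ℂ 2 (volume.restrict (Ioc (0 : ℝ) a))) : ∫ t in Ioc 0 a, ‖h t‖ ≤ √a * ‖h‖ := by
  have h1 := eLpNorm_le_eLpNorm_mul_rpow_measure_univ (p := 1) (q := 2) (by norm_num)
    (Lp.aestronglyMeasurable h)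
  rw [Measure.restrict_apply_univ, Real.volume_Ioc, sub_zero] at h1
  have h2 := ENNReal.toReal_mono (ENNReal.mul_ne_top (Lp.eLpNorm_ne_top h) (by
    refine ENNReal.rpow_ne_top_of_nonneg (by norm_num) ENNReal.ofReal_ne_top)) h1
  rw [ENNReal.toReal_mul, ← Lp.norm_def, ← ENNReal.toReal_rpow, ENNReal.toReal_ofReal ha,
    eLpNorm_one_eq_lintegral_enorm, ← integral_norm_eq_lintegral_enorm
    (Lp.aestronglyMeasurable h), mul_comm] at h2
  refine h2.trans (le_of_eq ?_)
  rw [Real.sqrt_eq_rpow]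
  norm_num

/-- The first two primitives of a square integrable function. -/
theorem exists_double_primitive {a : ℝ} (ha : 0 ≤ a)
    (h : Lp ℂ 2 (volume.restrict (Ioc (0 : ℝ) a))) : ∃ H₁ H₂ : ℝ → ℂ,
      (∀ x, HasDerivAt H₂ (H₁ x) x) ∧ H₁ 0 = 0 ∧ H₂ 0 = 0 ∧
      (∀ x ∈ Icc 0 a, H₁ x = ∫ t in (0 : ℝ)..x, h t) ∧
      (∀ x ∈ Icc 0 a, ‖H₁ x‖ ≤ √a * ‖h‖) ∧ (∀ x ∈ Icc 0 a, ‖H₂ x‖ ≤ a * √a * ‖h‖) := by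
  have hint : IntegrableOn h (Ioc (0 : ℝ) a) volume := (Lp.memLp h).integrable (by norm_num)
  -- Extension by zero makes the first primitive continuous on the whole line, hence the second one
  -- differentiable there.
  obtain ⟨g, hg⟩ : ∃ g : ℝ → ℂ, g = (Ioc 0 a).indicator h := ⟨_, rfl⟩
  have ig : Integrable g := hg ▸ (integrable_indicator_iff measurableSet_Ioc).2 hint
  have iig : ∀ x y, IntervalIntegrable g volume x y := fun x y => ig.intervalIntegrable
  obtain ⟨H₁, hH₁⟩ : ∃ H₁ : ℝ → ℂ, H₁ = fun x => ∫ t in (0 : ℝ)..x, g t := ⟨_, rfl⟩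
  have cH₁ : Continuous H₁ := hH₁ ▸ intervalIntegral.continuous_primitive iig 0
  have bH₁ : ∀ x ∈ Icc 0 a, ‖H₁ x‖ ≤ √a * ‖h‖ := by
    intro x hx
    have h1 : ‖H₁ x‖ ≤ ∫ t in Ioc 0 a, ‖h t‖ := by
      rw [hH₁]
      refine (intervalIntegral.norm_integral_le_integral_norm hx.1).trans ?_
      rw [intervalIntegral.integral_of_le hx.1]
      refine (setIntegral_mono_set ig.norm.integrableOn (Filter.Eventually.of_forall
        fun _ => norm_nonneg _) (Ioc_subset_Ioc_right hx.2).eventuallyLE).trans (le_of_eq ?_)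
      refine setIntegral_congr_fun measurableSet_Ioc fun t ht => ?_
      simp only [hg, indicator_of_mem ht]
    exact h1.trans (integral_norm_le_sqrt_mul_norm ha h)
  refine ⟨H₁, fun x => ∫ t in (0 : ℝ)..x, H₁ t, fun x =>
    (cH₁.integral_hasStrictDerivAt 0 x).hasDerivAt, by simp [hH₁], by simp, fun x hx => ?_, bH₁,
    fun x hx => ?_⟩
  · rw [hH₁]
    simp only
    rw [intervalIntegral.integral_of_le hx.1, intervalIntegral.integral_of_le hx.1]
    refine setIntegral_congr_fun measurableSet_Ioc fun t ht => ?_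
    simp only [hg, indicator_of_mem (Ioc_subset_Ioc_right hx.2 ht)]
  · refine (intervalIntegral.norm_integral_le_of_norm_le_const (C := √a * ‖h‖)
      fun t ht => ?_).trans ?_
    · rw [uIoc_of_le hx.1] at ht
      exact bH₁ t ⟨ht.1.le, ht.2.trans hx.2⟩
    · rw [sub_zero, abs_of_nonneg hx.1]
      calc √a * ‖h‖ * x ≤ √a * ‖h‖ * a := by gcongr; exact hx.2
        _ = _ := by ring

theorem exists_bounded_primitive {a M N : ℝ} {c u : ℝ → ℂ} (hM : 0 ≤ M) (hN : 0 ≤ N)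
    (hc : Continuous c) (hu : Continuous u) (hcM : ∀ x ∈ Icc 0 a, ‖c x‖ ≤ M)
    (huN : ∀ x ∈ Icc 0 a, ‖u x‖ ≤ N) : ∃ A : ℝ → ℂ,
      (∀ x, HasDerivAt A (c x * u x) x) ∧ A 0 = 0 ∧ ∀ x ∈ Icc 0 a, ‖A x‖ ≤ M * N * a := by
  refine ⟨fun x => ∫ t in (0 : ℝ)..x, c t * u t, fun x =>
    ((hc.mul hu).integral_hasStrictDerivAt 0 x).hasDerivAt, by simp, fun x hx => ?_⟩
  refine (intervalIntegral.norm_integral_le_of_norm_le_const (C := M * N) fun t ht => ?_).trans ?_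
  · rw [uIoc_of_le hx.1] at ht
    have ht' : t ∈ Icc 0 a := ⟨ht.1.le, ht.2.trans hx.2⟩
    rw [norm_mul]
    exact mul_le_mul (hcM t ht') (huN t ht') (norm_nonneg _) hM
  · rw [sub_zero, abs_of_nonneg hx.1]
    gcongr
    exact hx.2

theorem hasDerivAt_cos_const_mul (k : ℂ) (x : ℝ) :
    HasDerivAt (fun x : ℝ => Complex.cos (k * x)) (-Complex.sin (k * x) * k) x := by
  have := (Complex.hasDerivAt_cos (k * x)).comp x
    ((Complex.ofRealCLM.hasDerivAt (x := x)).const_mul k)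
  simpa [Function.comp_def] using this

theorem hasDerivAt_sin_const_mul (k : ℂ) (x : ℝ) :
    HasDerivAt (fun x : ℝ => Complex.sin (k * x)) (Complex.cos (k * x) * k) x := by
  have := (Complex.hasDerivAt_sin (k * x)).comp x
    ((Complex.ofRealCLM.hasDerivAt (x := x)).const_mul k)
  simpa [Function.comp_def] using this

theorem exists_cos_sin_bound (a : ℝ) (k : ℂ) : ∃ M : ℝ, 0 ≤ M ∧
    (∀ x ∈ Icc (0 : ℝ) a, ‖Complex.cos (k * x)‖ ≤ M) ∧
    ∀ x ∈ Icc (0 : ℝ) a, ‖Complex.sin (k * x)‖ ≤ M := by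
  have ccos : Continuous fun x : ℝ => Complex.cos (k * x) := by fun_prop
  have csin : Continuous fun x : ℝ => Complex.sin (k * x) := by fun_prop
  obtain ⟨M₁, hM₁⟩ := (isCompact_Icc (a := (0 : ℝ)) (b := a)).exists_bound_of_continuousOn
    ccos.continuousOn
  obtain ⟨M₂, hM₂⟩ := (isCompact_Icc (a := (0 : ℝ)) (b := a)).exists_bound_of_continuousOn
    csin.continuousOn
  refine ⟨max (max M₁ M₂) 0, le_max_right _ _, fun x hx => ?_, fun x hx => ?_⟩
  · exact (hM₁ x hx).trans ((le_max_left _ _).trans (le_max_left _ _))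
  · exact (hM₂ x hx).trans ((le_max_right _ _).trans (le_max_left _ _))

/-- A solution of `f'' = -k² (f + H₂)` with zero initial data, together with bounds. -/
theorem exists_volterra {a : ℝ} (ha : 0 < a) {k : ℂ} (hk : k ≠ 0) : ∃ P Q : ℝ, 0 ≤ P ∧ 0 ≤ Q ∧
    ∀ (H₂ : ℝ → ℂ) (N : ℝ), Continuous H₂ → 0 ≤ N → (∀ x ∈ Icc 0 a, ‖H₂ x‖ ≤ N) →
      ∃ w w' : ℝ → ℂ, (∀ x, HasDerivAt w (w' x) x) ∧
        (∀ x, HasDerivAt w' (-(k ^ 2 * (w x - H₂ x))) x) ∧ w 0 = 0 ∧ w' 0 = 0 ∧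
        (∀ x ∈ Icc 0 a, ‖w x‖ ≤ P * N) ∧ (∀ x ∈ Icc 0 a, ‖w' x‖ ≤ Q * N) := by
  obtain ⟨M, hM0, hMc, hMs⟩ := exists_cos_sin_bound a k
  refine ⟨‖k‖ * (M * (M * a) + M * (M * a)), ‖k‖ ^ 2 * (M * (M * a) + M * (M * a)),
    by positivity, by positivity, fun H₂ N cH₂ hN0 bH₂ => ?_⟩
  have ccos : Continuous fun x : ℝ => Complex.cos (k * x) := by fun_prop
  have csin : Continuous fun x : ℝ => Complex.sin (k * x) := by fun_prop
  obtain ⟨A, dA, A0, bA⟩ := exists_bounded_primitive hM0 hN0 ccos cH₂ hMc bH₂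
  obtain ⟨B, dB, B0, bB⟩ := exists_bounded_primitive hM0 hN0 csin cH₂ hMs bH₂
  -- Variation of constants: this is `k ∫ sin (k (x - t)) H₂ t dt`, expanded by the addition
  -- theorem.
  refine ⟨fun x => k * (Complex.sin (k * x) * A x - Complex.cos (k * x) * B x),
    fun x => k ^ 2 * (Complex.cos (k * x) * A x + Complex.sin (k * x) * B x),
    fun x => ?_, fun x => ?_, by simp [A0, B0], by simp [A0, B0], fun x hx => ?_, fun x hx => ?_⟩
  · refine ((((hasDerivAt_sin_const_mul k x).mul (dA x)).sub
      ((hasDerivAt_cos_const_mul k x).mul (dB x))).const_mul k).congr_deriv ?_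
    ring
  · refine ((((hasDerivAt_cos_const_mul k x).mul (dA x)).add
      ((hasDerivAt_sin_const_mul k x).mul (dB x))).const_mul (k ^ 2)).congr_deriv ?_
    linear_combination (k ^ 2 * H₂ x) * Complex.sin_sq_add_cos_sq (k * x)
  · rw [norm_mul, mul_assoc]
    gcongr
    refine (norm_sub_le _ _).trans ?_
    rw [norm_mul, norm_mul, add_mul, mul_assoc M, mul_right_comm M a]
    gcongr
    exacts [hMs x hx, bA x hx, hMc x hx, bB x hx]
  · rw [norm_mul, norm_pow, mul_assoc]
    gcongr
    refine (norm_add_le _ _).trans ?_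
    rw [norm_mul, norm_mul, add_mul, mul_assoc M, mul_right_comm M a]
    gcongr
    exacts [hMc x hx, bA x hx, hMs x hx, bB x hx]

/-- The initial value problem for `-f'' = k² f + h` with `h ∈ L²(0, a)`: the solution differs from
that of the homogeneous equation by terms which are bounded by `h`. -/
theorem exists_edge_solution {a : ℝ} (ha : 0 < a) {k : ℂ} (hk : k ≠ 0) : ∃ C : ℝ, 0 ≤ C ∧
    ∀ h : Lp ℂ 2 (volume.restrict (Ioc (0 : ℝ) a)), ∃ p q : ℂ, ‖p‖ ≤ C * ‖h‖ ∧ ‖q‖ ≤ C * ‖h‖ ∧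
      ∀ α β : ℂ, ∃ (F : Lp ℂ 2 (volume.restrict (Ioc (0 : ℝ) a))) (f f' : ℝ → ℂ),
        HasSecondDeriv a F (-(k ^ 2 • F + h)) f f' ∧ f 0 = α ∧ f' 0 = β ∧
        f a = α * Complex.cos (k * a) + β * Complex.sin (k * a) / k + p ∧
        f' a = -α * k * Complex.sin (k * a) + β * Complex.cos (k * a) + q ∧
        ‖F‖ ≤ C * (‖h‖ + ‖α‖ + ‖β‖) := by
  obtain ⟨M, hM0, hMc, hMs⟩ := exists_cos_sin_bound a k
  obtain ⟨P₀, Q₀, hP₀, hQ₀, hV⟩ := exists_volterra ha hk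
  set P : ℝ := P₀ * (a * √a) + a * √a with hP
  have hP0 : 0 ≤ P := by positivity
  set Q : ℝ := Q₀ * (a * √a) + √a with hQ
  have hQ0 : 0 ≤ Q := by positivity
  set S : ℝ := √a * (P + M + M / ‖k‖) with hS
  have hS0 : 0 ≤ S := by positivity
  refine ⟨P + Q + S, by positivity, fun h => ?_⟩
  obtain ⟨H₁, H₂, dH₂, H₁0, H₂0, eH₁, bH₁, bH₂⟩ := exists_double_primitive ha.le h
  have cH₂ : Continuous H₂ := continuous_iff_continuousAt.2 fun x => (dH₂ x).continuousAt
  obtain ⟨w, w', dw, dw', w0, w'0, bw, bw'⟩ := hV H₂ (a * √a * ‖h‖) cH₂ (by positivity) bH₂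
  have bp : ∀ x ∈ Icc 0 a, ‖w x - H₂ x‖ ≤ P * ‖h‖ := by
    intro x hx
    refine (norm_sub_le _ _).trans ?_
    have := bw x hx
    have := bH₂ x hx
    rw [hP]
    linarith
  have bq : ∀ x ∈ Icc 0 a, ‖w' x - H₁ x‖ ≤ Q * ‖h‖ := by
    intro x hx
    refine (norm_sub_le _ _).trans ?_
    have := bw' x hx
    have := bH₁ x hx
    rw [hQ]
    linarith
  have ma : a ∈ Icc 0 a := ⟨ha.le, le_rfl⟩
  -- The contributions of `h` at the right end do not depend on the initial data, which can
  -- therefore be adjusted to the vertex conditions afterwards.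
  refine ⟨w a - H₂ a, w' a - H₁ a, (bp a ma).trans ?_, (bq a ma).trans ?_, fun α β => ?_⟩
  · gcongr; linarith
  · gcongr; linarith
  -- The source `h` is merely square integrable. Splitting off its second primitive leaves the
  -- continuous source `H₂`, so that `v = f' + H₁` is differentiable everywhere.
  obtain ⟨f, hf⟩ : ∃ f : ℝ → ℂ, f = fun x : ℝ => α * Complex.cos (k * x) + β / k * Complex.sin (k * x)
      + (w x - H₂ x) := ⟨_, rfl⟩
  obtain ⟨v, hv⟩ : ∃ v : ℝ → ℂ, v = fun x : ℝ => -α * k * Complex.sin (k * x)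
      + β * Complex.cos (k * x) + w' x := ⟨_, rfl⟩
  have df : ∀ x, HasDerivAt f (v x - H₁ x) x := by
    intro x
    rw [hf]
    refine ((((hasDerivAt_cos_const_mul k x).const_mul α).add
      ((hasDerivAt_sin_const_mul k x).const_mul (β / k))).add ((dw x).sub (dH₂ x))).congr_deriv ?_
    rw [hv]
    field_simp
    ring
  have dv : ∀ x, HasDerivAt v (-(k ^ 2 * f x)) x := by
    intro x
    rw [hv]
    refine ((((hasDerivAt_sin_const_mul k x).const_mul (-α * k)).add
      ((hasDerivAt_cos_const_mul k x).const_mul β)).add (dw' x)).congr_deriv ?_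
    rw [hf]
    have hkk : β / k * k ^ 2 = β * k := by field_simp
    linear_combination (Complex.sin (k * x)) * hkk
  have cf : Continuous f := continuous_iff_continuousAt.2 fun x => (df x).continuousAt
  refine ⟨edgeLp a f cf, f, fun x => v x - H₁ x, ⟨edgeLp_coeFn _ _ _,
    fun x _ => (df x).hasDerivWithinAt, fun x hx => ?_⟩, ?_, ?_, ?_, ?_, ?_⟩
  · have e : ∫ t in (0 : ℝ)..x, (-(k ^ 2 • edgeLp a f cf + h)) t =
        ∫ t in (0 : ℝ)..x, (-(k ^ 2 * f t) - h t) := by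
      rw [intervalIntegral.integral_of_le hx.1, intervalIntegral.integral_of_le hx.1]
      refine integral_congr_ae
        (ae_mono (Measure.restrict_mono (Ioc_subset_Ioc_right hx.2) le_rfl) ?_)
      filter_upwards [Lp.coeFn_neg (k ^ 2 • edgeLp a f cf + h),
        Lp.coeFn_add (k ^ 2 • edgeLp a f cf) h, Lp.coeFn_smul (k ^ 2) (edgeLp a f cf),
        edgeLp_coeFn a f cf] with t h1 h2 h3 h4
      rw [h1, Pi.neg_apply, h2, Pi.add_apply, h3, Pi.smul_apply, h4, smul_eq_mul]
      ring
    have c2 : Continuous fun t => -(k ^ 2 * f t) := by fun_prop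
    rw [e, intervalIntegral.integral_sub (c2.intervalIntegrable _ _) (Lp_intervalIntegrable h hx),
      intervalIntegral.integral_eq_sub_of_hasDerivAt (fun y _ => dv y) (c2.intervalIntegrable _ _)]
    simp only [H₁0, eH₁ x hx]
    ring
  · simp [hf, w0, H₂0]
  · simp [hv, w'0, H₁0]
  · simp only [hf]; ring
  · simp only [hv]; ring
  · have : ∀ x ∈ Icc 0 a, ‖f x‖ ≤ (P + M + M / ‖k‖) * (‖h‖ + ‖α‖ + ‖β‖) := by
      intro x hx
      have e : f x = (α * Complex.cos (k * x) + β / k * Complex.sin (k * x)) +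
          (w x - H₂ x) := by
        rw [hf]
      rw [e]
      refine (norm_add_le _ _).trans ((add_le_add_left (norm_add_le _ _) _).trans ?_)
      rw [norm_mul, norm_mul, norm_div]
      have h1 : ‖α‖ * ‖Complex.cos (k * x)‖ ≤ M * ‖α‖ := by
        rw [mul_comm]; gcongr; exact hMc x hx
      have h2 : ‖β‖ / ‖k‖ * ‖Complex.sin (k * x)‖ ≤ M / ‖k‖ * ‖β‖ := by
        calc _ ≤ ‖β‖ / ‖k‖ * M := by gcongr; exact hMs x hx
          _ = _ := by ring
      have h3 := bp x hx
      have hMk : 0 ≤ M / ‖k‖ := by positivity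
      nlinarith [norm_nonneg h, norm_nonneg α, norm_nonneg β, mul_nonneg hP0 (norm_nonneg α),
        mul_nonneg hP0 (norm_nonneg β), mul_nonneg hM0 (norm_nonneg h),
        mul_nonneg hM0 (norm_nonneg β), mul_nonneg hMk (norm_nonneg h),
        mul_nonneg hMk (norm_nonneg α)]
    refine (norm_le_of_ae_bound_Ioc ha.le _ (edgeLp_coeFn a f cf) (by positivity) this).trans ?_
    rw [← mul_assoc]
    gcongr
    linarith

/-! ### Networks whose edges are coupled through common derivatives at the vertices -/

/-- The edges `φ (j, v)` of the network lead from the vertex `v` to the vertex `τ j v` and have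
length `ℓ j`. At every vertex `v`, the derivatives at the initial points of the outgoing edges and
`ε` times those at the end points of the incoming edges have a common value `a v`, and the
corresponding signed sum of the boundary values is `D * a v`. -/
structure IsDerivCoupling {E V J : Type} [Fintype J] (φ : J × V ≃ E) (τ : J → V ≃ V) (ε D : ℝ)
    (ℓ : J → ℝ) (L : E → ℝ) (B : Submodule ℂ (BoundaryData E)) : Prop where
  pos : ∀ j, 0 < ℓ j
  length : ∀ j v, L (φ (j, v)) = ℓ j
  sign : ε * ε = 1
  mem_iff : ∀ b, b ∈ B ↔ ∃ a : V → ℂ, ∀ v,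
    (∀ j, b.2.2.1 (φ (j, v)) = a v ∧ b.2.2.2 (φ (j, v)) = ε * a (τ j v)) ∧
    ∑ j, (b.1 (φ (j, v)) - ε * b.2.1 (φ (j, (τ j).symm v))) = D * a v

theorem summable_norm_sq {ι : Type} {G : ι → Type} [∀ i, NormedAddCommGroup (G i)] {f : ∀ i, G i}
    (hf : Memℓp f 2) : Summable fun i => ‖f i‖ ^ 2 := by
  have := hf.summable (by norm_num)
  simpa using this

theorem memℓp_two_of_le {ι : Type} {G : ι → Type} [∀ i, NormedAddCommGroup (G i)] {f : ∀ i, G i}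
    {g : ι → ℝ} (hg : Memℓp g 2) (h : ∀ i, ‖f i‖ ≤ g i) : Memℓp f 2 := by
  refine memℓp_gen ?_
  refine Summable.of_nonneg_of_le (fun i => by positivity) (fun i => ?_) (summable_norm_sq hg)
  simp only [ENNReal.toReal_ofNat, Real.rpow_ofNat, Real.norm_eq_abs, sq_abs]
  gcongr
  exact h i

theorem memℓp_comp_injective {ι κ : Type} {G : ι → Type} [∀ i, NormedAddCommGroup (G i)]
    {f : ∀ i, G i} (hf : Memℓp f 2) {σ : κ → ι} (hσ : Function.Injective σ) :
    Memℓp (fun k => f (σ k)) 2 := by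
  refine memℓp_gen ?_
  have := (hf.summable (by norm_num)).comp_injective hσ
  exact this

/-! ### The difference equation on the vertices -/

section Shift

variable {V : Type}

/-- Composition with a permutation, on `ℓ²(V)`. -/
noncomputable def permLp (σ : V ≃ V) : lp (fun _ : V => ℂ) 2 →L[ℂ] lp (fun _ : V => ℂ) 2 :=
  LinearMap.mkContinuous
    { toFun := fun a => ⟨fun v => a (σ v), memℓp_comp_injective (lp.memℓp a) σ.injective⟩
      map_add' := fun _ _ => rfl
      map_smul' := fun _ _ => rfl } 1 (fun a => by
    refine lp.norm_le_of_tsum_le (by norm_num) (by positivity) ?_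
    rw [one_mul, lp.norm_rpow_eq_tsum (by norm_num)]
    exact (σ.tsum_eq (fun v => ‖a v‖ ^ (2 : ENNReal).toReal)).le)

theorem norm_permLp_le (σ : V ≃ V) : ‖permLp σ‖ ≤ 1 :=
  LinearMap.mkContinuous_norm_le _ zero_le_one _

/-- A diagonally dominant equation on `ℓ²(V)` is solvable. -/
theorem exists_solution_of_dominant {J : Type} [Fintype J] (τ : J → V ≃ V) (A : ℂ) (x : J → ℂ)
    (hA : 2 * ∑ j, ‖x j‖ < ‖A‖) {b : V → ℂ} (hb : Memℓp b 2) :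
    ∃ a : V → ℂ, Memℓp a 2 ∧
      ∀ v, A * a v - ∑ j, x j * (a (τ j v) + a ((τ j).symm v)) = b v := by
  set K : lp (fun _ : V => ℂ) 2 →L[ℂ] lp (fun _ : V => ℂ) 2 :=
    ∑ j, x j • (permLp (τ j) + permLp (τ j).symm) with hK
  have hKn : ‖K‖ ≤ 2 * ∑ j, ‖x j‖ := by
    rw [hK, Finset.mul_sum]
    refine (norm_sum_le _ _).trans (Finset.sum_le_sum fun j _ => ?_)
    rw [norm_smul]
    have := norm_add_le (permLp (τ j)) (permLp (τ j).symm)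
    nlinarith [norm_permLp_le (τ j), norm_permLp_le (τ j).symm, norm_nonneg (x j)]
  have hA0 : 0 < ‖A‖ := lt_of_le_of_lt (by positivity) hA
  have hA1 : A ≠ 0 := norm_pos_iff.1 hA0
  -- Permutations act as contractions on ℓ², so diagonal dominance makes the Neumann series for `1 -
  -- A⁻¹ K` converge.
  have hlt : ‖A⁻¹ • K‖ < 1 := by
    rw [norm_smul, norm_inv, inv_mul_lt_iff₀ hA0, mul_one]
    exact hKn.trans_lt hA
  let U := Units.oneSub (A⁻¹ • K) hlt
  let a : lp (fun _ : V => ℂ) 2 := (↑U⁻¹ : lp (fun _ : V => ℂ) 2 →L[ℂ] lp (fun _ : V => ℂ) 2) (A⁻¹ • (⟨b, hb⟩ : lp (fun _ : V => ℂ) 2))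
  have ha : a - A⁻¹ • K a = A⁻¹ • (⟨b, hb⟩ : lp (fun _ : V => ℂ) 2) := by
    have h1 := congrArg (fun T : lp (fun _ : V => ℂ) 2 →L[ℂ] lp (fun _ : V => ℂ) 2 =>
      T (A⁻¹ • (⟨b, hb⟩ : lp (fun _ : V => ℂ) 2))) U.mul_inv
    exact h1
  have ha2 : A • a - K a = ⟨b, hb⟩ := by
    have := congrArg (fun z => A • z) ha
    simpa [smul_sub, smul_smul, hA1] using this
  refine ⟨a, lp.memℓp a, fun v => ?_⟩
  have hv := congrFun (congrArg Subtype.val ha2) v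
  have hKv : K a v = ∑ j, x j * (a (τ j v) + a ((τ j).symm v)) := by
    rw [hK, sum_apply, lp.coeFn_sum, Finset.sum_apply]
    rfl
  rw [← hKv]
  exact hv

end Shift

namespace IsDerivCoupling

variable {E V J : Type} [Fintype J] {φ : J × V ≃ E} {τ : J → V ≃ V} {ε D : ℝ} {ℓ : J → ℝ}
  {L : E → ℝ} {B : Submodule ℂ (BoundaryData E)}

theorem length_pos (h : IsDerivCoupling φ τ ε D ℓ L B) (e : E) : 0 < L e := by
  obtain ⟨⟨j, v⟩, rfl⟩ := φ.surjective e
  rw [h.length]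
  exact h.pos j

/-- Only finitely many edge lengths occur, so constants that depend on the length can be replaced by
their sum. -/
theorem exists_uniform (h : IsDerivCoupling φ τ ε D ℓ L B) {P : ℝ → ℝ → Prop}
    (hm : ∀ a C C', C ≤ C' → P a C → P a C') (hP : ∀ a, 0 < a → ∃ C, 0 ≤ C ∧ P a C) :
    ∃ C, 0 ≤ C ∧ ∀ e, P (L e) C := by
  choose c hc0 hc using fun j => hP (ℓ j) (h.pos j)
  refine ⟨∑ j, c j, Finset.sum_nonneg fun j _ => hc0 j, fun e => ?_⟩
  obtain ⟨⟨j, v⟩, rfl⟩ := φ.surjective e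
  rw [h.length]
  exact hm _ _ _ (Finset.single_le_sum (fun i _ => hc0 i) (Finset.mem_univ j)) (hc j)

/-- The boundary terms are regrouped from edges to vertices. At each vertex the common derivative
factors out and leaves the signed sums of boundary values, which are `D` times the common
derivatives; since `D` is real, the two contributions cancel. -/
theorem tsum_boundary_eq_zero (h : IsDerivCoupling φ τ ε D ℓ L B) {f g : BoundaryData E}
    (hf : f ∈ B) (hg : g ∈ B) {R S : E → ℂ}
    (hR : ∀ e, R e = starRingEnd ℂ (f.2.2.2 e) * g.2.1 e - starRingEnd ℂ (f.2.1 e) * g.2.2.2 e)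
    (hS : ∀ e, S e = starRingEnd ℂ (f.2.2.1 e) * g.1 e - starRingEnd ℂ (f.1 e) * g.2.2.1 e)
    (sR : Summable R) (sS : Summable S) : ∑' e, (R e - S e) = 0 := by
  obtain ⟨a, ha⟩ := (h.mem_iff _).1 hf
  obtain ⟨b, hb⟩ := (h.mem_iff _).1 hg
  have sR' : ∀ j, Summable fun v => R (φ (j, (τ j).symm v)) := fun j =>
    sR.comp_injective (φ.injective.comp
      ((Prod.mk_right_injective j).comp (τ j).symm.injective))
  have sS' : ∀ j, Summable fun v => S (φ (j, v)) := fun j =>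
    sS.comp_injective (φ.injective.comp (Prod.mk_right_injective j))
  have h1 : ∀ u : E → ℂ, Summable u → ∑' e, u e = ∑ j, ∑' v, u (φ (j, v)) := by
    intro u hu
    rw [← φ.tsum_eq, Summable.tsum_prod (f := fun c => u (φ c)) ((φ.summable_iff).2 hu),
      tsum_fintype]
  rw [sR.tsum_sub sS, h1 R sR, h1 S sS]
  -- Right-end terms are moved to the vertex at which the edge arrives.
  have h2 : ∀ j, ∑' v, R (φ (j, v)) = ∑' v, R (φ (j, (τ j).symm v)) := fun j =>
    ((τ j).symm.tsum_eq fun v => R (φ (j, v))).symm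
  simp only [h2]
  rw [← Summable.tsum_finsetSum (fun j _ => sR' j), ← Summable.tsum_finsetSum (fun j _ => sS' j),
    ← Summable.tsum_sub (summable_sum fun j _ => sR' j) (summable_sum fun j _ => sS' j)]
  refine (tsum_congr fun v => ?_).trans tsum_zero
  have e1 := (ha v).2
  have e2 := (hb v).2
  have e3 := congrArg (starRingEnd ℂ) e1
  simp only [map_sum, map_sub, map_mul, Complex.conj_ofReal] at e3
  have h3 : ∀ j, R (φ (j, (τ j).symm v)) - S (φ (j, v)) =
      (starRingEnd ℂ (f.1 (φ (j, v))) - ε * starRingEnd ℂ (f.2.1 (φ (j, (τ j).symm v)))) * b v -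
      starRingEnd ℂ (a v) * (g.1 (φ (j, v)) - ε * g.2.1 (φ (j, (τ j).symm v))) := by
    intro j
    rw [hR, hS, ((ha v).1 j).1, ((hb v).1 j).1, ((ha ((τ j).symm v)).1 j).2,
      ((hb ((τ j).symm v)).1 j).2, Equiv.apply_symm_apply, map_mul, Complex.conj_ofReal]
    ring
  rw [← Finset.sum_sub_distrib, Finset.sum_congr rfl fun j _ => h3 j, Finset.sum_sub_distrib,
    ← Finset.sum_mul, ← Finset.mul_sum, e2, e3]
  ring

end IsDerivCoupling

theorem tsum_inner_sub_inner {E : Type} {L : E → ℝ} (x X y Y : EdgeSpace L) :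
    ∑' e, (inner ℂ (X e) (y e) - inner ℂ (x e) (Y e)) = inner ℂ X y - inner ℂ x Y := by
  have h1 := lp.summable_inner (𝕜 := ℂ) X y
  have h2 := lp.summable_inner (𝕜 := ℂ) x Y
  rw [h1.tsum_sub h2, lp.inner_eq_tsum, lp.inner_eq_tsum]

theorem summable_conj_mul_of_le {E : Type} {L : E → ℝ} (x X y Y : EdgeSpace L) {C : ℝ}
    (hC0 : 0 ≤ C) {u w : E → ℂ} (hu : ∀ e, ‖u e‖ ≤ C * (‖x e‖ + ‖X e‖))
    (hw : ∀ e, ‖w e‖ ≤ C * (‖y e‖ + ‖Y e‖)) : Summable fun e => starRingEnd ℂ (u e) * w e := by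
  have s4 := (((summable_norm_sq (lp.memℓp x)).add (summable_norm_sq (lp.memℓp X))).add
    (summable_norm_sq (lp.memℓp y))).add (summable_norm_sq (lp.memℓp Y))
  refine Summable.of_norm_bounded (s4.mul_left (C * C)) fun e => ?_
  rw [norm_mul, RCLike.norm_conj]
  have key : ∀ p q r s : ℝ, (p + q) * (r + s) ≤ p ^ 2 + q ^ 2 + r ^ 2 + s ^ 2 := fun p q r s => by
    nlinarith [sq_nonneg (p - r), sq_nonneg (p - s), sq_nonneg (q - r), sq_nonneg (q - s)]
  calc ‖u e‖ * ‖w e‖ ≤ (C * (‖x e‖ + ‖X e‖)) * (C * (‖y e‖ + ‖Y e‖)) :=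
        mul_le_mul (hu e) (hw e) (norm_nonneg _) (by positivity)
    _ = C * C * ((‖x e‖ + ‖X e‖) * (‖y e‖ + ‖Y e‖)) := by ring
    _ ≤ _ := mul_le_mul_of_nonneg_left (key _ _ _ _) (by positivity)

namespace IsDerivCoupling

variable {E V J : Type} [Fintype J] {φ : J × V ≃ E} {τ : J → V ≃ V} {ε D : ℝ} {ℓ : J → ℝ}
  {L : E → ℝ} {B : Submodule ℂ (BoundaryData E)}

theorem exists_uniform_trace_bound (h : IsDerivCoupling φ τ ε D ℓ L B) : ∃ C : ℝ, 0 ≤ C ∧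
    ∀ (e : E) (F G : Lp ℂ 2 (volume.restrict (Ioc (0 : ℝ) (L e)))) (f f' : ℝ → ℂ),
      HasSecondDeriv (L e) F (-G) f f' →
      ‖f 0‖ ≤ C * (‖F‖ + ‖G‖) ∧ ‖f (L e)‖ ≤ C * (‖F‖ + ‖G‖) ∧
      ‖f' 0‖ ≤ C * (‖F‖ + ‖G‖) ∧ ‖f' (L e)‖ ≤ C * (‖F‖ + ‖G‖) := by
  refine h.exists_uniform (P := fun a C =>
    ∀ (F G : Lp ℂ 2 (volume.restrict (Ioc (0 : ℝ) a))) (f f' : ℝ → ℂ),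
      HasSecondDeriv a F (-G) f f' →
      ‖f 0‖ ≤ C * (‖F‖ + ‖G‖) ∧ ‖f a‖ ≤ C * (‖F‖ + ‖G‖) ∧
      ‖f' 0‖ ≤ C * (‖F‖ + ‖G‖) ∧ ‖f' a‖ ≤ C * (‖F‖ + ‖G‖)) ?_ ?_
  · intro a C C' hCC hP F G f f' hs
    obtain ⟨h1, h2, h3, h4⟩ := hP F G f f' hs
    have : C * (‖F‖ + ‖G‖) ≤ C' * (‖F‖ + ‖G‖) := by gcongr
    exact ⟨h1.trans this, h2.trans this, h3.trans this, h4.trans this⟩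
  · intro a ha
    obtain ⟨C, hC0, hC⟩ := exists_trace_bound ha
    refine ⟨C, hC0, fun F G f f' hs => ?_⟩
    have := hC F (-G) f f' hs
    rwa [norm_neg] at this

/-- Green's identity holds on every edge; the uniform trace bounds make the boundary terms summable,
and they cancel at the vertices. -/
theorem inner_graph_eq (h : IsDerivCoupling φ τ ε D ℓ L B) {x X y Y : EdgeSpace L}
    (hx : (x, X) ∈ edgeLaplacianGraph L B) (hy : (y, Y) ∈ edgeLaplacianGraph L B) :
    inner ℂ X y = inner ℂ x Y := by
  obtain ⟨f, f', hf, fB⟩ := hx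
  obtain ⟨g, g', hg, gB⟩ := hy
  obtain ⟨C, hC0, hC⟩ := h.exists_uniform_trace_bound
  have tf := fun e => hC e _ _ _ _ (hf e)
  have tg := fun e => hC e _ _ _ _ (hg e)
  have sR : Summable fun e => starRingEnd ℂ (f' e (L e)) * g e (L e) -
      starRingEnd ℂ (f e (L e)) * g' e (L e) :=
    (summable_conj_mul_of_le x X y Y hC0 (fun e => (tf e).2.2.2) (fun e => (tg e).2.1)).sub
      (summable_conj_mul_of_le x X y Y hC0 (fun e => (tf e).2.1) (fun e => (tg e).2.2.2))
  have sS : Summable fun e => starRingEnd ℂ (f' e 0) * g e 0 -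
      starRingEnd ℂ (f e 0) * g' e 0 :=
    (summable_conj_mul_of_le x X y Y hC0 (fun e => (tf e).2.2.1) (fun e => (tg e).1)).sub
      (summable_conj_mul_of_le x X y Y hC0 (fun e => (tf e).1) (fun e => (tg e).2.2.1))
  have tot := h.tsum_boundary_eq_zero fB gB (fun _ => rfl) (fun _ => rfl) sR sS
  have hf₁ : ∀ e, HasSecondDeriv (L e) (x e) (-(X e)) (f e) (f' e) := hf
  have hg₁ : ∀ e, HasSecondDeriv (L e) (y e) (-(Y e)) (g e) (g' e) := hg
  have he : ∀ e, inner ℂ (X e) (y e) - inner ℂ (x e) (Y e) =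
      -((starRingEnd ℂ (f' e (L e)) * g e (L e) - starRingEnd ℂ (f e (L e)) * g' e (L e)) -
      (starRingEnd ℂ (f' e 0) * g e 0 - starRingEnd ℂ (f e 0) * g' e 0)) := by
    intro e
    have := (hf₁ e).inner_sub_inner (h.length_pos e).le (hg₁ e)
    rw [inner_neg_left, inner_neg_right] at this
    rw [← this]
    ring
  have hts : ∑' e, (inner ℂ (X e) (y e) - inner ℂ (x e) (Y e)) = inner ℂ X y - inner ℂ x Y :=
    tsum_inner_sub_inner x X y Y
  rw [tsum_congr he, tsum_neg] at hts
  have h0 : inner ℂ X y - inner ℂ x Y = 0 := by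
    rw [← hts, neg_eq_zero]
    exact tot
  exact sub_eq_zero.1 h0

theorem symmetric (h : IsDerivCoupling φ τ ε D ℓ L B) (x y : (edgeLaplacian L B).domain) :
    inner ℂ (edgeLaplacian L B x) (y : EdgeSpace L) =
      inner ℂ (x : EdgeSpace L) (edgeLaplacian L B y) := by
  refine h.inner_graph_eq ?_ ?_
  · rw [← edgeLaplacian_graph]; exact LinearPMap.mem_graph _ x
  · rw [← edgeLaplacian_graph]; exact LinearPMap.mem_graph _ y

end IsDerivCoupling

/-! ### Solving the resolvent equation -/

theorem memℓp_mul_of_bound {ι : Type} {u : ι → ℂ} {f : ι → ℝ} {C : ℝ}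
    (hf : Memℓp f 2) (h : ∀ i, ‖u i‖ ≤ C * f i) : Memℓp u 2 :=
  memℓp_two_of_le (hf.const_mul C) h

theorem memℓp_of_fibers {E V J : Type} [Fintype J] (φ : J × V ≃ E) {G : E → Type}
    [∀ e, NormedAddCommGroup (G e)] {w : ∀ e, G e}
    (h : ∀ j, Memℓp (fun v => w (φ (j, v))) 2) : Memℓp w 2 := by
  refine memℓp_gen ?_
  rw [← φ.summable_iff]
  refine (summable_prod_of_nonneg fun _ => ?_).2 ⟨fun j => ?_, Summable.of_finite⟩
  · exact Real.rpow_nonneg (norm_nonneg _) _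
  · exact (h j).summable (by norm_num)

namespace IsDerivCoupling

variable {E V J : Type} [Fintype J] {φ : J × V ≃ E} {τ : J → V ≃ V} {ε D : ℝ} {ℓ : J → ℝ}
  {L : E → ℝ} {B : Submodule ℂ (BoundaryData E)}

theorem exists_uniform_edge_solution (h : IsDerivCoupling φ τ ε D ℓ L B) {k : ℂ} (hk : k ≠ 0) :
    ∃ C : ℝ, 0 ≤ C ∧ ∀ (e : E) (u : Lp ℂ 2 (volume.restrict (Ioc (0 : ℝ) (L e)))),
      ∃ p q : ℂ, ‖p‖ ≤ C * ‖u‖ ∧ ‖q‖ ≤ C * ‖u‖ ∧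
      ∀ α β : ℂ, ∃ (F : Lp ℂ 2 (volume.restrict (Ioc (0 : ℝ) (L e)))) (f f' : ℝ → ℂ),
        HasSecondDeriv (L e) F (-(k ^ 2 • F + u)) f f' ∧ f 0 = α ∧ f' 0 = β ∧
        f (L e) = α * Complex.cos (k * L e) + β * Complex.sin (k * L e) / k + p ∧
        f' (L e) = -α * k * Complex.sin (k * L e) + β * Complex.cos (k * L e) + q ∧
        ‖F‖ ≤ C * (‖u‖ + ‖α‖ + ‖β‖) := by
  refine h.exists_uniform (P := fun a C => ∀ u : Lp ℂ 2 (volume.restrict (Ioc (0 : ℝ) a)),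
      ∃ p q : ℂ, ‖p‖ ≤ C * ‖u‖ ∧ ‖q‖ ≤ C * ‖u‖ ∧
      ∀ α β : ℂ, ∃ (F : Lp ℂ 2 (volume.restrict (Ioc (0 : ℝ) a))) (f f' : ℝ → ℂ),
        HasSecondDeriv a F (-(k ^ 2 • F + u)) f f' ∧ f 0 = α ∧ f' 0 = β ∧
        f a = α * Complex.cos (k * a) + β * Complex.sin (k * a) / k + p ∧
        f' a = -α * k * Complex.sin (k * a) + β * Complex.cos (k * a) + q ∧
        ‖F‖ ≤ C * (‖u‖ + ‖α‖ + ‖β‖)) ?_ (fun a ha => exists_edge_solution ha hk)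
  intro a C C' hCC hP u
  obtain ⟨p, q, hp, hq, hα⟩ := hP u
  refine ⟨p, q, hp.trans (by gcongr), hq.trans (by gcongr), fun α β => ?_⟩
  obtain ⟨F, f, f', h1, h2, h3, h4, h5, h6⟩ := hα α β
  exact ⟨F, f, f', h1, h2, h3, h4, h5, h6.trans (by gcongr)⟩

/-- If the vertex equation at energy `k²` is diagonally dominant, then the operator minus `k²` is
surjective. -/
theorem surjective (h : IsDerivCoupling φ τ ε D ℓ L B) {k : ℂ} (hk : k ≠ 0)
    (hs : ∀ j, Complex.sin (k * ℓ j) ≠ 0)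
    (hdom : 2 * ∑ j, ‖1 / (k * Complex.sin (k * ℓ j))‖ <
      ‖∑ j, 2 * Complex.cos (k * ℓ j) / (k * Complex.sin (k * ℓ j)) - D‖) (u : EdgeSpace L) :
    ∃ x : (edgeLaplacian L B).domain,
      edgeLaplacian L B x - k ^ 2 • (x : EdgeSpace L) = u := by
  obtain ⟨C, hC0, hC⟩ := h.exists_uniform_edge_solution hk
  choose p q hp hq hF using fun e => hC e (u e)
  have hun : Memℓp (fun e => ‖u e‖) 2 := (lp.memℓp u).norm
  have mp : Memℓp p 2 := memℓp_mul_of_bound hun hp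
  have mq : Memℓp q 2 := memℓp_mul_of_bound hun hq
  set x : J → ℂ := fun j => 1 / (k * Complex.sin (k * ℓ j)) with hx
  set c : J → ℂ := fun j => Complex.cos (k * ℓ j) with hc
  have inj : ∀ j (σ : V ≃ V), Function.Injective fun v => φ (j, σ v) := fun j σ =>
    φ.injective.comp ((Prod.mk_right_injective j).comp σ.injective)
  -- This is what the source `u` contributes to the sum of the boundary values at `v`.
  have mb : Memℓp (fun v => ∑ j, (ε * p (φ (j, (τ j).symm v)) +
      ε * c j * x j * q (φ (j, (τ j).symm v)) - x j * q (φ (j, v)))) 2 := by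
    refine Memℓp.finsetSum _ fun j _ => ?_
    exact (((memℓp_comp_injective mp (inj j (τ j).symm)).const_mul _).add
      ((memℓp_comp_injective mq (inj j (τ j).symm)).const_mul _)).sub
      ((memℓp_comp_injective mq (inj j (Equiv.refl V))).const_mul _)
  have hεn : ‖(ε : ℂ)‖ = 1 := by
    have h1 : |ε| * |ε| = 1 := by rw [← abs_mul, h.sign, abs_one]
    rw [Complex.norm_real, Real.norm_eq_abs]
    nlinarith [abs_nonneg ε]
  have hε : (ε : ℂ) * ε = 1 := by exact_mod_cast h.sign
  -- Prescribing the derivatives at both ends fixes every edge function because the sines do not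
  -- vanish. The only remaining condition, on the sums of boundary values, is the equation solved
  -- here.
  obtain ⟨a, ma, ha⟩ := exists_solution_of_dominant τ
    (∑ j, 2 * Complex.cos (k * ℓ j) / (k * Complex.sin (k * ℓ j)) - D) (fun j => ε * x j)
    (by simpa only [norm_mul, hεn, one_mul] using hdom) mb
  -- The initial value is forced by requiring the derivative at the far end to be `ε * a (τ j v)`.
  set α : E → ℂ := fun e => x (φ.symm e).1 * (q e + c (φ.symm e).1 * a (φ.symm e).2 -
    ε * a (τ (φ.symm e).1 (φ.symm e).2)) with hα
  choose F f f' hFs f0 f'0 fL f'L bF using fun e => hF e (α e) (a (φ.symm e).2)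
  have mβ : Memℓp (fun e => a (φ.symm e).2) 2 := by
    refine memℓp_of_fibers φ fun j => ?_
    simpa using ma
  have mα : Memℓp α 2 := by
    refine memℓp_of_fibers φ fun j => ?_
    simp only [hα, Equiv.symm_apply_apply]
    exact (((memℓp_comp_injective mq (inj j (Equiv.refl V))).add (ma.const_mul _)).sub
      ((memℓp_comp_injective ma (τ j).injective).const_mul _)).const_mul _
  have mF : Memℓp F 2 := memℓp_two_of_le (((hun.add mα.norm).add mβ.norm).const_mul C) bF
  set X : EdgeSpace L := ⟨F, mF⟩ with hX
  have fL₁ := fun j v => fL (φ (j, v))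
  have f'L₁ := fun j v => f'L (φ (j, v))
  simp only [h.length, Equiv.symm_apply_apply, hα] at fL₁ f'L₁
  have hmem : (X, k ^ 2 • X + u) ∈ edgeLaplacianGraph L B := by
    refine ⟨f, f', hFs, (h.mem_iff _).2 ⟨a, fun v => ⟨fun j => ?_, ?_⟩⟩⟩
    · simp only [f'0, h.length, f'L₁, Equiv.symm_apply_apply, true_and, hx, hc]
      have := hs j
      field_simp
      ring
    · simp only [f0, h.length, fL₁, Equiv.symm_apply_apply, hα, Equiv.apply_symm_apply]
      have hv := ha v
      rw [sub_mul, Finset.sum_mul, sub_right_comm, sub_eq_iff_eq_add] at hv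
      rw [← sub_eq_iff_eq_add'] at hv
      rw [← hv, ← Finset.sum_sub_distrib, ← Finset.sum_sub_distrib]
      refine Finset.sum_congr rfl fun j _ => ?_
      have hsj := hs j
      have hcs := Complex.sin_sq_add_cos_sq (k * ℓ j)
      have e1 : Complex.sin (k * ℓ j) / k = x j - x j * c j ^ 2 := by
        simp only [hx, hc]
        field_simp
        linear_combination hcs
      have e2 : 2 * Complex.cos (k * ℓ j) / (k * Complex.sin (k * ℓ j)) = 2 * c j * x j := by
        simp only [hx, hc]
        ring
      rw [mul_div_assoc, e1, e2]
      linear_combination (c j * x j * a v) * hε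
  rw [← edgeLaplacian_graph, LinearPMap.mem_graph_iff] at hmem
  obtain ⟨y, hy1, hy2⟩ := hmem
  refine ⟨y, ?_⟩
  rw [hy2, hy1]
  simp

end IsDerivCoupling

/-! ### Approximate eigenvectors built from Bloch waves -/

theorem edgeLp_add_smul (a : ℝ) {u v f : ℝ → ℂ} (hu : Continuous u) (hv : Continuous v)
    (hf : Continuous f) (c d : ℂ) (h : ∀ x, f x = c * u x + d * v x) :
    edgeLp a f hf = c • edgeLp a u hu + d • edgeLp a v hv := by
  refine Lp.ext ?_
  filter_upwards [edgeLp_coeFn a f hf, edgeLp_coeFn a u hu, edgeLp_coeFn a v hv,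
    Lp.coeFn_add (c • edgeLp a u hu) (d • edgeLp a v hv), Lp.coeFn_smul c (edgeLp a u hu),
    Lp.coeFn_smul d (edgeLp a v hv)] with x h1 h2 h3 h4 h5 h6
  rw [h1, h4, Pi.add_apply, h5, h6, Pi.smul_apply, Pi.smul_apply, h2, h3, h, smul_eq_mul,
    smul_eq_mul]

theorem edgeLp_ne_zero {a : ℝ} (ha : 0 < a) {u : ℝ → ℂ} (hu : Continuous u) {x : ℝ}
    (hx : x ∈ Icc 0 a) (hux : u x ≠ 0) : edgeLp a u hu ≠ 0 := by
  intro h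
  have h0 : u =ᵐ[volume.restrict (Ioo 0 a)] (fun _ => (0 : ℂ)) := by
    refine ae_mono (Measure.restrict_mono Ioo_subset_Ioc_self le_rfl) ?_
    filter_upwards [edgeLp_coeFn a u hu, Lp.coeFn_zero ℂ 2 (volume.restrict (Ioc (0 : ℝ) a))]
      with y h1 h2
    rw [← h1, h, h2]; rfl
  have hz : EqOn u (fun _ => (0 : ℂ)) (Ioo 0 a) :=
    Measure.eqOn_open_of_ae_eq h0 isOpen_Ioo hu.continuousOn continuousOn_const
  have hzI : EqOn u (fun _ => (0 : ℂ)) (Icc 0 a) := by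
    refine hz.of_subset_closure hu.continuousOn continuousOn_const Ioo_subset_Icc_self ?_
    rw [closure_Ioo ha.ne]
  exact hux (hzI hx)

theorem lp_norm_sq_eq_tsum {ι : Type} {G : ι → Type} [∀ i, NormedAddCommGroup (G i)]
    (f : lp G 2) : ‖f‖ ^ 2 = ∑' i, ‖f i‖ ^ 2 := by
  have := lp.norm_rpow_eq_tsum (p := 2) (by norm_num) f
  simpa using this

namespace IsDerivCoupling

variable {E V J : Type} [Fintype J] {φ : J × V ≃ E} {τ : J → V ≃ V} {ε D : ℝ} {ℓ : J → ℝ}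
  {L : E → ℝ} {B : Submodule ℂ (BoundaryData E)}

/-- A slowly modulated Bloch solution. -/
theorem exists_modulated (h : IsDerivCoupling φ τ ε D ℓ L B) {z a : ℂ} {u u' : J → ℝ → ℂ}
    {w : J → ℂ} {ω : V → ℂ}
    (hu : ∀ j x, HasDerivAt (u j) (u' j x) x) (hu' : ∀ j x, HasDerivAt (u' j) (-(z * u j x)) x)
    (hw : ∀ j, w j ≠ 0) (hωτ : ∀ j v, ω (τ j v) = w j * ω v) (hω : ∀ v, ‖ω v‖ = 1)
    (h0 : ∀ j, u' j 0 = a) (hL : ∀ j, u' j (ℓ j) = ε * w j * a)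
    (hsum : ∑ j, (u j 0 - ε * (w j)⁻¹ * u j (ℓ j)) = D * a) :
    ∃ K : ℝ, 0 ≤ K ∧ ∀ χ : V → ℝ, (∀ v, 0 ≤ χ v) → Memℓp χ 2 → ∀ δ : ℝ, 0 < δ →
      (∀ j v, |χ (τ j v) - χ v| ≤ δ * χ v) → ∃ x : (edgeLaplacian L B).domain,
        (∀ j v, ‖((edgeLaplacian L B x - z • (x : EdgeSpace L)) : EdgeSpace L) (φ (j, v))‖ ≤
          K * δ * χ v) ∧
        ∀ j v (hc : Continuous (u j)),
          (‖edgeLp (ℓ j) (u j) hc‖ - K * δ) * χ v ≤ ‖(x : EdgeSpace L) (φ (j, v))‖ := by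
  -- `η` rises from 0 to 1 along the edge with zero slope at both ends. Multiplying the Bloch wave
  -- by `χ v + (χ (τ j v) - χ v) η` scales values and derivatives at each vertex by the same factor,
  -- so the coupling conditions survive.
  choose η η' η'' dη dη' cη cη'' η0 η'0 ηL η'L using fun j => exists_hermite (h.pos j) 0 0 1 0
  have cu : ∀ j, Continuous (u j) := fun j =>
    continuous_iff_continuousAt.2 fun x => (hu j x).continuousAt
  have cu' : ∀ j, Continuous (u' j) := fun j =>
    continuous_iff_continuousAt.2 fun x => (hu' j x).continuousAt
  have cη' : ∀ j, Continuous (η' j) := fun j =>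
    continuous_iff_continuousAt.2 fun x => (dη' j x).continuousAt
  have cV : ∀ j, Continuous fun x => η j x * u j x := fun j => (cη j).mul (cu j)
  have cW : ∀ j, Continuous fun x => η'' j x * u j x + 2 * (η' j x * u' j x) := fun j =>
    ((cη'' j).mul (cu j)).add (((cη' j).mul (cu' j)).const_mul 2)
  set nV : J → ℝ := fun j => ‖edgeLp (ℓ j) _ (cV j)‖ with hnV
  set nW : J → ℝ := fun j => ‖edgeLp (ℓ j) _ (cW j)‖ with hnW
  have hKV : ∀ j, nV j ≤ ∑ j, (nV j + nW j) := fun j =>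
    (le_add_of_nonneg_right (norm_nonneg _)).trans
      (Finset.single_le_sum (f := fun j => nV j + nW j)
        (fun i _ => add_nonneg (norm_nonneg _) (norm_nonneg _)) (Finset.mem_univ j))
  have hKW : ∀ j, nW j ≤ ∑ j, (nV j + nW j) := fun j =>
    (le_add_of_nonneg_left (norm_nonneg _)).trans
      (Finset.single_le_sum (f := fun j => nV j + nW j)
        (fun i _ => add_nonneg (norm_nonneg _) (norm_nonneg _)) (Finset.mem_univ j))
  set K : ℝ := ∑ j, (nV j + nW j) with hK
  have hK0 : 0 ≤ K := Finset.sum_nonneg fun i _ => add_nonneg (norm_nonneg _) (norm_nonneg _)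
  refine ⟨K, hK0, fun χ hχ0 hχm δ hδ hχδ => ?_⟩
  set c : E → ℂ := fun e => ω (φ.symm e).2 * χ (φ.symm e).2 with hc
  set d : E → ℂ := fun e => ω (φ.symm e).2 *
    ((χ (τ (φ.symm e).1 (φ.symm e).2) - χ (φ.symm e).2 : ℝ) : ℂ) with hd
  have nc : ∀ j v, ‖c (φ (j, v))‖ = χ v := fun j v => by
    simp only [hc, Equiv.symm_apply_apply, norm_mul, hω, one_mul, Complex.norm_real,
      Real.norm_of_nonneg (hχ0 v)]
  have nd : ∀ j v, ‖d (φ (j, v))‖ ≤ δ * χ v := fun j v => by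
    simp only [hd, Equiv.symm_apply_apply, norm_mul, hω, one_mul, Complex.norm_real,
      Real.norm_eq_abs]
    exact hχδ j v
  obtain ⟨f, hf⟩ : ∃ f : E → ℝ → ℂ, f = fun e x => c e * u (φ.symm e).1 x +
    d e * (η (φ.symm e).1 x * u (φ.symm e).1 x) := ⟨_, rfl⟩
  obtain ⟨f', hf'⟩ : ∃ f' : E → ℝ → ℂ, f' = fun e x => c e * u' (φ.symm e).1 x +
    d e * (η' (φ.symm e).1 x * u (φ.symm e).1 x + η (φ.symm e).1 x * u' (φ.symm e).1 x) :=
    ⟨_, rfl⟩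
  -- The deviation from the eigenvalue equation carries the factor `d`, the small difference of
  -- neighbouring amplitudes.
  obtain ⟨f'', hf''⟩ : ∃ f'' : E → ℝ → ℂ, f'' = fun e x => -z * f e x +
    d e * (η'' (φ.symm e).1 x * u (φ.symm e).1 x + 2 * (η' (φ.symm e).1 x * u' (φ.symm e).1 x)) :=
    ⟨_, rfl⟩
  have df : ∀ e x, HasDerivAt (f e) (f' e x) x := fun e x => by
    rw [hf, hf']
    exact ((hu _ x).const_mul (c e)).add (((dη _ x).mul (hu _ x)).const_mul (d e))
  have df' : ∀ e x, HasDerivAt (f' e) (f'' e x) x := fun e x => by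
    rw [hf']
    refine (((hu' _ x).const_mul (c e)).add ((((dη' _ x).mul (hu _ x)).add
      ((dη _ x).mul (hu' _ x))).const_mul (d e))).congr_deriv ?_
    rw [hf'', hf]
    ring
  have cf : ∀ e, Continuous (f e) := fun e =>
    continuous_iff_continuousAt.2 fun x => (df e x).continuousAt
  have cf'' : ∀ e, Continuous (f'' e) := fun e => by
    rw [hf'']
    exact ((cf e).const_mul _).add ((cW _).const_mul _)
  have normL : ∀ j v {g : ℝ → ℂ} (hg : Continuous g),
      ‖edgeLp (L (φ (j, v))) g hg‖ = ‖edgeLp (ℓ j) g hg‖ := fun j v g hg => by rw [h.length]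
  have eX : ∀ e, edgeLp (L e) (f e) (cf e) = c e • edgeLp (L e) _ (cu (φ.symm e).1) +
      d e • edgeLp (L e) _ (cV (φ.symm e).1) := fun e =>
    edgeLp_add_smul _ _ _ _ _ _ fun x => by rw [hf]
  have nX : ∀ j v, ‖c (φ (j, v)) • edgeLp (L (φ (j, v))) _ (cu (φ.symm (φ (j, v))).1)‖ =
      ‖edgeLp (ℓ j) _ (cu j)‖ * χ v := fun j v => by
    rw [norm_smul, nc, normL, mul_comm]
    simp only [Equiv.symm_apply_apply]
  have nY : ∀ j v, ‖d (φ (j, v)) • edgeLp (L (φ (j, v))) _ (cV (φ.symm (φ (j, v))).1)‖ ≤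
      K * δ * χ v := fun j v => by
    rw [norm_smul, normL]
    simp only [Equiv.symm_apply_apply]
    calc _ ≤ δ * χ v * K := mul_le_mul (nd j v) (hKV j) (norm_nonneg _)
          (mul_nonneg hδ.le (hχ0 v))
      _ = _ := by ring
  have nZ : ∀ j v, ‖d (φ (j, v)) • edgeLp (L (φ (j, v))) _ (cW (φ.symm (φ (j, v))).1)‖ ≤
      K * δ * χ v := fun j v => by
    rw [norm_smul, normL]
    simp only [Equiv.symm_apply_apply]
    calc _ ≤ δ * χ v * K := mul_le_mul (nd j v) (hKW j) (norm_nonneg _)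
          (mul_nonneg hδ.le (hχ0 v))
      _ = _ := by ring
  have mX : Memℓp (fun e => edgeLp (L e) (f e) (cf e)) 2 := by
    refine memℓp_of_fibers φ fun j => ?_
    refine memℓp_two_of_le (hχm.const_mul (‖edgeLp (ℓ j) _ (cu j)‖ + K * δ)) fun v => ?_
    rw [eX, add_mul]
    exact (norm_add_le _ _).trans (add_le_add (nX j v).le (nY j v))
  have mZ : Memℓp (fun e => -(d e • edgeLp (L e) _ (cW (φ.symm e).1))) 2 := by
    refine memℓp_of_fibers φ fun j => ?_
    refine memℓp_two_of_le (hχm.const_mul (K * δ)) fun v => ?_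
    rw [norm_neg]
    exact nZ j v
  set X : EdgeSpace L := ⟨_, mX⟩ with hX
  set Z : EdgeSpace L := ⟨_, mZ⟩ with hZ
  have hmem : (X, z • X + Z) ∈ edgeLaplacianGraph L B := by
    refine ⟨f, f', fun e => ?_, (h.mem_iff _).2 ⟨fun v => ω v * χ v * a, fun v =>
      ⟨fun j => ⟨?_, ?_⟩, ?_⟩⟩⟩
    · have e1 : -((z • X + Z) e) = edgeLp (L e) (f'' e) (cf'' e) := by
        rw [edgeLp_add_smul (L e) (cf e) (cW (φ.symm e).1) (cf'' e) (-z) (d e)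
          fun x => by rw [hf'']]
        change -(z • edgeLp (L e) (f e) (cf e) + -(d e • edgeLp (L e) _ (cW (φ.symm e).1))) = _
        rw [neg_smul]
        abel
      change HasSecondDeriv (L e) (edgeLp (L e) (f e) (cf e)) (-((z • X + Z) e)) (f e) (f' e)
      rw [e1]
      exact hasSecondDeriv_edgeLp (df e) (df' e) (cf e) (cf'' e)
    · simp only [hf', hc, Equiv.symm_apply_apply, h0, η0, η'0]
      ring
    · simp only [hf', hc, hd, Equiv.symm_apply_apply, h.length, hL, ηL, η'L, hωτ]
      push_cast
      ring
    · have e2 : ∀ j, f (φ (j, v)) 0 - ε * f (φ (j, (τ j).symm v)) (L (φ (j, (τ j).symm v))) =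
          ω v * χ v * (u j 0 - ε * (w j)⁻¹ * u j (ℓ j)) := by
        intro j
        have hωs : ω ((τ j).symm v) = (w j)⁻¹ * ω v := by
          have := hωτ j ((τ j).symm v)
          rw [Equiv.apply_symm_apply] at this
          rw [this, inv_mul_cancel_left₀ (hw j)]
        simp only [hf, hc, hd, Equiv.symm_apply_apply, h.length, η0, ηL, hωs,
          Equiv.apply_symm_apply]
        push_cast
        ring
      simp only [e2]
      rw [← Finset.mul_sum, hsum]
      ring
  rw [← edgeLaplacian_graph, LinearPMap.mem_graph_iff] at hmem
  obtain ⟨y, hy1, hy2⟩ := hmem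
  refine ⟨y, fun j v => ?_, fun j v hc => ?_⟩
  · rw [hy2, hy1, add_sub_cancel_left]
    change ‖-(d (φ (j, v)) • edgeLp (L (φ (j, v))) _ (cW (φ.symm (φ (j, v))).1))‖ ≤ _
    rw [norm_neg]
    exact nZ j v
  · rw [hy1]
    change _ ≤ ‖edgeLp (L (φ (j, v))) (f (φ (j, v))) (cf (φ (j, v)))‖
    rw [eX, sub_mul]
    have := norm_sub_le_norm_add (c (φ (j, v)) • edgeLp (L (φ (j, v))) _
      (cu (φ.symm (φ (j, v))).1)) (d (φ (j, v)) • edgeLp (L (φ (j, v))) _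
      (cV (φ.symm (φ (j, v))).1))
    rw [nX] at this
    have := nY j v
    linarith

/-- With amplitude `χ`, the squared norm is at least a constant times `∑ χ ^ 2`, and the squared
residual at most a constant times `δ ^ 2 * ∑ χ ^ 2`. Because the variation of `χ` is small relative
to `χ` itself, the quotient does not involve `χ`, and Weyl's criterion applies. -/
theorem mem_spectrum_of_bloch (h : IsDerivCoupling φ τ ε D ℓ L B) {z a : ℂ} {u u' : J → ℝ → ℂ}
    {w : J → ℂ} {ω : V → ℂ} [Nonempty V]
    (hu : ∀ j x, HasDerivAt (u j) (u' j x) x) (hu' : ∀ j x, HasDerivAt (u' j) (-(z * u j x)) x)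
    (hw : ∀ j, w j ≠ 0) (hωτ : ∀ j v, ω (τ j v) = w j * ω v) (hω : ∀ v, ‖ω v‖ = 1)
    (h0 : ∀ j, u' j 0 = a) (hL : ∀ j, u' j (ℓ j) = ε * w j * a)
    (hsum : ∑ j, (u j 0 - ε * (w j)⁻¹ * u j (ℓ j)) = D * a)
    (hne : ∃ j, ∃ x ∈ Icc 0 (ℓ j), u j x ≠ 0)
    (hχ : ∀ δ : ℝ, 0 < δ → ∃ χ : V → ℝ, (∀ v, 0 < χ v) ∧ Memℓp χ 2 ∧
      ∀ j v, |χ (τ j v) - χ v| ≤ δ * χ v) :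
    z ∈ unboundedSpectrum (edgeLaplacian L B) := by
  obtain ⟨j₀, x₀, hx₀, hne⟩ := hne
  have cu : Continuous (u j₀) := continuous_iff_continuousAt.2 fun x => (hu j₀ x).continuousAt
  have hm := norm_pos_iff.2 (edgeLp_ne_zero (h.pos j₀) cu hx₀ hne)
  set m := ‖edgeLp (ℓ j₀) (u j₀) cu‖ with hm_def
  obtain ⟨K, hK0, hK⟩ := h.exists_modulated hu hu' hw hωτ hω h0 hL hsum
  refine mem_unboundedSpectrum_of_approx _ z fun η hη => ?_
  set N : ℝ := (Fintype.card J : ℝ) with hN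
  have hN0 : 0 ≤ N := Nat.cast_nonneg _
  -- The first bound keeps half of the Bloch wave's norm `m` on the edges of type `j₀`; the second
  -- makes the residual over all edge types at most `η` times that.
  obtain ⟨δ, hδ, hδ1, hδ2⟩ : ∃ δ : ℝ, 0 < δ ∧ K * δ ≤ m / 2 ∧
      (K * δ) ^ 2 * N ≤ η ^ 2 * (m / 2) ^ 2 := by
    refine ⟨min (m / (2 * (K + 1))) (η * m / (2 * (K + 1) * (N + 1))), by positivity, ?_, ?_⟩
    · calc K * _ ≤ (K + 1) * (m / (2 * (K + 1))) := by
            gcongr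
            · linarith
            · exact min_le_left _ _
        _ = m / 2 := by field_simp
    · have h1 : K * min (m / (2 * (K + 1))) (η * m / (2 * (K + 1) * (N + 1))) ≤
          η * (m / 2) / (N + 1) := by
        calc K * _ ≤ (K + 1) * (η * m / (2 * (K + 1) * (N + 1))) := by
              gcongr
              · linarith
              · exact min_le_right _ _
          _ = _ := by field_simp
      calc _ ≤ (η * (m / 2) / (N + 1)) ^ 2 * N := by gcongr
        _ = (η ^ 2 * (m / 2) ^ 2) * (N / (N + 1) ^ 2) := by field_simp
        _ ≤ (η ^ 2 * (m / 2) ^ 2) * 1 := by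
            gcongr
            rw [div_le_one (by positivity)]
            nlinarith
        _ = _ := mul_one _
  obtain ⟨χ, hχ0, hχm, hχδ⟩ := hχ δ hδ
  obtain ⟨x, hx1, hx2⟩ := hK χ (fun v => (hχ0 v).le) hχm δ hδ hχδ
  have hχs : Summable fun v => χ v ^ 2 := by
    have := summable_norm_sq hχm
    simpa using this
  set S := ∑' v, χ v ^ 2 with hS
  have hS0 : 0 < S := hχs.tsum_pos (fun v => by positivity) (Classical.arbitrary V)
    (by have := hχ0 (Classical.arbitrary V); positivity)
  set Z : EdgeSpace L := edgeLaplacian L B x - z • (x : EdgeSpace L) with hZ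
  have hlow : (m / 2) ^ 2 * S ≤ ‖(x : EdgeSpace L)‖ ^ 2 := by
    rw [lp_norm_sq_eq_tsum, hS, ← tsum_mul_left]
    have hinj : Function.Injective fun v => φ (j₀, v) :=
      φ.injective.comp (Prod.mk_right_injective j₀)
    refine le_trans ?_ (tsum_comp_le_tsum_of_inj (summable_norm_sq (lp.memℓp (x : EdgeSpace L)))
      (fun _ => by positivity) hinj)
    refine Summable.tsum_le_tsum (fun v => ?_) (hχs.mul_left _)
      ((summable_norm_sq (lp.memℓp (x : EdgeSpace L))).comp_injective hinj)
    rw [← mul_pow]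
    have := hχ0 v
    refine pow_le_pow_left₀ (by positivity) (le_trans ?_ (hx2 j₀ v cu)) 2
    gcongr
    rw [← hm_def]
    linarith
  have hup : ‖Z‖ ^ 2 ≤ (K * δ) ^ 2 * N * S := by
    rw [lp_norm_sq_eq_tsum, ← φ.tsum_eq]
    have hs := (φ.summable_iff).2 (summable_norm_sq (lp.memℓp Z))
    rw [Summable.tsum_prod (f := fun c => ‖Z (φ c)‖ ^ 2) hs, tsum_fintype]
    have : ∀ j, ∑' v, ‖Z (φ (j, v))‖ ^ 2 ≤ (K * δ) ^ 2 * S := by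
      intro j
      rw [hS, ← tsum_mul_left]
      refine Summable.tsum_le_tsum (fun v => ?_)
        (hs.comp_injective (Prod.mk_right_injective j)) (hχs.mul_left _)
      rw [← mul_pow]
      exact pow_le_pow_left₀ (norm_nonneg _) (hx1 j v) 2
    refine (Finset.sum_le_sum fun j _ => this j).trans (le_of_eq ?_)
    rw [Finset.sum_const, nsmul_eq_mul, Finset.card_univ, hN]
    ring
  refine ⟨x, fun hx => ?_, ?_⟩
  · rw [hx, norm_zero] at hlow
    have : 0 < (m / 2) ^ 2 * S := by positivity
    linarith
  · refine le_of_sq_le_sq (hup.trans ?_) (by positivity)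
    rw [mul_pow η]
    calc (K * δ) ^ 2 * N * S ≤ (η ^ 2 * (m / 2) ^ 2) * S := by gcongr
      _ = η ^ 2 * ((m / 2) ^ 2 * S) := by ring
      _ ≤ _ := by gcongr

end IsDerivCoupling

/-! ### The two models -/

/-- The sign is `-1` because the coupling uses outward derivatives, which at an incoming end are
`-f'`. The label `false` stands for horizontal edges and `true` for vertical ones. -/
theorem isDerivCoupling_lattice {l₁ l₂ : ℝ} (h₁ : 0 < l₁) (h₂ : 0 < l₂) (D : ℝ) :
    IsDerivCoupling (Equiv.boolProdEquivSum (ℤ × ℤ))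
      (fun j => Equiv.addRight (cond j ((0, 1) : ℤ × ℤ) (1, 0))) (-1) D (fun j => cond j l₂ l₁)
      (latticeLength l₁ l₂) (deltaPrimeSLattice D) where
  pos j := by cases j <;> assumption
  length j v := by cases j <;> rfl
  sign := by norm_num
  mem_iff b := by
    constructor
    · intro hb
      refine ⟨fun v => b.2.2.1 (Sum.inl v), fun v => ⟨fun j => ?_, ?_⟩⟩
      · obtain ⟨n, m⟩ := v
        cases j
        · have := (hb (n + 1) m).1
          simp only [add_sub_cancel_right] at this
          simp [Equiv.boolProdEquivSum, this]
        · have h1 := (hb n m).2.1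
          have h2 := (hb n (m + 1)).2.2.1
          simp only [add_sub_cancel_right] at h2
          simp [Equiv.boolProdEquivSum, h1, h2]
      · obtain ⟨n, m⟩ := v
        have := (hb n m).2.2.2
        simp only [Fintype.sum_bool, Equiv.boolProdEquivSum, Equiv.coe_fn_mk]
        simp only [← this]
        simp [sub_eq_add_neg]
        ring
    · rintro ⟨a, ha⟩ n m
      have e1 := ((ha (n, m)).1 false).1
      have e2 := ((ha (n, m)).1 true).1
      have e3 := ((ha (n - 1, m)).1 false).2
      have e4 := ((ha (n, m - 1)).1 true).2
      have e5 := (ha (n, m)).2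
      simp only [Fintype.sum_bool, Equiv.boolProdEquivSum, Equiv.coe_fn_mk] at e1 e2 e3 e4 e5
      simp [sub_eq_add_neg] at e1 e2 e3 e4 e5
      simp only [← sub_eq_add_neg] at e3 e4 e5
      refine ⟨by rw [e1, e3, neg_neg], by rw [e1, e2], by rw [e1, e4, neg_neg], ?_⟩
      rw [e1, ← e5]
      ring

theorem isDerivCoupling_array {l : ℝ} (hl : 0 < l) (D : ℝ) :
    IsDerivCoupling (Equiv.punitProd ℤ) (fun _ : PUnit => Equiv.addRight (1 : ℤ)) 1 D
      (fun _ => l) (fun _ => l) (deltaPrimeArray D) where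
  pos _ := hl
  length _ _ := rfl
  sign := by norm_num
  mem_iff b := by
    constructor
    · intro hb
      refine ⟨fun v => b.2.2.1 v, fun v => ⟨fun j => ?_, ?_⟩⟩
      · have := (hb (v + 1)).1
        simp only [add_sub_cancel_right] at this
        simp [this]
      · have := (hb v).2
        simp only [← this]
        simp [sub_eq_add_neg]
    · rintro ⟨a, ha⟩ n
      have e1 := ((ha n).1 PUnit.unit).1
      have e2 := ((ha (n - 1)).1 PUnit.unit).2
      have e3 := (ha n).2
      simp [sub_eq_add_neg] at e1 e2 e3
      simp only [← sub_eq_add_neg] at e2 e3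
      exact ⟨by rw [e1, e2], by rw [e1, e3]⟩

theorem summable_pow_natAbs {s : ℝ} (h0 : 0 ≤ s) (h1 : s < 1) :
    Summable fun n : ℤ => s ^ n.natAbs := by
  refine Summable.of_nat_of_neg ?_ ?_
  · simpa using summable_geometric_of_lt_one h0 h1
  · simpa using summable_geometric_of_lt_one h0 h1

/-- Neighbouring values of this weight have ratio `1 + δ` or its inverse. Exponential decay gives a
relative bound at every site, which a cutoff of finite support could not. -/
theorem abs_pow_natAbs_sub_le {δ : ℝ} (hδ : 0 < δ) (n : ℤ) :
    |((1 + δ)⁻¹) ^ (n + 1).natAbs - ((1 + δ)⁻¹) ^ n.natAbs| ≤ δ * ((1 + δ)⁻¹) ^ n.natAbs := by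
  set r : ℝ := (1 + δ)⁻¹ with hr
  have hr0 : 0 < r := by positivity
  have hr1 : r * (1 + δ) = 1 := inv_mul_cancel₀ (by positivity)
  rcases le_or_gt 0 n with hn | hn
  · have : (n + 1).natAbs = n.natAbs + 1 := by omega
    rw [this, pow_succ, abs_le]
    have hp : 0 < r ^ n.natAbs := by positivity
    constructor <;> nlinarith [mul_pos hp hr0, mul_pos (mul_pos hp hr0) hδ]
  · have : n.natAbs = (n + 1).natAbs + 1 := by omega
    rw [this, pow_succ, abs_le]
    have hp : 0 < r ^ (n + 1).natAbs := by positivity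
    constructor <;> nlinarith [mul_pos hp hr0, mul_pos (mul_pos hp hr0) hδ]

theorem exists_slow_cutoff {δ : ℝ} (hδ : 0 < δ) : ∃ χ : ℤ × ℤ → ℝ, (∀ v, 0 < χ v) ∧ Memℓp χ 2 ∧
    ∀ (j : Bool) v, |χ (Equiv.addRight (cond j ((0, 1) : ℤ × ℤ) (1, 0)) v) - χ v| ≤ δ * χ v := by
  set r : ℝ := (1 + δ)⁻¹ with hr
  have hr0 : 0 < r := by positivity
  have hr1 : r < 1 := inv_lt_one_of_one_lt₀ (by linarith)
  refine ⟨fun v => r ^ v.1.natAbs * r ^ v.2.natAbs, fun v => by positivity, ?_, ?_⟩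
  · refine memℓp_gen ?_
    have h := summable_pow_natAbs (s := r ^ 2) (by positivity)
      (pow_lt_one₀ hr0.le hr1 (by norm_num))
    refine (h.mul_of_nonneg h (fun _ => by positivity) (fun _ => by positivity)).congr fun v => ?_
    simp only [ENNReal.toReal_ofNat, Real.rpow_ofNat, Real.norm_eq_abs, sq_abs]
    ring
  · rintro j ⟨n, m⟩
    cases j
    · simp only [cond_false, Equiv.coe_addRight, Prod.mk_add_mk, add_zero]
      rw [← sub_mul, abs_mul, abs_of_pos (show 0 < r ^ m.natAbs by positivity), ← mul_assoc]
      gcongr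
      exact abs_pow_natAbs_sub_le hδ n
    · simp only [cond_true, Equiv.coe_addRight, Prod.mk_add_mk, add_zero]
      rw [← mul_sub, abs_mul, abs_of_pos (show 0 < r ^ n.natAbs by positivity), mul_left_comm]
      gcongr
      exact abs_pow_natAbs_sub_le hδ m

/-- A Bloch wave, given by its components `u₁`, `u₂` on the horizontal and vertical edges at the
origin, puts its energy into the spectrum of the lattice. -/
theorem mem_latticeSpectrum_of_bloch {l₁ l₂ : ℝ} (h₁ : 0 < l₁) (h₂ : 0 < l₂) {D : ℝ} {z a : ℂ}
    {u₁ u₁' u₂ u₂' : ℝ → ℂ} {w₁ w₂ : ℂ}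
    (d₁ : ∀ x, HasDerivAt u₁ (u₁' x) x) (d₁' : ∀ x, HasDerivAt u₁' (-(z * u₁ x)) x)
    (d₂ : ∀ x, HasDerivAt u₂ (u₂' x) x) (d₂' : ∀ x, HasDerivAt u₂' (-(z * u₂ x)) x)
    (hw₁ : ‖w₁‖ = 1) (hw₂ : ‖w₂‖ = 1) (h0₁ : u₁' 0 = a) (h0₂ : u₂' 0 = a)
    (hL₁ : u₁' l₁ = -w₁ * a) (hL₂ : u₂' l₂ = -w₂ * a)
    (hsum : (u₁ 0 + w₁⁻¹ * u₁ l₁) + (u₂ 0 + w₂⁻¹ * u₂ l₂) = D * a)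
    (hne : (∃ x ∈ Icc 0 l₁, u₁ x ≠ 0) ∨ ∃ x ∈ Icc 0 l₂, u₂ x ≠ 0) :
    z ∈ latticeSpectrum l₁ l₂ D := by
  have hw₁0 : w₁ ≠ 0 := norm_pos_iff.1 (by rw [hw₁]; exact one_pos)
  have hw₂0 : w₂ ≠ 0 := norm_pos_iff.1 (by rw [hw₂]; exact one_pos)
  refine (isDerivCoupling_lattice h₁ h₂ D).mem_spectrum_of_bloch (z := z) (a := a)
    (u := fun j => cond j u₂ u₁) (u' := fun j => cond j u₂' u₁') (w := fun j => cond j w₂ w₁)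
    (ω := fun v => w₁ ^ v.1 * w₂ ^ v.2) ?_ ?_ ?_ ?_ ?_ ?_ ?_ ?_ ?_ fun δ hδ => exists_slow_cutoff hδ
  · rintro (_ | _); exacts [d₁, d₂]
  · rintro (_ | _); exacts [d₁', d₂']
  · rintro (_ | _) <;> assumption
  · rintro (_ | _) ⟨n, m⟩
    · simp [zpow_add₀ hw₁0]; ring
    · simp [zpow_add₀ hw₂0]; ring
  · intro v
    simp [hw₁, hw₂]
  · rintro (_ | _) <;> assumption
  · rintro (_ | _) <;> simp [hL₁, hL₂]
  · rw [Fintype.sum_bool, ← hsum]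
    simp
    ring
  · rcases hne with h | h
    exacts [⟨false, h⟩, ⟨true, h⟩]

theorem notMem_latticeSpectrum {l₁ l₂ : ℝ} (h₁ : 0 < l₁) (h₂ : 0 < l₂) {D E : ℝ} {k : ℂ}
    (hkE : k ^ 2 = E) (hk : k ≠ 0) (hs₁ : Complex.sin (k * l₁) ≠ 0) (hs₂ : Complex.sin (k * l₂) ≠ 0)
    (hdom : 2 * (‖1 / (k * Complex.sin (k * l₁))‖ + ‖1 / (k * Complex.sin (k * l₂))‖) <
      ‖2 * Complex.cos (k * l₁) / (k * Complex.sin (k * l₁)) +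
        2 * Complex.cos (k * l₂) / (k * Complex.sin (k * l₂)) - D‖) :
    (E : ℂ) ∉ latticeSpectrum l₁ l₂ D ∧ ∀ z ∈ latticeSpectrum l₁ l₂ D, z.im = 0 := by
  have hI := isDerivCoupling_lattice h₁ h₂ D
  have hsurj := hI.surjective hk (by rintro (_ | _) <;> assumption) (by
    simp only [Fintype.sum_bool, cond_true, cond_false]
    rw [add_comm ‖_‖, add_comm (2 * _ / _)]
    exact hdom)
  rw [hkE] at hsurj
  exact ⟨notMem_unboundedSpectrum_of_surjective _ hI.symmetric E hsurj,
    fun z hz => unboundedSpectrum_im_eq_zero _ hI.symmetric E hsurj hz⟩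

theorem notMem_kronigPenneyEnergies {l : ℝ} (hl : 0 < l) {D E : ℝ} {k : ℂ}
    (hkE : k ^ 2 = E) (hk : k ≠ 0) (hs : Complex.sin (k * l) ≠ 0)
    (hdom : 2 * ‖1 / (k * Complex.sin (k * l))‖ <
      ‖2 * Complex.cos (k * l) / (k * Complex.sin (k * l)) - D‖) :
    E ∉ kronigPenneyEnergies l D := by
  have hI := isDerivCoupling_array hl D
  have hsurj := hI.surjective hk (fun _ => hs) (by
    simpa only [Finset.univ_unique, Finset.sum_singleton] using hdom)
  rw [hkE] at hsurj
  exact notMem_unboundedSpectrum_of_surjective _ hI.symmetric E hsurj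

/-! ### The spectral condition -/

/-- The wave `cos (k x)` on the edges of one direction and zero on the others has vanishing
derivative at all vertices, so `D` plays no role. The Bloch factor `-cos (k l) = ±1` makes the
boundary values cancel in pairs. -/
theorem mem_latticeSpectrum_of_sin_eq_zero {l₁ l₂ : ℝ} (h₁ : 0 < l₁) (h₂ : 0 < l₂) (D : ℝ) {k : ℂ}
    (h : Complex.sin (k * l₁) = 0 ∨ Complex.sin (k * l₂) = 0) :
    k ^ 2 ∈ latticeSpectrum l₁ l₂ D := by
  have dc : ∀ x : ℝ, HasDerivAt (fun x : ℝ => Complex.cos (k * x)) (-k * Complex.sin (k * x)) x :=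
    fun x => (hasDerivAt_cos_const_mul k x).congr_deriv (by ring)
  have dc' : ∀ x : ℝ, HasDerivAt (fun x : ℝ => -k * Complex.sin (k * x))
      (-(k ^ 2 * Complex.cos (k * x))) x :=
    fun x => ((hasDerivAt_sin_const_mul k x).const_mul (-k)).congr_deriv (by ring)
  have dz : ∀ x : ℝ, HasDerivAt (fun _ : ℝ => (0 : ℂ)) 0 x := fun x => hasDerivAt_const x 0
  have dz' : ∀ x : ℝ, HasDerivAt (fun _ : ℝ => (0 : ℂ)) (-(k ^ 2 * 0)) x := fun x => by
    simpa using dz x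
  have hsq : ∀ {l : ℝ}, Complex.sin (k * l) = 0 → Complex.cos (k * l) * Complex.cos (k * l) = 1 :=
    fun {l} hs => by
      have := Complex.sin_sq_add_cos_sq (k * l)
      rw [hs] at this
      linear_combination this
  have hn : ∀ {l : ℝ}, Complex.sin (k * l) = 0 → ‖-Complex.cos (k * l)‖ = 1 := fun {l} hs => by
    have := congrArg norm (hsq hs)
    rw [norm_mul, norm_one] at this
    rw [norm_neg]
    nlinarith [norm_nonneg (Complex.cos (k * l))]
  have hinv : ∀ {l : ℝ}, Complex.sin (k * l) = 0 →
      (-Complex.cos (k * l))⁻¹ * Complex.cos (k * l) = -1 := fun {l} hs => by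
    have h0 : Complex.cos (k * l) ≠ 0 := left_ne_zero_of_mul_eq_one (hsq hs)
    field_simp
  rcases h with h | h
  · refine mem_latticeSpectrum_of_bloch h₁ h₂ (a := 0) dc dc' dz dz' (hn h) (w₂ := 1) (by simp)
      (by simp) rfl (by simp [h]) (by simp) ?_ (Or.inl ⟨0, ⟨le_rfl, h₁.le⟩, by simp⟩)
    rw [hinv h]
    simp
  · refine mem_latticeSpectrum_of_bloch h₁ h₂ (a := 0) dz dz' dc dc' (w₁ := 1) (by simp) (hn h)
      rfl (by simp) (by simp) (by simp [h]) ?_ (Or.inr ⟨0, ⟨le_rfl, h₂.le⟩, by simp⟩)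
    rw [hinv h]
    simp

/-- On the unit circle `w + w⁻¹ = 2 cos θ` fills `[-2, 2]`. The sign of `x` is absorbed into `θ`, so
that both lattice directions can be used with the same `t`. -/
theorem exists_unit_add_inv {x t : ℝ} (ht : |t| ≤ 1) : ∃ w : ℂ, ‖w‖ = 1 ∧
    (x : ℂ) * (w + w⁻¹) = ((-(t * (2 * |x|)) : ℝ) : ℂ) := by
  obtain ⟨s, hs, hsx⟩ : ∃ s : ℝ, |s| ≤ 1 ∧ x * s = -(t * |x|) := by
    rcases le_total 0 x with hx | hx
    · exact ⟨-t, by rwa [abs_neg], by rw [abs_of_nonneg hx]; ring⟩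
    · exact ⟨t, ht, by rw [abs_of_nonpos hx]; ring⟩
  obtain ⟨h1, h2⟩ := abs_le.1 hs
  refine ⟨Complex.exp (Real.arccos s * Complex.I), Complex.norm_exp_ofReal_mul_I _, ?_⟩
  rw [← Complex.exp_neg]
  have hc : (Complex.exp (Real.arccos s * Complex.I) + Complex.exp (-(Real.arccos s * Complex.I))) =
      2 * s := by
    have h3 : Complex.cos (Real.arccos s) = s := by
      rw [← Complex.ofReal_cos, Real.cos_arccos h1 h2]
    rw [← h3, Complex.cos]
    ring_nf
  rw [hc]
  have : x * (2 * s) = -(t * (2 * |x|)) := by linear_combination 2 * hsx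
  rw [← this]
  push_cast
  ring

/-- This is the condition that the symbol of the vertex equation has a zero on the torus. The
coefficients are only asked to be real, so it serves real as well as imaginary `k`. -/
theorem mem_latticeSpectrum_iff_and {l₁ l₂ : ℝ} (h₁ : 0 < l₁) (h₂ : 0 < l₂) {D E A₁ A₂ x₁ x₂ : ℝ} {k : ℂ}
    (hkE : k ^ 2 = E) (hk : k ≠ 0) (hs₁ : Complex.sin (k * l₁) ≠ 0) (hs₂ : Complex.sin (k * l₂) ≠ 0)
    (hA₁ : 2 * Complex.cos (k * l₁) / (k * Complex.sin (k * l₁)) = A₁)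
    (hA₂ : 2 * Complex.cos (k * l₂) / (k * Complex.sin (k * l₂)) = A₂)
    (hx₁ : 1 / (k * Complex.sin (k * l₁)) = x₁) (hx₂ : 1 / (k * Complex.sin (k * l₂)) = x₂) :
    ((E : ℂ) ∈ latticeSpectrum l₁ l₂ D ↔ |A₁ + A₂ - D| ≤ 2 * (|x₁| + |x₂|)) ∧
      ((E : ℂ) ∉ latticeSpectrum l₁ l₂ D → ∀ z ∈ latticeSpectrum l₁ l₂ D, z.im = 0) := by
  have hnot : ¬ |A₁ + A₂ - D| ≤ 2 * (|x₁| + |x₂|) →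
      (E : ℂ) ∉ latticeSpectrum l₁ l₂ D ∧ ∀ z ∈ latticeSpectrum l₁ l₂ D, z.im = 0 := by
    intro hlt
    refine notMem_latticeSpectrum h₁ h₂ hkE hk hs₁ hs₂ ?_
    rw [hA₁, hA₂, hx₁, hx₂, ← Complex.ofReal_add, ← Complex.ofReal_sub]
    simpa only [Complex.norm_real, Real.norm_eq_abs] using not_le.1 hlt
  suffices hmem : |A₁ + A₂ - D| ≤ 2 * (|x₁| + |x₂|) → (E : ℂ) ∈ latticeSpectrum l₁ l₂ D from
    ⟨⟨fun h => by_contra fun hlt => (hnot hlt).1 h, hmem⟩, fun h => (hnot fun hle => h (hmem hle)).2⟩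
  intro h
  obtain ⟨t, ht, hAt⟩ : ∃ t : ℝ, |t| ≤ 1 ∧ A₁ + A₂ - D = t * (2 * (|x₁| + |x₂|)) := by
    rcases (by positivity : 0 ≤ 2 * (|x₁| + |x₂|)).eq_or_lt with h0 | h0
    · rw [← h0] at h
      exact ⟨0, by simp, by rw [abs_nonpos_iff.1 h]; simp⟩
    · refine ⟨(A₁ + A₂ - D) / (2 * (|x₁| + |x₂|)), ?_, (div_mul_cancel₀ _ h0.ne').symm⟩
      rwa [abs_div, abs_of_pos h0, div_le_one h0]
  obtain ⟨w₁, hw₁, e₁⟩ := exists_unit_add_inv (x := x₁) ht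
  obtain ⟨w₂, hw₂, e₂⟩ := exists_unit_add_inv (x := x₂) ht
  have d : ∀ (α : ℂ) (x : ℝ), HasDerivAt (fun x : ℝ => α * Complex.cos (k * x) +
      Complex.sin (k * x) / k) (-α * k * Complex.sin (k * x) + Complex.cos (k * x)) x :=
    fun α x => (((hasDerivAt_cos_const_mul k x).const_mul α).add
      ((hasDerivAt_sin_const_mul k x).div_const k)).congr_deriv (by field_simp)
  have d' : ∀ (α : ℂ) (x : ℝ), HasDerivAt (fun x : ℝ => -α * k * Complex.sin (k * x) +
      Complex.cos (k * x)) (-(E * (α * Complex.cos (k * x) + Complex.sin (k * x) / k))) x :=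
    fun α x => (((hasDerivAt_sin_const_mul k x).const_mul (-α * k)).add
      (hasDerivAt_cos_const_mul k x)).congr_deriv (by rw [← hkE]; field_simp; ring)
  -- With unit derivative at the vertex, `α` is fixed by the Bloch condition on the derivative at
  -- the far end; the contribution of this direction to the sum of values is then `A + x (w + w⁻¹)`.
  have key : ∀ (l A x : ℝ) (w : ℂ), ‖w‖ = 1 → Complex.sin (k * l) ≠ 0 →
      2 * Complex.cos (k * l) / (k * Complex.sin (k * l)) = A →
      1 / (k * Complex.sin (k * l)) = x → ∃ α : ℂ,
      -α * k * Complex.sin (k * l) + Complex.cos (k * l) = -w * 1 ∧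
      α + w⁻¹ * (α * Complex.cos (k * l) + Complex.sin (k * l) / k) = A + x * (w + w⁻¹) := by
    intro l A x w hw hs hA hx
    have hw0 : w ≠ 0 := norm_pos_iff.1 (by rw [hw]; exact one_pos)
    refine ⟨(Complex.cos (k * l) + w) / (k * Complex.sin (k * l)), by field_simp; ring, ?_⟩
    rw [← hA, ← hx]
    have hcs := Complex.sin_sq_add_cos_sq (k * l)
    field_simp
    linear_combination hcs
  obtain ⟨α₁, b₁, c₁⟩ := key l₁ A₁ x₁ w₁ hw₁ hs₁ hA₁ hx₁
  obtain ⟨α₂, b₂, c₂⟩ := key l₂ A₂ x₂ w₂ hw₂ hs₂ hA₂ hx₂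
  refine mem_latticeSpectrum_of_bloch h₁ h₂ (a := 1) (d α₁) (d' α₁) (d α₂) (d' α₂) hw₁ hw₂
    (by simp) (by simp) b₁ b₂ ?_ (Or.inl ?_)
  · simp only [Complex.ofReal_zero, mul_zero, Complex.cos_zero, mul_one, Complex.sin_zero,
      zero_div, add_zero]
    rw [c₁, c₂, e₁, e₂]
    have := congrArg (Complex.ofReal) hAt
    push_cast at this ⊢
    linear_combination this
  -- If the wave vanishes at the origin it is `sin (k x) / k`, which is nonzero at the far end.
  · by_cases hα : α₁ = 0
    · refine ⟨l₁, ⟨h₁.le, le_rfl⟩, ?_⟩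
      simpa [hα, hk] using hs₁
    · exact ⟨0, ⟨le_rfl, h₁.le⟩, by simpa using hα⟩

/-! ### Half-angle form of the condition at positive energies -/

/-- `cot u` for `x = 2 u + n π`, `0 < u < π / 2`. -/
noncomputable def cotHalf (x : ℝ) : ℝ := 1 / |sin x| + cos x / sin x

/-- `tan u` for `x = 2 u + n π`, `0 < u < π / 2`. -/
noncomputable def tanHalf (x : ℝ) : ℝ := 1 / |sin x| - cos x / sin x

theorem abs_cos_div_sin_le (x : ℝ) : |cos x / sin x| ≤ 1 / |sin x| := by
  rw [abs_div]
  gcongr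
  exact abs_cos_le_one x

theorem cotHalf_nonneg (x : ℝ) : 0 ≤ cotHalf x := by
  have := (abs_le.1 (abs_cos_div_sin_le x)).1
  rw [cotHalf]; linarith

theorem tanHalf_nonneg (x : ℝ) : 0 ≤ tanHalf x := by
  have := (abs_le.1 (abs_cos_div_sin_le x)).2
  rw [tanHalf]; linarith

theorem zero_mem_latticeEnergies {l₁ l₂ : ℝ} (h₁ : 0 < l₁) (h₂ : 0 < l₂) (D : ℝ) :
    0 ∈ latticeEnergies l₁ l₂ D := by
  have := mem_latticeSpectrum_of_sin_eq_zero h₁ h₂ D (k := 0) (Or.inl (by simp))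
  simpa [latticeEnergies] using this

theorem sq_mem_latticeEnergies_of_sin {l₁ l₂ : ℝ} (h₁ : 0 < l₁) (h₂ : 0 < l₂) (D : ℝ) {k : ℝ}
    (h : sin (k * l₁) = 0 ∨ sin (k * l₂) = 0) : k ^ 2 ∈ latticeEnergies l₁ l₂ D := by
  have := mem_latticeSpectrum_of_sin_eq_zero h₁ h₂ D (k := k)
    (by rw [← Complex.ofReal_mul, ← Complex.ofReal_mul, ← Complex.ofReal_sin, ← Complex.ofReal_sin]
        exact_mod_cast h)
  simpa [latticeEnergies] using this

theorem abs_div_sub_le_iff {k : ℝ} (hk : 0 < k) (a b D : ℝ) :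
    |a / k - D| ≤ b / k ↔ D * k ≤ b + a ∧ -(D * k) ≤ b - a := by
  have e : a / k - D = (a - D * k) / k := by field_simp
  rw [e, abs_div, abs_of_pos hk, div_le_div_iff_of_pos_right hk, abs_le]
  constructor <;> rintro ⟨h1, h2⟩ <;> constructor <;> linarith

/-- Splitting the absolute value pairs `1 / |sin|` with `±cos / sin` for each length. Both
half-angle functions are nonnegative, so for either sign of `D` only one of the two inequalities is
a restriction. -/
theorem sq_mem_latticeEnergies_iff {l₁ l₂ : ℝ} (h₁ : 0 < l₁) (h₂ : 0 < l₂) (D : ℝ) {k : ℝ}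
    (hk : 0 < k) (hs₁ : sin (k * l₁) ≠ 0) (hs₂ : sin (k * l₂) ≠ 0) :
    k ^ 2 ∈ latticeEnergies l₁ l₂ D ↔
      D * k ≤ 2 * (cotHalf (k * l₁) + cotHalf (k * l₂)) ∧
      -(D * k) ≤ 2 * (tanHalf (k * l₁) + tanHalf (k * l₂)) := by
  rw [latticeEnergies, mem_ofPred_eq, (mem_latticeSpectrum_iff_and h₁ h₂ (k := k)
    (A₁ := 2 * cos (k * l₁) / (k * sin (k * l₁))) (A₂ := 2 * cos (k * l₂) / (k * sin (k * l₂)))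
    (x₁ := 1 / (k * sin (k * l₁))) (x₂ := 1 / (k * sin (k * l₂))) (by norm_cast)
    (by exact_mod_cast hk.ne') (by exact_mod_cast hs₁) (by exact_mod_cast hs₂)
    (by push_cast; rfl) (by push_cast; rfl) (by push_cast; rfl) (by push_cast; rfl)).1]
  have e : ∀ x : ℝ, |1 / (k * x)| = 1 / |x| / k := fun x => by
    rw [abs_div, abs_mul, abs_of_pos hk, abs_one]; field_simp
  have e2 : 2 * cos (k * l₁) / (k * sin (k * l₁)) + 2 * cos (k * l₂) / (k * sin (k * l₂)) =
      2 * (cos (k * l₁) / sin (k * l₁) + cos (k * l₂) / sin (k * l₂)) / k := by field_simp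
  rw [e, e, e2, ← add_div, mul_div_assoc' 2 (_ + _) k, abs_div_sub_le_iff hk, cotHalf, cotHalf,
    tanHalf, tanHalf]
  constructor <;> rintro ⟨a, b⟩ <;> constructor <;> linarith

theorem sq_notMem_kronigPenneyEnergies {l : ℝ} (hl : 0 < l) (D : ℝ) {k : ℝ}
    (hk : 0 < k) (hs : sin (k * l) ≠ 0)
    (h : 2 * cotHalf (k * l) < D * k ∨ 2 * tanHalf (k * l) < -(D * k)) :
    k ^ 2 ∉ kronigPenneyEnergies l D := by
  refine notMem_kronigPenneyEnergies hl (k := k) (by norm_cast) (by exact_mod_cast hk.ne')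
    (by exact_mod_cast hs) ?_
  have e : ‖1 / (k * Complex.sin (k * l))‖ = 1 / |sin (k * l)| / k := by
    have : (1 / (k * Complex.sin (k * l)) : ℂ) = ((1 / (k * sin (k * l)) : ℝ) : ℂ) := by
      push_cast; rfl
    rw [this, Complex.norm_real, Real.norm_eq_abs, abs_div, abs_mul, abs_of_pos hk, abs_one]
    field_simp
  have e2 : (2 * Complex.cos (k * l) / (k * Complex.sin (k * l)) - D : ℂ) =
      ((2 * (cos (k * l) / sin (k * l)) / k - D : ℝ) : ℂ) := by
    push_cast
    congr 1
    field_simp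
  rw [e, e2, Complex.norm_real, Real.norm_eq_abs, mul_div_assoc', ← not_le, abs_div_sub_le_iff hk]
  rw [cotHalf, tanHalf] at h
  rintro ⟨a, b⟩
  rcases h with h | h <;> linarith

/-! ### The condition at negative energies -/

theorem sin_mul_I_mul (κ l : ℝ) :
    (κ * Complex.I : ℂ) * Complex.sin (κ * Complex.I * l) = ((-(κ * sinh (κ * l)) : ℝ) : ℂ) := by
  have : (κ * Complex.I * l : ℂ) = (κ * l : ℂ) * Complex.I := by ring
  rw [this, Complex.sin_mul_I]
  push_cast
  linear_combination (κ * Complex.sinh (κ * l)) * Complex.I_mul_I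

theorem cos_mul_I_mul (κ l : ℝ) :
    Complex.cos (κ * Complex.I * l) = ((cosh (κ * l) : ℝ) : ℂ) := by
  have : (κ * Complex.I * l : ℂ) = (κ * l : ℂ) * Complex.I := by ring
  rw [this, Complex.cos_mul_I]
  push_cast
  rfl

theorem sin_mul_I_mul_ne_zero {κ l : ℝ} (hκ : 0 < κ) (hl : 0 < l) :
    Complex.sin (κ * Complex.I * l) ≠ 0 := by
  intro h
  have := sin_mul_I_mul κ l
  rw [h, mul_zero] at this
  have h2 : -(κ * sinh (κ * l)) = 0 := by exact_mod_cast this.symm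
  have : 0 < sinh (κ * l) := sinh_pos_iff.2 (by positivity)
  nlinarith [mul_pos hκ this]

theorem one_div_sinh_sub {x : ℝ} (hx : 0 < x) : cosh x / sinh x - 1 / sinh x = tanh (x / 2) ∧
    1 / sinh x + cosh x / sinh x = (tanh (x / 2))⁻¹ := by
  have h1 : sinh x = 2 * sinh (x / 2) * cosh (x / 2) := by
    rw [← sinh_two_mul]; congr 1; ring
  have h2 : cosh x = cosh (x / 2) ^ 2 + sinh (x / 2) ^ 2 := by
    rw [← cosh_two_mul]; congr 1; ring
  have h3 := cosh_sq_sub_sinh_sq (x / 2)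
  have hs : 0 < sinh (x / 2) := sinh_pos_iff.2 (by positivity)
  have hc : 0 < cosh (x / 2) := cosh_pos _
  rw [h1, h2, tanh_eq_sinh_div_cosh]
  constructor
  · field_simp
    linear_combination h3
  · field_simp
    linear_combination -h3

/-- The general criterion at `k = i κ`, where `k sin (k l) = -κ sinh (κ l)` is real and the
hyperbolic half-angle formulas apply. -/
theorem neg_sq_mem_latticeSpectrum_iff_and {l₁ l₂ : ℝ} (h₁ : 0 < l₁) (h₂ : 0 < l₂) (D : ℝ) {κ : ℝ}
    (hκ : 0 < κ) : (((-κ ^ 2 : ℝ) : ℂ) ∈ latticeSpectrum l₁ l₂ D ↔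
      2 * (tanh (κ * l₁ / 2) + tanh (κ * l₂ / 2)) ≤ -(D * κ) ∧
      -(D * κ) ≤ 2 * ((tanh (κ * l₁ / 2))⁻¹ + (tanh (κ * l₂ / 2))⁻¹)) ∧
    (((-κ ^ 2 : ℝ) : ℂ) ∉ latticeSpectrum l₁ l₂ D → ∀ z ∈ latticeSpectrum l₁ l₂ D, z.im = 0) := by
  have hk : (κ * Complex.I : ℂ) ≠ 0 := mul_ne_zero (by exact_mod_cast hκ.ne') Complex.I_ne_zero
  have key := mem_latticeSpectrum_iff_and h₁ h₂ (D := D) (E := -κ ^ 2) (k := κ * Complex.I)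
    (A₁ := 2 * cosh (κ * l₁) / (-(κ * sinh (κ * l₁))))
    (A₂ := 2 * cosh (κ * l₂) / (-(κ * sinh (κ * l₂))))
    (x₁ := 1 / (-(κ * sinh (κ * l₁)))) (x₂ := 1 / (-(κ * sinh (κ * l₂))))
    (by rw [mul_pow, Complex.I_sq]; push_cast; ring) hk
    (sin_mul_I_mul_ne_zero hκ h₁) (sin_mul_I_mul_ne_zero hκ h₂)
    (by rw [sin_mul_I_mul, cos_mul_I_mul]; push_cast; rfl)
    (by rw [sin_mul_I_mul, cos_mul_I_mul]; push_cast; rfl)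
    (by rw [sin_mul_I_mul]; push_cast; rfl) (by rw [sin_mul_I_mul]; push_cast; rfl)
  refine ⟨key.1.trans ?_, key.2⟩
  have hs₁ : 0 < sinh (κ * l₁) := sinh_pos_iff.2 (by positivity)
  have hs₂ : 0 < sinh (κ * l₂) := sinh_pos_iff.2 (by positivity)
  obtain ⟨a₁, b₁⟩ := one_div_sinh_sub (x := κ * l₁) (by positivity)
  obtain ⟨a₂, b₂⟩ := one_div_sinh_sub (x := κ * l₂) (by positivity)
  have e : ∀ x : ℝ, 0 < x → |1 / (-(κ * x))| = 1 / x / κ := fun x hx => by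
    rw [abs_div, abs_neg, abs_of_pos (mul_pos hκ hx), abs_one]; field_simp
  have e2 : 2 * cosh (κ * l₁) / (-(κ * sinh (κ * l₁))) +
      2 * cosh (κ * l₂) / (-(κ * sinh (κ * l₂))) - D =
      -(2 * (cosh (κ * l₁) / sinh (κ * l₁) + cosh (κ * l₂) / sinh (κ * l₂)) / κ - -D) := by
    field_simp
    ring
  rw [e _ hs₁, e _ hs₂, e2, abs_neg, ← add_div, mul_div_assoc' 2 (_ + _) κ, abs_div_sub_le_iff hκ, ← b₁, ← b₂,
    ← a₁, ← a₂]
  constructor <;> rintro ⟨a, b⟩ <;> constructor <;> linarith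

theorem neg_sq_mem_latticeEnergies_iff {l₁ l₂ : ℝ} (h₁ : 0 < l₁) (h₂ : 0 < l₂) (D : ℝ) {κ : ℝ}
    (hκ : 0 < κ) : -κ ^ 2 ∈ latticeEnergies l₁ l₂ D ↔
      2 * (tanh (κ * l₁ / 2) + tanh (κ * l₂ / 2)) ≤ -(D * κ) ∧
      -(D * κ) ≤ 2 * ((tanh (κ * l₁ / 2))⁻¹ + (tanh (κ * l₂ / 2))⁻¹) :=
  (neg_sq_mem_latticeSpectrum_iff_and h₁ h₂ D hκ).1

theorem latticeSpectrum_eq_ofReal_image {l₁ l₂ : ℝ} (h₁ : 0 < l₁) (h₂ : 0 < l₂) (D : ℝ) {κ : ℝ}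
    (hκ : 0 < κ) (h : -κ ^ 2 ∉ latticeEnergies l₁ l₂ D) :
    latticeSpectrum l₁ l₂ D = Complex.ofReal '' latticeEnergies l₁ l₂ D := by
  have him := (neg_sq_mem_latticeSpectrum_iff_and h₁ h₂ D hκ).2 h
  ext z
  constructor
  · intro hz
    have e : ((z.re : ℝ) : ℂ) = z := Complex.ext (by simp) (by simp [him z hz])
    exact ⟨z.re, by rwa [latticeEnergies, mem_ofPred_eq, e], e⟩
  · rintro ⟨E, hE, rfl⟩
    exact hE

theorem neg_sq_notMem_kronigPenneyEnergies {l : ℝ} (hl : 0 < l) (D : ℝ) {κ : ℝ} (hκ : 0 < κ)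
    (h : -(D * κ) < 2 * tanh (κ * l / 2) ∨ 2 * (tanh (κ * l / 2))⁻¹ < -(D * κ)) :
    -κ ^ 2 ∉ kronigPenneyEnergies l D := by
  have hk : (κ * Complex.I : ℂ) ≠ 0 := mul_ne_zero (by exact_mod_cast hκ.ne') Complex.I_ne_zero
  refine notMem_kronigPenneyEnergies hl (k := κ * Complex.I)
    (by rw [mul_pow, Complex.I_sq]; push_cast; ring) hk (sin_mul_I_mul_ne_zero hκ hl) ?_
  have hs : 0 < sinh (κ * l) := sinh_pos_iff.2 (by positivity)
  obtain ⟨a, b⟩ := one_div_sinh_sub (x := κ * l) (by positivity)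
  rw [sin_mul_I_mul, cos_mul_I_mul]
  have e : ‖(1 / ((-(κ * sinh (κ * l)) : ℝ) : ℂ))‖ = 1 / sinh (κ * l) / κ := by
    rw [norm_div, norm_one, Complex.norm_real, Real.norm_eq_abs, abs_neg,
      abs_of_pos (mul_pos hκ hs)]
    field_simp
  have e2 : (2 * ((cosh (κ * l) : ℝ) : ℂ) / ((-(κ * sinh (κ * l)) : ℝ) : ℂ) - D : ℂ) =
      ((-(2 * (cosh (κ * l) / sinh (κ * l)) / κ - -D) : ℝ) : ℂ) := by
    have : -(2 * (cosh (κ * l) / sinh (κ * l)) / κ - -D) =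
        2 * cosh (κ * l) / (-(κ * sinh (κ * l))) - D := by
      field_simp
      ring
    rw [this]
    push_cast
    rfl
  rw [e, e2, Complex.norm_real, Real.norm_eq_abs, abs_neg, mul_div_assoc', ← not_le,
    abs_div_sub_le_iff hκ]
  rw [← b, ← a] at h
  rintro ⟨c, d⟩
  rcases h with h | h <;> linarith

/-! ### Monotone functions of one variable -/

/-- The set where `g ≥ 0` is an initial segment, relatively closed by continuity, and its supremum
is the threshold. Only the sign of `g` has to be monotone, not `g` itself. -/
theorem exists_threshold_le {g : ℝ → ℝ} {p q : ℝ} (hc : ContinuousOn g (Ioo p q))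
    (hg : ∀ x ∈ Ioo p q, ∀ y ∈ Ioo p q, x < y → 0 ≤ g y → 0 ≤ g x)
    (hex : ∃ x ∈ Ioo p q, 0 ≤ g x) :
    ∃ c, p < c ∧ c ≤ q ∧ ∀ x ∈ Ioo p q, 0 ≤ g x ↔ x ≤ c := by
  set T : Set ℝ := {x | x ∈ Ioo p q ∧ 0 ≤ g x} with hT
  have hne : T.Nonempty := hex.imp fun x hx => ⟨hx.1, hx.2⟩
  have hbdd : BddAbove T := ⟨q, fun x hx => hx.1.2.le⟩
  have hlub := isLUB_csSup hne hbdd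
  obtain ⟨x₀, hx₀, hgx₀⟩ := hex
  refine ⟨sSup T, hx₀.1.trans_le (hlub.1 ⟨hx₀, hgx₀⟩), hlub.2 fun x hx => hx.1.2.le, fun x hx =>
    ⟨fun h => hlub.1 ⟨hx, h⟩, fun h => ?_⟩⟩
  rcases h.lt_or_eq with h | h
  · obtain ⟨y, hy, hxy⟩ := (lt_isLUB_iff hlub).1 h
    exact hg x hx y hy.1 hxy hy.2
  · have hmem : x ∈ closure T := h ▸ csSup_mem_closure hne hbdd
    have hcw : ContinuousWithinAt g T x := (hc x hx).mono fun y hy => hy.1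
    exact closure_minimal (by rintro _ ⟨y, hy, rfl⟩; exact hy.2) isClosed_Ici
      (hcw.mem_closure_image hmem)

theorem exists_threshold_ge {g : ℝ → ℝ} {p q : ℝ} (hc : ContinuousOn g (Ioo p q))
    (hg : ∀ x ∈ Ioo p q, ∀ y ∈ Ioo p q, x < y → 0 ≤ g x → 0 ≤ g y)
    (hex : ∃ x ∈ Ioo p q, 0 ≤ g x) :
    ∃ d, p ≤ d ∧ d < q ∧ ∀ x ∈ Ioo p q, 0 ≤ g x ↔ d ≤ x := by
  have hm : ∀ {x}, x ∈ Ioo (-q) (-p) → -x ∈ Ioo p q := fun {x} hx => by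
    constructor <;> linarith [hx.1, hx.2]
  have hm' : ∀ {x}, x ∈ Ioo p q → -x ∈ Ioo (-q) (-p) := fun {x} hx => by
    constructor <;> linarith [hx.1, hx.2]
  obtain ⟨x₀, hx₀, h₀⟩ := hex
  obtain ⟨c, h1, h2, h3⟩ := exists_threshold_le (g := fun x => g (-x)) (p := -q) (q := -p)
    (hc.comp continuousOn_neg fun x hx => hm hx)
    (fun x hx y hy hxy h => hg _ (hm hy) _ (hm hx) (neg_lt_neg hxy) h)
    ⟨-x₀, hm' hx₀, by simpa using h₀⟩
  refine ⟨-c, by linarith, by linarith, fun x hx => ?_⟩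
  have := h3 (-x) (hm' hx)
  rw [neg_neg] at this
  rw [this, neg_le]

/-- The sign of the derivative is that of `2 z - sin (2 z)`. -/
theorem tan_div_self_lt {x y : ℝ} (hx : 0 < x) (hxy : x < y) (hy : y < π / 2) :
    tan x / x < tan y / y := by
  have hcos : ∀ z ∈ Ioo 0 (π / 2), 0 < cos z := fun z hz =>
    cos_pos_of_mem_Ioo ⟨by linarith [hz.1, pi_pos], hz.2⟩
  have hd : ∀ z ∈ Ioo 0 (π / 2), HasDerivAt (fun z => tan z / z)
      ((1 / cos z ^ 2 * z - tan z * 1) / z ^ 2) z := fun z hz =>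
    (hasDerivAt_tan (hcos z hz).ne').div (hasDerivAt_id z) hz.1.ne'
  refine strictMonoOn_of_deriv_pos (D := Ioo 0 (π / 2)) (convex_Ioo _ _)
    (fun z hz => (hd z hz).continuousAt.continuousWithinAt) ?_ ⟨hx, hxy.trans hy⟩
    ⟨hx.trans hxy, hy⟩ hxy
  intro z hz
  rw [interior_Ioo] at hz
  rw [(hd z hz).deriv]
  have hc := hcos z hz
  have hz0 := hz.1
  have : 1 / cos z ^ 2 * z - tan z * 1 = (z - sin z * cos z) / cos z ^ 2 := by
    rw [tan_eq_sin_div_cos]; field_simp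
  rw [this]
  have h1 : sin (2 * z) < 2 * z := sin_lt (by linarith)
  rw [sin_two_mul] at h1
  exact div_pos (div_pos (by linarith) (by positivity)) (by positivity)

theorem hasDerivAt_tanh (x : ℝ) : HasDerivAt tanh (1 / cosh x ^ 2) x := by
  have h := (hasDerivAt_sinh x).div (hasDerivAt_cosh x) (cosh_pos x).ne'
  have e : tanh = fun x => sinh x / cosh x := funext tanh_eq_sinh_div_cosh
  rw [e]
  refine h.congr_deriv ?_
  congr 1
  linear_combination cosh_sq_sub_sinh_sq x

/-- The sign of the derivative is that of `2 z - sinh (2 z)`. -/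
theorem tanh_div_self_lt {x y : ℝ} (hx : 0 < x) (hxy : x < y) : tanh y / y < tanh x / x := by
  have hd : ∀ z ∈ Ioi (0 : ℝ), HasDerivAt (fun z => tanh z / z)
      ((1 / cosh z ^ 2 * z - tanh z * 1) / z ^ 2) z := fun z hz =>
    (hasDerivAt_tanh z).div (hasDerivAt_id z) (ne_of_gt hz)
  refine strictAntiOn_of_deriv_neg (D := Ioi (0 : ℝ)) (convex_Ioi _)
    (fun z hz => (hd z hz).continuousAt.continuousWithinAt) ?_ hx (hx.trans hxy) hxy
  intro z hz
  rw [interior_Ioi] at hz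
  rw [(hd z hz).deriv]
  have hz0 : 0 < z := hz
  have hc := cosh_pos z
  have : 1 / cosh z ^ 2 * z - tanh z * 1 = (z - sinh z * cosh z) / cosh z ^ 2 := by
    rw [tanh_eq_sinh_div_cosh]; field_simp
  rw [this]
  have h1 : 2 * z < sinh (2 * z) := self_lt_sinh_iff.2 (by linarith)
  rw [sinh_two_mul] at h1
  exact div_neg_of_neg_of_pos (div_neg_of_neg_of_pos (by linarith) (by positivity)) (by positivity)

theorem tanh_pos_of_pos {x : ℝ} (hx : 0 < x) : 0 < tanh x := by
  rw [tanh_eq_sinh_div_cosh]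
  exact div_pos (sinh_pos_iff.2 hx) (cosh_pos x)

theorem tanh_lt_tanh {x y : ℝ} (hxy : x < y) : tanh x < tanh y :=
  strictMono_of_deriv_pos (fun z => by
    rw [(hasDerivAt_tanh z).deriv]
    have := cosh_pos z
    positivity) hxy

theorem tanh_lt_self {x : ℝ} (hx : 0 < x) : tanh x < x := by
  have hd : ∀ z, HasDerivAt (fun z => z - tanh z) (1 - 1 / cosh z ^ 2) z := fun z =>
    (hasDerivAt_id z).sub (hasDerivAt_tanh z)
  have hmono : StrictMonoOn (fun z => z - tanh z) (Ici 0) := by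
    refine strictMonoOn_of_deriv_pos (convex_Ici 0)
      (fun z _ => (hd z).continuousAt.continuousWithinAt) fun z hz => ?_
    rw [interior_Ici] at hz
    rw [(hd z).deriv, sub_pos, div_lt_one (by have := cosh_pos z; positivity)]
    exact one_lt_pow₀ (one_lt_cosh.2 (ne_of_gt hz)) two_ne_zero
  have := hmono (mem_Ici.2 le_rfl) (mem_Ici.2 hx.le) hx
  simp only [tanh_zero, sub_zero] at this
  linarith

/-! ### Half-angle functions between consecutive zeros of the sine -/

theorem sin_two_mul_add_ne_zero {u : ℝ} (hu : u ∈ Ioo 0 (π / 2)) (n : ℕ) :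
    sin (2 * u + n * π) ≠ 0 := by
  rw [sin_add_nat_mul_pi]
  have : 0 < sin (2 * u) := sin_pos_of_pos_of_lt_pi (by linarith [hu.1]) (by linarith [hu.2])
  exact mul_ne_zero (pow_ne_zero _ (by norm_num)) this.ne'

theorem tanHalf_two_mul_add {u : ℝ} (hu : u ∈ Ioo 0 (π / 2)) (n : ℕ) :
    tanHalf (2 * u + n * π) = tan u ∧ cotHalf (2 * u + n * π) = (tan u)⁻¹ := by
  have h2 : 0 < sin (2 * u) := sin_pos_of_pos_of_lt_pi (by linarith [hu.1]) (by linarith [hu.2])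
  have hs : 0 < sin u := sin_pos_of_pos_of_lt_pi hu.1 (by linarith [hu.2, pi_pos])
  have hc : 0 < cos u := cos_pos_of_mem_Ioo ⟨by linarith [hu.1, pi_pos], hu.2⟩
  have e1 : |sin (2 * u + n * π)| = sin (2 * u) := by
    rw [sin_add_nat_mul_pi, abs_mul, abs_pow, abs_neg, abs_one, one_pow, one_mul, abs_of_pos h2]
  have e2 : cos (2 * u + n * π) / sin (2 * u + n * π) = cos (2 * u) / sin (2 * u) := by
    rw [sin_add_nat_mul_pi, cos_add_nat_mul_pi]
    exact mul_div_mul_left _ _ (pow_ne_zero _ (by norm_num))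
  have h3 := sin_sq_add_cos_sq u
  rw [tanHalf, cotHalf, e1, e2, sin_two_mul, cos_two_mul, tan_eq_sin_div_cos]
  constructor
  · field_simp
    linear_combination -2 * h3
  · field_simp
    ring

/-! ### Spectral bands between consecutive Dirichlet points -/

/-- `p < q` are consecutive points of `(π / l₁) ℕ ∪ (π / l₂) ℕ`. -/
structure IsDirichletInterval (l₁ l₂ p q : ℝ) (n₁ n₂ : ℕ) : Prop where
  nonneg : 0 ≤ p
  lt : p < q
  left₁ : n₁ * π ≤ p * l₁
  left₂ : n₂ * π ≤ p * l₂
  right₁ : q * l₁ ≤ (n₁ + 1) * π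
  right₂ : q * l₂ ≤ (n₂ + 1) * π
  left_eq : n₁ * π = p * l₁ ∨ n₂ * π = p * l₂
  right_eq : q * l₁ = (n₁ + 1) * π ∨ q * l₂ = (n₂ + 1) * π

theorem half_phase_mem {l p q k : ℝ} {n : ℕ} (hl : 0 < l) (h : n * π ≤ p * l)
    (h' : q * l ≤ (n + 1) * π) (hk : k ∈ Ioo p q) : (k * l - n * π) / 2 ∈ Ioo 0 (π / 2) := by
  have h1 := mul_lt_mul_of_pos_right hk.1 hl
  have h2 := mul_lt_mul_of_pos_right hk.2 hl
  constructor <;> linarith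

theorem continuousOn_tan_half_phase {l p q : ℝ} {n : ℕ} (hl : 0 < l) (h : n * π ≤ p * l)
    (h' : q * l ≤ (n + 1) * π) : ContinuousOn (fun k => tan ((k * l - n * π) / 2)) (Ioo p q) := by
  refine continuousOn_tan_Ioo.comp (by fun_prop) fun k hk => ?_
  have := half_phase_mem hl h h' hk
  exact ⟨by linarith [this.1, pi_pos], this.2⟩

theorem tan_half_phase_pos {l p q k : ℝ} {n : ℕ} (hl : 0 < l) (h : n * π ≤ p * l)
    (h' : q * l ≤ (n + 1) * π) (hk : k ∈ Ioo p q) : 0 < tan ((k * l - n * π) / 2) :=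
  have := half_phase_mem hl h h' hk
  tan_pos_of_pos_of_lt_pi_div_two this.1 this.2

theorem tan_half_phase_lt {l p q k k' : ℝ} {n : ℕ} (hl : 0 < l) (h : n * π ≤ p * l)
    (h' : q * l ≤ (n + 1) * π) (hk : k ∈ Ioo p q) (hk' : k' ∈ Ioo p q) (hkk : k < k') :
    tan ((k * l - n * π) / 2) < tan ((k' * l - n * π) / 2) := by
  have h1 := half_phase_mem hl h h' hk
  have h2 := half_phase_mem hl h h' hk'
  have := mul_lt_mul_of_pos_right hkk hl
  exact tan_lt_tan_of_nonneg_of_lt_pi_div_two h1.1.le h2.2 (by linarith)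

/-- With `u` the half phase, `tan u / k = (tan u / u) (u / k)`. The first factor increases, and so
does `u / k = l / 2 - n π / (2 k)` in the weak sense because `n ≥ 0`. -/
theorem tan_half_phase_mul_lt {l p q k k' : ℝ} {n : ℕ} (hl : 0 < l) (hp : 0 ≤ p)
    (h : n * π ≤ p * l) (h' : q * l ≤ (n + 1) * π) (hk : k ∈ Ioo p q) (hk' : k' ∈ Ioo p q)
    (hkk : k < k') :
    k' * tan ((k * l - n * π) / 2) < k * tan ((k' * l - n * π) / 2) := by
  have h1 := half_phase_mem hl h h' hk
  have h2 := half_phase_mem hl h h' hk'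
  have hkl := mul_lt_mul_of_pos_right hkk hl
  have ht := tan_div_self_lt h1.1 (y := (k' * l - n * π) / 2) (by linarith) h2.2
  rw [div_lt_div_iff₀ h1.1 h2.1] at ht
  set a := tan ((k * l - n * π) / 2)
  set b := tan ((k' * l - n * π) / 2)
  have ha : 0 < a := tan_half_phase_pos hl h h' hk
  have hk0 : 0 < k := hp.trans_lt hk.1
  have h3 : (k * l - n * π) / 2 * k' ≤ (k' * l - n * π) / 2 * k := by
    have := mul_nonneg (mul_nonneg n.cast_nonneg pi_pos.le) (sub_nonneg.2 hkk.le)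
    linarith
  refine lt_of_mul_lt_mul_left ?_ h1.1.le
  calc (k * l - n * π) / 2 * (k' * a) = (k * l - n * π) / 2 * k' * a := by ring
    _ ≤ (k' * l - n * π) / 2 * k * a := by gcongr
    _ = k * (a * ((k' * l - n * π) / 2)) := by ring
    _ < k * (b * ((k * l - n * π) / 2)) := by gcongr
    _ = _ := by ring

theorem exists_tan_half_phase_lt {l p q ε : ℝ} {n : ℕ} (hpq : p < q) (h : n * π = p * l)
    (hε : 0 < ε) : ∃ k ∈ Ioo p q, tan ((k * l - n * π) / 2) < ε := by
  have hc : ContinuousAt (fun k => tan ((k * l - n * π) / 2)) p := by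
    refine ContinuousAt.comp (g := tan) (continuousAt_tan.2 ?_) (by fun_prop)
    rw [h]; simp
  have h0 : tan ((p * l - n * π) / 2) < ε := by rw [h]; simpa using hε
  have h1 := (hc.eventually (gt_mem_nhds h0)).filter_mono (nhdsWithin_le_nhds (s := Ioi p))
  obtain ⟨k, hk, hk'⟩ := (h1.and (Ioo_mem_nhdsGT hpq)).exists
  exact ⟨k, hk', hk⟩

/-- The divergence at `q` is read off from the tangent of the complementary angle, which is
continuous and zero there. -/
theorem exists_lt_tan_half_phase {l p q M : ℝ} {n : ℕ} (hl : 0 < l) (hpq : p < q)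
    (h : n * π ≤ p * l) (h' : q * l = (n + 1) * π) (hM : 0 < M) :
    ∃ k ∈ Ioo p q, M < tan ((k * l - n * π) / 2) := by
  have e0 : π / 2 - (q * l - n * π) / 2 = 0 := by rw [h']; ring
  have hc : ContinuousAt (fun k => tan (π / 2 - (k * l - n * π) / 2)) q := by
    refine ContinuousAt.comp (g := tan) (continuousAt_tan.2 ?_) (by fun_prop)
    rw [e0]; simp
  have h0 : tan (π / 2 - (q * l - n * π) / 2) < M⁻¹ := by rw [e0]; simpa using hM
  have h1 := (hc.eventually (gt_mem_nhds h0)).filter_mono (nhdsWithin_le_nhds (s := Iio q))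
  obtain ⟨k, hk, hk'⟩ := (h1.and (Ioo_mem_nhdsLT hpq)).exists
  refine ⟨k, hk', ?_⟩
  rw [tan_pi_div_two_sub] at hk
  exact (inv_lt_inv₀ (tan_half_phase_pos hl h h'.le hk') hM).1 hk

namespace IsDirichletInterval

variable {l₁ l₂ p q k : ℝ} {n₁ n₂ : ℕ}

theorem sq_mem_iff (h : IsDirichletInterval l₁ l₂ p q n₁ n₂) (h₁ : 0 < l₁) (h₂ : 0 < l₂) (D : ℝ)
    (hk : k ∈ Ioo p q) : k ^ 2 ∈ latticeEnergies l₁ l₂ D ↔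
      D * k ≤ 2 * ((tan ((k * l₁ - n₁ * π) / 2))⁻¹ + (tan ((k * l₂ - n₂ * π) / 2))⁻¹) ∧
      -(D * k) ≤ 2 * (tan ((k * l₁ - n₁ * π) / 2) + tan ((k * l₂ - n₂ * π) / 2)) := by
  have u₁ := half_phase_mem h₁ h.left₁ h.right₁ hk
  have u₂ := half_phase_mem h₂ h.left₂ h.right₂ hk
  have e : ∀ (l : ℝ) (n : ℕ), 2 * ((k * l - n * π) / 2) + n * π = k * l := fun l n => by ring
  have s₁ := sin_two_mul_add_ne_zero u₁ n₁
  have s₂ := sin_two_mul_add_ne_zero u₂ n₂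
  obtain ⟨a₁, b₁⟩ := tanHalf_two_mul_add u₁ n₁
  obtain ⟨a₂, b₂⟩ := tanHalf_two_mul_add u₂ n₂
  rw [e] at s₁ s₂ a₁ a₂ b₁ b₂
  rw [sq_mem_latticeEnergies_iff h₁ h₂ D (h.nonneg.trans_lt hk.1) s₁ s₂, a₁, a₂, b₁, b₂]

/-- For `D > 0` the tangent condition is automatic. The cotangents decrease while `D k` increases,
and one cotangent blows up at the left end, so the band starts there. -/
theorem exists_upper_of_pos (h : IsDirichletInterval l₁ l₂ p q n₁ n₂) (h₁ : 0 < l₁) (h₂ : 0 < l₂)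
    {D : ℝ} (hD : 0 < D) : ∃ c, p < c ∧ c ≤ q ∧
      ∀ k ∈ Ioo p q, k ^ 2 ∈ latticeEnergies l₁ l₂ D ↔ k ≤ c := by
  have pos₁ := fun {k} (hk : k ∈ Ioo p q) => tan_half_phase_pos h₁ h.left₁ h.right₁ hk
  have pos₂ := fun {k} (hk : k ∈ Ioo p q) => tan_half_phase_pos h₂ h.left₂ h.right₂ hk
  have key := exists_threshold_le (p := p) (q := q)
    (g := fun k => 2 * ((tan ((k * l₁ - n₁ * π) / 2))⁻¹ + (tan ((k * l₂ - n₂ * π) / 2))⁻¹) - D * k)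
    ((((continuousOn_tan_half_phase h₁ h.left₁ h.right₁).inv₀ fun k hk => (pos₁ hk).ne').add
      ((continuousOn_tan_half_phase h₂ h.left₂ h.right₂).inv₀ fun k hk => (pos₂ hk).ne')).const_mul
        2 |>.sub (by fun_prop)) ?_ ?_
  · obtain ⟨c, hpc, hcq, hc⟩ := key
    refine ⟨c, hpc, hcq, fun k hk => ?_⟩
    rw [h.sq_mem_iff h₁ h₂ D hk, ← hc k hk, sub_nonneg, and_iff_left_iff_imp]
    intro _
    have := mul_pos hD (h.nonneg.trans_lt hk.1)
    linarith [pos₁ hk, pos₂ hk]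
  · intro x hx y hy hxy hgy
    have i₁ := inv_strictAnti₀ (pos₁ hx) (tan_half_phase_lt h₁ h.left₁ h.right₁ hx hy hxy)
    have i₂ := inv_strictAnti₀ (pos₂ hx) (tan_half_phase_lt h₂ h.left₂ h.right₂ hx hy hxy)
    have i₃ := mul_lt_mul_of_pos_left hxy hD
    linarith
  · have hq : 0 < D * q := mul_pos hD (h.nonneg.trans_lt h.lt)
    have fin : ∀ t k : ℝ, 0 < t → t < (D * q)⁻¹ → k ∈ Ioo p q → D * k ≤ 2 * t⁻¹ :=
      fun t k ht htq hk => by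
        have := (lt_inv_comm₀ ht hq).1 htq
        have := mul_lt_mul_of_pos_left hk.2 hD
        linarith
    rcases h.left_eq with he | he
    · obtain ⟨k, hk, hlt⟩ := exists_tan_half_phase_lt h.lt he (inv_pos.2 hq)
      have := fin _ k (pos₁ hk) hlt hk
      exact ⟨k, hk, by linarith [inv_pos.2 (pos₂ hk)]⟩
    · obtain ⟨k, hk, hlt⟩ := exists_tan_half_phase_lt h.lt he (inv_pos.2 hq)
      have := fin _ k (pos₂ hk) hlt hk
      exact ⟨k, hk, by linarith [inv_pos.2 (pos₁ hk)]⟩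

/-- For `D < 0` the cotangent condition is automatic. After division by `k` the tangent side
increases, and it blows up at the right end, so the band reaches that end. -/
theorem exists_lower_of_neg (h : IsDirichletInterval l₁ l₂ p q n₁ n₂) (h₁ : 0 < l₁) (h₂ : 0 < l₂)
    {D : ℝ} (hD : D < 0) : ∃ d, p ≤ d ∧ d < q ∧
      ∀ k ∈ Ioo p q, k ^ 2 ∈ latticeEnergies l₁ l₂ D ↔ d ≤ k := by
  have pos₁ := fun {k} (hk : k ∈ Ioo p q) => tan_half_phase_pos h₁ h.left₁ h.right₁ hk
  have pos₂ := fun {k} (hk : k ∈ Ioo p q) => tan_half_phase_pos h₂ h.left₂ h.right₂ hk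
  have key := exists_threshold_ge (p := p) (q := q)
    (g := fun k => 2 * (tan ((k * l₁ - n₁ * π) / 2) + tan ((k * l₂ - n₂ * π) / 2)) - -(D * k))
    (((continuousOn_tan_half_phase h₁ h.left₁ h.right₁).add
      (continuousOn_tan_half_phase h₂ h.left₂ h.right₂)).const_mul 2 |>.sub (by fun_prop)) ?_ ?_
  · obtain ⟨d, hpd, hdq, hd⟩ := key
    refine ⟨d, hpd, hdq, fun k hk => ?_⟩
    rw [h.sq_mem_iff h₁ h₂ D hk, ← hd k hk, sub_nonneg, and_iff_right_iff_imp]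
    intro _
    have := mul_neg_of_neg_of_pos hD (h.nonneg.trans_lt hk.1)
    linarith [inv_pos.2 (pos₁ hk), inv_pos.2 (pos₂ hk)]
  · intro x hx y hy hxy hgx
    have i₁ := tan_half_phase_mul_lt h₁ h.nonneg h.left₁ h.right₁ hx hy hxy
    have i₂ := tan_half_phase_mul_lt h₂ h.nonneg h.left₂ h.right₂ hx hy hxy
    have hx0 : 0 < x := h.nonneg.trans_lt hx.1
    have hgx' := mul_nonneg (hx0.trans hxy).le hgx
    refine le_of_mul_le_mul_left ?_ hx0
    linarith
  · have hq : 0 < -(D * q) := neg_pos.2 (mul_neg_of_neg_of_pos hD (h.nonneg.trans_lt h.lt))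
    have fin : ∀ k ∈ Ioo p q, -(D * k) ≤ -(D * q) := fun k hk => by
      have := mul_lt_mul_of_neg_left hk.2 hD
      linarith
    rcases h.right_eq with he | he
    · obtain ⟨k, hk, hlt⟩ := exists_lt_tan_half_phase h₁ h.lt h.left₁ he hq
      exact ⟨k, hk, by linarith [fin k hk, pos₂ hk]⟩
    · obtain ⟨k, hk, hlt⟩ := exists_lt_tan_half_phase h₂ h.lt h.left₂ he hq
      exact ⟨k, hk, by linarith [fin k hk, pos₁ hk]⟩

/-- On the first interval both phases start at zero, and `tan u > u` bounds the tangent side below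
by `k (l₁ + l₂) ≥ -D k`. -/
theorem sq_mem_of_left_eq_zero (h : IsDirichletInterval l₁ l₂ 0 q n₁ n₂) (h₁ : 0 < l₁)
    (h₂ : 0 < l₂) {D : ℝ} (hD : D < 0) (hD' : -l₁ - l₂ ≤ D) (hk : k ∈ Ioo 0 q) :
    k ^ 2 ∈ latticeEnergies l₁ l₂ D := by
  have hn : ∀ n : ℕ, (n : ℝ) * π ≤ 0 → (n : ℝ) = 0 := fun n hn =>
    le_antisymm (nonpos_of_mul_nonpos_left hn pi_pos) n.cast_nonneg
  have e₁ := hn n₁ (by simpa using h.left₁)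
  have e₂ := hn n₂ (by simpa using h.left₂)
  have u₁ := half_phase_mem h₁ h.left₁ h.right₁ hk
  have u₂ := half_phase_mem h₂ h.left₂ h.right₂ hk
  have t₁ := lt_tan u₁.1 u₁.2
  have t₂ := lt_tan u₂.1 u₂.2
  rw [h.sq_mem_iff h₁ h₂ D hk]
  rw [e₁] at *
  rw [e₂] at *
  have i₁ := inv_pos.2 (u₁.1.trans t₁)
  have i₂ := inv_pos.2 (u₂.1.trans t₂)
  have := mul_neg_of_neg_of_pos hD hk.1
  have := mul_le_mul_of_nonneg_right hD' hk.1.le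
  constructor <;> linarith

end IsDirichletInterval

/-! ### The sequence of Dirichlet points -/

/-- The smallest point of `(π / l₁) ℕ ∪ (π / l₂) ℕ` above `p`. -/
noncomputable def nextDirichlet (l₁ l₂ p : ℝ) : ℝ :=
  min ((⌊p * l₁ / π⌋₊ + 1) * π / l₁) ((⌊p * l₂ / π⌋₊ + 1) * π / l₂)

/-- The increasing enumeration of `(π / l₁) ℕ ∪ (π / l₂) ℕ`. -/
noncomputable def dirichletSeq (l₁ l₂ : ℝ) : ℕ → ℝ
  | 0 => 0
  | i + 1 => nextDirichlet l₁ l₂ (dirichletSeq l₁ l₂ i)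

/-- `p` is a point of `(π / l) ℕ`. -/
def IsDirichletPoint (l p : ℝ) : Prop := ∃ n : ℕ, n * π = p * l

theorem lt_floor_add_one_mul_pi_div {l : ℝ} (hl : 0 < l) (p : ℝ) :
    p < (⌊p * l / π⌋₊ + 1) * π / l := by
  rw [lt_div_iff₀ hl, ← div_lt_iff₀ pi_pos]
  exact Nat.lt_floor_add_one _

theorem lt_nextDirichlet {l₁ l₂ : ℝ} (h₁ : 0 < l₁) (h₂ : 0 < l₂) (p : ℝ) :
    p < nextDirichlet l₁ l₂ p :=
  lt_min (lt_floor_add_one_mul_pi_div h₁ p) (lt_floor_add_one_mul_pi_div h₂ p)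

theorem floor_mul_pi_le {l p : ℝ} (hl : 0 < l) (hp : 0 ≤ p) : ⌊p * l / π⌋₊ * π ≤ p * l := by
  rw [← le_div_iff₀ pi_pos]
  exact Nat.floor_le (by positivity)

theorem nextDirichlet_eq {l₁ l₂ : ℝ} (h₁ : 0 < l₁) (h₂ : 0 < l₂) (p : ℝ) :
    nextDirichlet l₁ l₂ p * l₁ = (⌊p * l₁ / π⌋₊ + 1) * π ∨
      nextDirichlet l₁ l₂ p * l₂ = (⌊p * l₂ / π⌋₊ + 1) * π := by
  rcases min_choice ((⌊p * l₁ / π⌋₊ + 1) * π / l₁) ((⌊p * l₂ / π⌋₊ + 1) * π / l₂) with h | h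
  · exact Or.inl (by rw [nextDirichlet, h, div_mul_cancel₀ _ h₁.ne'])
  · exact Or.inr (by rw [nextDirichlet, h, div_mul_cancel₀ _ h₂.ne'])

theorem dirichletSeq_strictMono {l₁ l₂ : ℝ} (h₁ : 0 < l₁) (h₂ : 0 < l₂)
    : StrictMono (dirichletSeq l₁ l₂) :=
  strictMono_nat_of_lt_succ fun _ => lt_nextDirichlet h₁ h₂ _

theorem dirichletSeq_nonneg {l₁ l₂ : ℝ} (h₁ : 0 < l₁) (h₂ : 0 < l₂)
    (i : ℕ) : 0 ≤ dirichletSeq l₁ l₂ i :=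
  (dirichletSeq_strictMono h₁ h₂).monotone (Nat.zero_le i)

theorem isDirichletPoint_dirichletSeq {l₁ l₂ : ℝ} (h₁ : 0 < l₁) (h₂ : 0 < l₂)
    (i : ℕ) :
    IsDirichletPoint l₁ (dirichletSeq l₁ l₂ i) ∨ IsDirichletPoint l₂ (dirichletSeq l₁ l₂ i) := by
  cases i with
  | zero => exact Or.inl ⟨0, by simp [dirichletSeq]⟩
  | succ i =>
    exact (nextDirichlet_eq h₁ h₂ (dirichletSeq l₁ l₂ i)).imp
      (fun h => ⟨⌊dirichletSeq l₁ l₂ i * l₁ / π⌋₊ + 1, by rw [dirichletSeq, h]; push_cast; rfl⟩)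
      (fun h => ⟨⌊dirichletSeq l₁ l₂ i * l₂ / π⌋₊ + 1, by rw [dirichletSeq, h]; push_cast; rfl⟩)

theorem IsDirichletPoint.floor_eq {l p : ℝ} (h : IsDirichletPoint l p) :
    ⌊p * l / π⌋₊ * π = p * l := by
  obtain ⟨n, hn⟩ := h
  rw [← hn, mul_div_cancel_right₀ _ pi_pos.ne', Nat.floor_natCast]

theorem isDirichletInterval_dirichletSeq {l₁ l₂ : ℝ} (h₁ : 0 < l₁) (h₂ : 0 < l₂)
    (i : ℕ) :
    IsDirichletInterval l₁ l₂ (dirichletSeq l₁ l₂ i) (dirichletSeq l₁ l₂ (i + 1))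
      ⌊dirichletSeq l₁ l₂ i * l₁ / π⌋₊ ⌊dirichletSeq l₁ l₂ i * l₂ / π⌋₊ where
  nonneg := dirichletSeq_nonneg h₁ h₂ i
  lt := dirichletSeq_strictMono h₁ h₂ i.lt_succ_self
  left₁ := floor_mul_pi_le h₁ (dirichletSeq_nonneg h₁ h₂ i)
  left₂ := floor_mul_pi_le h₂ (dirichletSeq_nonneg h₁ h₂ i)
  right₁ := (le_div_iff₀ h₁).1 (min_le_left _ _)
  right₂ := (le_div_iff₀ h₂).1 (min_le_right _ _)
  left_eq := (isDirichletPoint_dirichletSeq h₁ h₂ i).imp (fun h => h.floor_eq) fun h => h.floor_eq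
  right_eq := nextDirichlet_eq h₁ h₂ _

/-- Every step of the sequence raises at least one of the two counts; this is what makes the
sequence unbounded. -/
theorem le_floor_add_floor_dirichletSeq {l₁ l₂ : ℝ} (h₁ : 0 < l₁) (h₂ : 0 < l₂)
    (i : ℕ) :
    i ≤ ⌊dirichletSeq l₁ l₂ i * l₁ / π⌋₊ + ⌊dirichletSeq l₁ l₂ i * l₂ / π⌋₊ := by
  induction i with
  | zero => exact Nat.zero_le _
  | succ i ih =>
    have hlt := (dirichletSeq_strictMono h₁ h₂ i.lt_succ_self).le
    have m : ∀ {l : ℝ}, 0 < l → ⌊dirichletSeq l₁ l₂ i * l / π⌋₊ ≤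
        ⌊dirichletSeq l₁ l₂ (i + 1) * l / π⌋₊ := fun hl =>
      Nat.floor_mono (by have := pi_pos; gcongr)
    have s : ∀ {l : ℝ}, dirichletSeq l₁ l₂ (i + 1) * l = (⌊dirichletSeq l₁ l₂ i * l / π⌋₊ + 1) * π →
        ⌊dirichletSeq l₁ l₂ (i + 1) * l / π⌋₊ = ⌊dirichletSeq l₁ l₂ i * l / π⌋₊ + 1 :=
      fun h => by
        rw [h, mul_div_cancel_right₀ _ pi_pos.ne']
        exact_mod_cast Nat.floor_natCast (R := ℝ) (_ + 1)
    have m₁ := m h₁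
    have m₂ := m h₂
    rcases nextDirichlet_eq h₁ h₂ (dirichletSeq l₁ l₂ i) with h | h
    · have := s h
      omega
    · have := s h
      omega

theorem exists_lt_dirichletSeq {l₁ l₂ : ℝ} (h₁ : 0 < l₁) (h₂ : 0 < l₂)
    (K : ℝ) : ∃ i, K < dirichletSeq l₁ l₂ i := by
  obtain ⟨i, hi⟩ := exists_nat_gt (K * (l₁ + l₂) / π)
  refine ⟨i, ?_⟩
  have h := le_floor_add_floor_dirichletSeq h₁ h₂ i
  have h' : (i : ℝ) ≤ ⌊dirichletSeq l₁ l₂ i * l₁ / π⌋₊ + ⌊dirichletSeq l₁ l₂ i * l₂ / π⌋₊ := by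
    exact_mod_cast h
  have a₁ := floor_mul_pi_le h₁ (dirichletSeq_nonneg h₁ h₂ i)
  have a₂ := floor_mul_pi_le h₂ (dirichletSeq_nonneg h₁ h₂ i)
  rw [div_lt_iff₀ pi_pos] at hi
  have := mul_le_mul_of_nonneg_right h' pi_pos.le
  refine lt_of_mul_lt_mul_right (a := l₁ + l₂) ?_ (by positivity)
  linarith

theorem sq_dirichletSeq_mem {l₁ l₂ : ℝ} (h₁ : 0 < l₁) (h₂ : 0 < l₂)
    (D : ℝ) (i : ℕ) :
    dirichletSeq l₁ l₂ i ^ 2 ∈ latticeEnergies l₁ l₂ D := by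
  refine sq_mem_latticeEnergies_of_sin h₁ h₂ D ?_
  refine (isDirichletPoint_dirichletSeq h₁ h₂ i).imp ?_ ?_ <;>
  · rintro ⟨n, hn⟩
    rw [← hn, sin_nat_mul_pi]

theorem exists_dirichletSeq_sq_eq {l₁ l₂ : ℝ} (h₁ : 0 < l₁) (h₂ : 0 < l₂)
    (i : ℕ) :
    ∃ n : ℤ, dirichletSeq l₁ l₂ i ^ 2 = (π * n / l₁) ^ 2 ∨
      dirichletSeq l₁ l₂ i ^ 2 = (π * n / l₂) ^ 2 := by
  rcases isDirichletPoint_dirichletSeq h₁ h₂ i with ⟨n, hn⟩ | ⟨n, hn⟩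
  · exact ⟨n, Or.inl (by congr 1; rw [eq_div_iff h₁.ne', ← hn]; push_cast; ring)⟩
  · exact ⟨n, Or.inr (by congr 1; rw [eq_div_iff h₂.ne', ← hn]; push_cast; ring)⟩

theorem exists_mem_Ico_of_unbounded {a : ℕ → ℝ} (hu : ∀ K, ∃ i, K < a i)
    {x : ℝ} (hx : a 0 ≤ x) : ∃ i, x ∈ Ico (a i) (a (i + 1)) := by
  classical
  have h0 : Nat.find (hu x) ≠ 0 := fun h => by
    have := Nat.find_spec (hu x)
    rw [h] at this
    exact hx.not_gt this
  obtain ⟨m, hm⟩ := Nat.exists_eq_succ_of_ne_zero h0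
  refine ⟨m, not_lt.1 (Nat.find_min (hu x) (m := m) (by omega)), ?_⟩
  have := Nat.find_spec (hu x)
  rwa [hm] at this

/-! ### The negative part of the spectrum -/

theorem tanh_half_phase_mul_lt {l x y : ℝ} (hl : 0 < l) (hx : 0 < x) (hxy : x < y) :
    x * tanh (y * l / 2) < y * tanh (x * l / 2) := by
  have hy := hx.trans hxy
  have h := tanh_div_self_lt (x := x * l / 2) (y := y * l / 2) (by positivity) (by gcongr)
  rw [div_lt_div_iff₀ (by positivity) (by positivity)] at h
  refine lt_of_mul_lt_mul_right (a := l / 2) ?_ (by positivity)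
  linarith

theorem one_lt_inv_tanh {x : ℝ} (hx : 0 < x) : 1 < (tanh x)⁻¹ :=
  (one_lt_inv₀ (tanh_pos_of_pos hx)).2 (tanh_lt_one x)

/-- Divided by `κ`, the left side decreases strictly, with limit `l₁ + l₂` at zero. The comparison
with `-D` therefore holds on a final segment, which is all of `κ > 0` exactly when `-D ≥ l₁ + l₂`.
-/
theorem exists_tanh_threshold {l₁ l₂ : ℝ} (h₁ : 0 < l₁) (h₂ : 0 < l₂) {D : ℝ} (hD : D < 0) :
    ∃ κ₁, 0 ≤ κ₁ ∧ (∀ κ, 0 < κ →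
      (2 * (tanh (κ * l₁ / 2) + tanh (κ * l₂ / 2)) ≤ -(D * κ) ↔ κ₁ ≤ κ)) ∧
      (0 < κ₁ ↔ -l₁ - l₂ < D) := by
  have hD' : 0 < -D := neg_pos.2 hD
  have hM : ∀ κ, 4 / -D ≤ κ → 2 * (tanh (κ * l₁ / 2) + tanh (κ * l₂ / 2)) ≤ -(D * κ) := by
    intro κ hκ
    rw [div_le_iff₀ hD'] at hκ
    linarith [tanh_lt_one (κ * l₁ / 2), tanh_lt_one (κ * l₂ / 2)]
  have hM0 : 0 < 4 / -D := by positivity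
  have hmem : 4 / -D ∈ Ioo 0 (4 / -D + 1) := ⟨hM0, by linarith⟩
  have hct : Continuous tanh := continuous_iff_continuousAt.2 fun x => (hasDerivAt_tanh x).continuousAt
  obtain ⟨d, h0d, -, hd⟩ := exists_threshold_ge (p := 0) (q := 4 / -D + 1)
    (g := fun κ => -(D * κ) - 2 * (tanh (κ * l₁ / 2) + tanh (κ * l₂ / 2)))
    (Continuous.continuousOn (by fun_prop))
    (fun x hx y hy hxy hg => by
      have i₁ := tanh_half_phase_mul_lt h₁ hx.1 hxy
      have i₂ := tanh_half_phase_mul_lt h₂ hx.1 hxy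
      have := mul_nonneg hy.1.le hg
      refine le_of_mul_le_mul_left ?_ hx.1
      linarith) ⟨_, hmem, sub_nonneg.2 (hM _ le_rfl)⟩
  have hdM : d ≤ 4 / -D := (hd _ hmem).1 (sub_nonneg.2 (hM _ le_rfl))
  have hiff : ∀ κ, 0 < κ →
      (2 * (tanh (κ * l₁ / 2) + tanh (κ * l₂ / 2)) ≤ -(D * κ) ↔ d ≤ κ) := fun κ hκ => by
    rcases lt_or_ge κ (4 / -D + 1) with h | h
    · rw [← hd κ ⟨hκ, h⟩, sub_nonneg]
    · exact ⟨fun _ => by linarith, fun _ => hM κ (by linarith)⟩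
  refine ⟨d, h0d, hiff, fun hd0 => ?_, fun hDl => ?_⟩
  · by_contra! hle
    have hd2 : 0 < d / 2 := by positivity
    have t₁ := tanh_lt_self (x := d / 2 * l₁ / 2) (by positivity)
    have t₂ := tanh_lt_self (x := d / 2 * l₂ / 2) (by positivity)
    have := mul_le_mul_of_nonneg_right hle hd2.le
    have := (hiff (d / 2) hd2).1 (by linarith)
    linarith
  -- If the inequality held for all `κ > 0`, its slope at zero would give `l₁ + l₂ + D ≤ 0`.
  · by_contra! hle
    have hder : HasDerivAt (fun κ => 2 * (tanh (κ * l₁ / 2) + tanh (κ * l₂ / 2)) + D * κ)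
        (l₁ + l₂ + D) 0 := by
      have h : ∀ l : ℝ, HasDerivAt (fun κ => tanh (κ * l / 2)) (l / 2) 0 := fun l => by
        have h2 : HasDerivAt (fun κ : ℝ => κ * l / 2) (1 * l / 2) 0 :=
          ((hasDerivAt_id (0 : ℝ)).mul_const l).div_const 2
        have h3 := (hasDerivAt_tanh (0 * l / 2)).comp 0 h2
        refine h3.congr_deriv ?_
        simp
      exact ((((h l₁).add (h l₂)).const_mul 2).add ((hasDerivAt_id (0 : ℝ)).const_mul D)).congr_deriv
        (by ring)
    have ht := (hasDerivWithinAt_iff_tendsto_slope' (self_notMem_Ioi (a := (0 : ℝ)))).1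
      (hder.hasDerivWithinAt (s := Ioi 0))
    have := le_of_tendsto ht (b := 0) (by
      filter_upwards [self_mem_nhdsWithin] with κ hκ
      rw [slope_def_field]
      simp only [zero_mul, zero_div, tanh_zero, add_zero, mul_zero, sub_zero]
      exact div_nonpos_of_nonpos_of_nonneg
        (by linarith [(hiff κ hκ).2 (hle.trans (le_of_lt hκ))]) (le_of_lt hκ))
    linarith

/-- The right side decreases and the left side increases. At `κ = 4 / -D` the left side equals 4
while the right side exceeds 4, which places this point below the threshold. -/
theorem exists_inv_tanh_threshold {l₁ l₂ : ℝ} (h₁ : 0 < l₁) (h₂ : 0 < l₂) {D : ℝ} (hD : D < 0) :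
    ∃ κ₀, 4 ≤ -(D * κ₀) ∧ ∀ κ, 0 < κ →
      (-(D * κ) ≤ 2 * ((tanh (κ * l₁ / 2))⁻¹ + (tanh (κ * l₂ / 2))⁻¹) ↔ κ ≤ κ₀) := by
  have hD' : 0 < -D := neg_pos.2 hD
  have pos : ∀ {l κ : ℝ}, 0 < l → 0 < κ → 0 < tanh (κ * l / 2) := fun hl hκ =>
    tanh_pos_of_pos (by positivity)
  have one_lt : ∀ {l κ : ℝ}, 0 < l → 0 < κ → 1 < (tanh (κ * l / 2))⁻¹ := fun hl hκ =>
    one_lt_inv_tanh (by positivity)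
  have anti : ∀ {l κ κ' : ℝ}, 0 < l → 0 < κ → κ < κ' →
      (tanh (κ' * l / 2))⁻¹ < (tanh (κ * l / 2))⁻¹ := fun hl hκ h =>
    inv_strictAnti₀ (pos hl hκ) (tanh_lt_tanh (by gcongr))
  set C := 2 * ((tanh (1 * l₁ / 2))⁻¹ + (tanh (1 * l₂ / 2))⁻¹) with hC
  have hC4 : 4 < C := by linarith [one_lt h₁ one_pos, one_lt h₂ one_pos]
  -- Beyond `κ = 1` the right side is below its value `C` there, and beyond `C / -D` the left side
  -- exceeds `C`.
  set M := 1 + C / -D with hMdef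
  have hCD : 0 < C / -D := by positivity
  have hM : ∀ κ, M ≤ κ → 2 * ((tanh (κ * l₁ / 2))⁻¹ + (tanh (κ * l₂ / 2))⁻¹) < -(D * κ) := by
    intro κ hκ
    have h1κ : 1 < κ := by linarith
    have : C / -D < κ := by linarith
    rw [div_lt_iff₀ hD'] at this
    linarith [anti h₁ one_pos h1κ, anti h₂ one_pos h1κ]
  have h4 : 4 / -D ∈ Ioo 0 (M + 1) := ⟨by positivity, by
    have : 4 / -D < C / -D := by gcongr
    linarith⟩
  have e4 : -(D * (4 / -D)) = 4 := by rw [← neg_mul, mul_div_cancel₀ _ hD'.ne']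
  have h4g : 0 ≤ 2 * ((tanh (4 / -D * l₁ / 2))⁻¹ + (tanh (4 / -D * l₂ / 2))⁻¹) + D * (4 / -D) := by
    linarith [one_lt h₁ h4.1, one_lt h₂ h4.1]
  have hct : Continuous tanh := continuous_iff_continuousAt.2 fun x => (hasDerivAt_tanh x).continuousAt
  have cont : ∀ {l : ℝ}, 0 < l → ContinuousOn (fun κ => (tanh (κ * l / 2))⁻¹) (Ioo 0 (M + 1)) :=
    fun hl => ContinuousOn.inv₀ (Continuous.continuousOn (by fun_prop)) fun κ hκ => (pos hl hκ.1).ne'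
  obtain ⟨c, -, -, hc⟩ := exists_threshold_le (p := 0) (q := M + 1)
    (g := fun κ => 2 * ((tanh (κ * l₁ / 2))⁻¹ + (tanh (κ * l₂ / 2))⁻¹) + D * κ)
    ((((cont h₁).add (cont h₂)).const_mul 2).add (by fun_prop))
    (fun x hx y hy hxy hg => by
      have := mul_lt_mul_of_neg_left hxy hD
      linarith [anti h₁ hx.1 hxy, anti h₂ hx.1 hxy]) ⟨_, h4, h4g⟩
  refine ⟨c, ?_, fun κ hκ => ?_⟩
  · have := (hc _ h4).1 h4g
    rw [div_le_iff₀ hD'] at this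
    linarith
  · rcases lt_or_ge κ (M + 1) with h | h
    · rw [← hc κ ⟨hκ, h⟩]
      constructor <;> intro h <;> linarith
    · have hMc : c < M := by
        by_contra! hle
        have := (hc M ⟨by linarith, by linarith⟩).2 hle
        linarith [hM M le_rfl]
      exact ⟨fun h' => absurd (hM κ (by linarith)) (not_lt.2 h'), fun h' => by linarith⟩

theorem exists_negative_band {l₁ l₂ : ℝ} (h₁ : 0 < l₁) (h₂ : 0 < l₂) {D : ℝ} (hD : D < 0) :
    ∃ κ₁ κ₀, 0 ≤ κ₁ ∧ κ₁ < κ₀ ∧ (0 < κ₁ ↔ -l₁ - l₂ < D) ∧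
      (∀ κ, 0 < κ → (2 * (tanh (κ * l₁ / 2) + tanh (κ * l₂ / 2)) ≤ -(D * κ) ↔ κ₁ ≤ κ)) ∧
      (∀ κ, 0 < κ →
        (-(D * κ) ≤ 2 * ((tanh (κ * l₁ / 2))⁻¹ + (tanh (κ * l₂ / 2))⁻¹) ↔ κ ≤ κ₀)) := by
  obtain ⟨κ₁, h0, hκ₁, hpos⟩ := exists_tanh_threshold h₁ h₂ hD
  obtain ⟨κ₀, h4, hκ₀⟩ := exists_inv_tanh_threshold h₁ h₂ hD
  refine ⟨κ₁, κ₀, h0, ?_, hpos, hκ₁, hκ₀⟩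
  have hD' : 0 < -D := neg_pos.2 hD
  -- The number 4 separates the thresholds: `-D κ₁ ≤ 2 ∑ tanh < 4 ≤ -D κ₀`.
  refine lt_of_mul_lt_mul_left (a := -D) (lt_of_lt_of_le ?_ (h4.trans_eq (by ring))) hD'.le
  rcases h0.eq_or_lt with rfl | h0
  · simp
  have t₁ := tanh_pos_of_pos (x := κ₁ * l₁ / 2) (by positivity)
  have t₂ := tanh_pos_of_pos (x := κ₁ * l₂ / 2) (by positivity)
  suffices -D * κ₁ ≤ 2 * (tanh (κ₁ * l₁ / 2) + tanh (κ₁ * l₂ / 2)) by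
    linarith [tanh_lt_one (κ₁ * l₁ / 2), tanh_lt_one (κ₁ * l₂ / 2)]
  -- A strict inequality at `κ₁` would persist slightly to its left, since `tanh` increases.
  by_contra! hlt
  rw [mul_comm (-D), ← div_lt_iff₀ hD'] at hlt
  obtain ⟨κ, hκ, hκκ⟩ := exists_between hlt
  have hκ0 : 0 < κ := lt_trans (by positivity) hκ
  refine hκκ.not_ge ((hκ₁ κ hκ0).1 ?_)
  rw [div_lt_iff₀ hD'] at hκ
  have m₁ : tanh (κ * l₁ / 2) < tanh (κ₁ * l₁ / 2) := tanh_lt_tanh (by gcongr)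
  have m₂ : tanh (κ * l₂ / 2) < tanh (κ₁ * l₂ / 2) := tanh_lt_tanh (by gcongr)
  linarith

/-! ### Unbounded resolvent set -/

/-- Start where `|sin (k l₁)| = 1`. If `sin (k l₂)` is small there, a shift by the fixed `t` helps:
the formula for `sin (t l₂)` as the sine of a difference forces one of the two sines to be at least
half of it. No relation between the lengths is needed. -/
theorem exists_le_abs_sin {l₁ l₂ : ℝ} (h₁ : 0 < l₁) (h₂ : 0 < l₂) :
    ∃ δ > 0, ∀ K, ∃ k > K, δ ≤ |sin (k * l₁)| ∧ δ ≤ |sin (k * l₂)| := by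
  set t := π / (4 * (l₁ + l₂)) with ht
  have ht0 : 0 < t := by positivity
  have htl : t * l₁ + t * l₂ = π / 4 := by rw [ht]; field_simp
  have a₁ : 0 < t * l₁ := by positivity
  have a₂ : 0 < t * l₂ := by positivity
  have hπ := pi_pos
  have hc : 0 < cos (t * l₁) := cos_pos_of_mem_Ioo ⟨by linarith, by linarith⟩
  have hs : 0 < sin (t * l₂) := sin_pos_of_pos_of_lt_pi a₂ (by linarith)
  refine ⟨min (sin (t * l₂) / 2) (cos (t * l₁)), by positivity, fun K => ?_⟩
  obtain ⟨n, hn⟩ := exists_nat_gt (K * l₁ / π)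
  rw [div_lt_iff₀ hπ] at hn
  set k := (π / 2 + n * π) / l₁ with hk
  have hkl : k * l₁ = π / 2 + n * π := div_mul_cancel₀ _ h₁.ne'
  have hkK : K < k := by
    rw [hk, lt_div_iff₀ h₁]
    linarith
  have s₁ : |sin (k * l₁)| = 1 := by
    rw [hkl, sin_add_nat_mul_pi, sin_pi_div_two, mul_one, abs_pow, abs_neg, abs_one, one_pow]
  have s₂ : |sin ((k + t) * l₁)| = cos (t * l₁) := by
    have : (k + t) * l₁ = (t * l₁ + π / 2) + n * π := by rw [add_mul, hkl]; ring
    rw [this, sin_add_nat_mul_pi, sin_add_pi_div_two, abs_mul, abs_pow, abs_neg, abs_one, one_pow,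
      one_mul, abs_of_pos hc]
  have s₃ : sin (t * l₂) ≤ |sin ((k + t) * l₂)| + |sin (k * l₂)| := by
    have : t * l₂ = (k + t) * l₂ - k * l₂ := by ring
    rw [this, sin_sub]
    refine (le_abs_self _).trans ((abs_sub _ _).trans ?_)
    rw [abs_mul, abs_mul]
    exact add_le_add (mul_le_of_le_one_right (abs_nonneg _) (abs_cos_le_one _))
      (mul_le_of_le_one_left (abs_nonneg _) (abs_cos_le_one _))
  rcases le_total (sin (t * l₂) / 2) |sin (k * l₂)| with h | h
  · exact ⟨k, hkK, by rw [s₁]; exact (min_le_right _ _).trans (cos_le_one _),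
      (min_le_left _ _).trans h⟩
  · exact ⟨k + t, by linarith, by rw [s₂]; exact min_le_right _ _,
      (min_le_left _ _).trans (by linarith)⟩

theorem exists_gt_notMem_latticeEnergies {l₁ l₂ : ℝ} (h₁ : 0 < l₁) (h₂ : 0 < l₂) {D : ℝ}
    (hD : D ≠ 0) (K : ℝ) : ∃ E > K, E ∉ latticeEnergies l₁ l₂ D := by
  obtain ⟨δ, hδ, h⟩ := exists_le_abs_sin h₁ h₂
  -- Each half-angle function is at most `2 / δ`, so both right sides are at most `8 / δ`.
  obtain ⟨k, hk, s₁, s₂⟩ := h (max (max K 1) (8 / δ / |D|))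
  obtain ⟨hk', hkD⟩ := max_lt_iff.1 hk
  obtain ⟨hkK, hk1⟩ := max_lt_iff.1 hk'
  have hk0 : 0 < k := by linarith
  refine ⟨k ^ 2, by nlinarith, ?_⟩
  rw [sq_mem_latticeEnergies_iff h₁ h₂ D hk0 (abs_pos.1 (hδ.trans_le s₁))
    (abs_pos.1 (hδ.trans_le s₂))]
  rw [div_lt_iff₀ (abs_pos.2 hD)] at hkD
  have b : ∀ x, δ ≤ |sin x| → cotHalf x ≤ 2 / δ ∧ tanHalf x ≤ 2 / δ := fun x hx => by
    have h1 := abs_le.1 (abs_cos_div_sin_le x)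
    have h2 : 1 / |sin x| ≤ 1 / δ := by gcongr
    have h3 : 2 / δ = 1 / δ + 1 / δ := by ring
    rw [cotHalf, tanHalf, h3]
    constructor <;> linarith
  have b₁ := b _ s₁
  have b₂ := b _ s₂
  have e : 8 / δ = 2 * (2 / δ + 2 / δ) := by ring
  rintro ⟨c, d⟩
  rcases abs_cases D with ⟨hD', -⟩ | ⟨hD', -⟩ <;> rw [hD'] at hkD <;> linarith

/-! ### Merging touching intervals -/

theorem Icc_subset_iUnion_Icc {a b : ℕ → ℝ} {n m : ℕ} (hnm : n ≤ m)
    (h : ∀ i, n ≤ i → i < m → a (i + 1) ≤ b i) : Icc (a n) (b m) ⊆ ⋃ i, Icc (a i) (b i) := by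
  induction m, hnm using Nat.le_induction with
  | base => exact subset_iUnion (fun i => Icc (a i) (b i)) n
  | succ m hnm ih =>
    intro x hx
    rcases le_total x (b m) with hxm | hxm
    · exact ih (fun i hi him => h i hi (him.trans m.lt_succ_self)) ⟨hx.1, hxm⟩
    · exact mem_iUnion.2 ⟨m + 1, (h m hnm m.lt_succ_self).trans hxm, hx.2⟩

/-- A merged band ends at the indices with `b i < a (i + 1)`, and points off the union at arbitrary
height make these infinite in number. The bound `r ≤ i` ensures that every merged band but the first
ends at some `b i` with `i ≥ 1`. -/
theorem exists_separated_bands {a b : ℕ → ℝ} (hab : ∀ i, a i < b i) (hba : ∀ i, b i ≤ a (i + 1))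
    (hu : ∀ K, ∃ i, K < a i) (hgap : ∀ K, ∃ x > K, x ∉ ⋃ i, Icc (a i) (b i)) :
    ∃ α β : ℕ → ℝ, (∀ r, α r < β r ∧ β r < α (r + 1)) ∧
      ⋃ r, Icc (α r) (β r) = ⋃ i, Icc (a i) (b i) ∧ α 0 = a 0 ∧ (∀ r, ∃ i, α r = a i) ∧
      (∀ r, ∃ i, r ≤ i ∧ β r = b i) ∧ (b 0 < a 1 → β 0 = b 0 ∧ α 1 = a 1) := by
  classical
  have ha : StrictMono a := strictMono_nat_of_lt_succ fun i => (hab i).trans_le (hba i)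
  have hb : StrictMono b := strictMono_nat_of_lt_succ fun i => (hba i).trans_lt (hab _)
  set P : ℕ → Prop := fun i => b i < a (i + 1) with hP
  have hinf : (Set.ofPred P).Infinite := by
    refine Set.infinite_of_not_bddAbove ?_
    rintro ⟨N, hN⟩
    obtain ⟨x, hx, hxn⟩ := hgap (a (N + 1))
    obtain ⟨i, hi, hi'⟩ := exists_mem_Ico_of_unbounded hu ((ha.monotone (Nat.zero_le _)).trans hx.le)
    have hPi : P i := by
      by_contra hle
      exact hxn (mem_iUnion.2 ⟨i, hi, hi'.le.trans (not_lt.1 hle)⟩)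
    have h1 : i ≤ N := hN hPi
    exact absurd (hx.trans hi') (not_lt.2 (ha.monotone (by omega)))
  set σ : ℕ → ℕ := Nat.nth P with hσ
  have hσm : StrictMono σ := Nat.nth_strictMono hinf
  have hσP : ∀ r, P (σ r) := Nat.nth_mem_of_infinite hinf
  -- A merged band begins just after the end of the previous one; the first begins at index 0.
  set s : ℕ → ℕ := fun r => Nat.casesOn r 0 fun r => σ r + 1 with hs
  have hsσ : ∀ r, s r ≤ σ r := fun r => by
    cases r with
    | zero => exact Nat.zero_le _
    | succ r => exact hσm r.lt_succ_self
  have hnot : ∀ r i, s r ≤ i → i < σ r → ¬ P i := by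
    intro r i h1 h2 hPi
    have hn : Nat.nth P (Nat.count P i) = i := Nat.nth_count hPi
    have h3 : Nat.count P i < r := hσm.lt_iff_lt.1 (hn.trans_lt h2)
    cases r with
    | zero => omega
    | succ r =>
      have h4 : σ (Nat.count P i) ≤ σ r := hσm.monotone (by omega)
      have h5 : σ (Nat.count P i) = i := hn
      have h6 : s (r + 1) = σ r + 1 := rfl
      omega
  refine ⟨fun r => a (s r), fun r => b (σ r), fun r => ⟨(hab _).trans_le (hb.monotone (hsσ r)),
    hσP r⟩, ?_, rfl, fun r => ⟨_, rfl⟩, fun r => ⟨_, hσm.id_le r, rfl⟩, fun h0 => ?_⟩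
  · refine Subset.antisymm (iUnion_subset fun r => Icc_subset_iUnion_Icc (hsσ r) fun i h1 h2 =>
      not_lt.1 (hnot r i h1 h2)) (iUnion_subset fun i => ?_)
    have hex : ∃ r, i ≤ σ r := ⟨i, hσm.id_le i⟩
    refine subset_iUnion_of_subset (Nat.find hex) (Icc_subset_Icc (ha.monotone ?_)
      (hb.monotone (Nat.find_spec hex)))
    rcases hr : Nat.find hex with _ | r
    · exact Nat.zero_le _
    · exact not_le.1 (Nat.find_min hex (m := r) (by omega))
  · have h : σ 0 = 0 := by
      by_contra hne
      exact hnot 0 0 le_rfl (Nat.pos_of_ne_zero hne) h0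
    have h' : s 1 = σ 0 + 1 := rfl
    simp only [h, h', zero_add, and_self]

/-- Midpoints between successive bands lie in distinct components: a component is an interval, so if
it contained two midpoints it would contain the left end of a band. -/
theorem infinite_isGap_of_bands {S : Set ℝ} {α β : ℕ → ℝ} (h : ∀ r, α r < β r ∧ β r < α (r + 1))
    (hS : S = ⋃ r, Icc (α r) (β r)) : {I : Set ℝ | IsGap S I}.Infinite := by
  have hα : StrictMono α := strictMono_nat_of_lt_succ fun i => (h i).1.trans (h i).2
  have hβ : StrictMono β := strictMono_nat_of_lt_succ fun i => (h i).2.trans (h _).1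
  set x : ℕ → ℝ := fun r => (β r + α (r + 1)) / 2 with hx
  have x1 : ∀ r, β r < x r := fun r => by simp only [hx]; linarith [(h r).2]
  have x2 : ∀ r, x r < α (r + 1) := fun r => by simp only [hx]; linarith [(h r).2]
  have hxS : ∀ r, x r ∈ Sᶜ := by
    intro r hr
    rw [hS] at hr
    obtain ⟨i, hi⟩ := mem_iUnion.1 hr
    rcases le_or_gt i r with hir | hir
    · exact absurd ((hβ.monotone hir).trans_lt (x1 r)) (not_lt.2 hi.2)
    · exact absurd ((x2 r).trans_le (hα.monotone hir)) (not_lt.2 hi.1)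
  have key : ∀ r s, r < s →
      connectedComponentIn Sᶜ (x r) ≠ connectedComponentIn Sᶜ (x s) := by
    intro r s hrs he
    have hr := mem_connectedComponentIn (hxS r)
    have hs : x s ∈ connectedComponentIn Sᶜ (x r) := he ▸ mem_connectedComponentIn (hxS s)
    have hm : α (r + 1) ∈ connectedComponentIn Sᶜ (x r) :=
      isPreconnected_connectedComponentIn.ordConnected.out hr hs
        ⟨(x2 r).le, (hα.monotone hrs).trans ((h s).1.trans (x1 s)).le⟩
    refine connectedComponentIn_subset _ _ hm ?_
    rw [hS]
    exact mem_iUnion.2 ⟨r + 1, le_rfl, (h _).1.le⟩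
  refine Set.infinite_of_injective_forall_mem (f := fun r => connectedComponentIn Sᶜ (x r)) ?_
    fun r => ⟨x r, hxS r, rfl⟩
  intro r s he
  rcases lt_trichotomy r s with hrs | hrs | hrs
  · exact absurd he (key r s hrs)
  · exact hrs
  · exact absurd he.symm (key s r hrs)

/-! ### Band structure -/

theorem sq_lt_sq_of_nonneg {x y : ℝ} (hx : 0 ≤ x) (h : x < y) : x ^ 2 < y ^ 2 :=
  pow_lt_pow_left₀ h hx two_ne_zero

theorem exists_eq_neg_sq {E : ℝ} (hE : E < 0) : ∃ κ, 0 < κ ∧ E = -κ ^ 2 :=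
  ⟨√(-E), sqrt_pos.2 (neg_pos.2 hE), by rw [sq_sqrt (neg_pos.2 hE).le, neg_neg]⟩

theorem neg_sq_notMem_of_nonneg {l₁ l₂ : ℝ} (h₁ : 0 < l₁) (h₂ : 0 < l₂) {D : ℝ} (hD : 0 ≤ D) {κ : ℝ}
    (hκ : 0 < κ) : -κ ^ 2 ∉ latticeEnergies l₁ l₂ D := by
  rw [neg_sq_mem_latticeEnergies_iff h₁ h₂ D hκ]
  rintro ⟨h, -⟩
  have := mul_nonneg hD hκ.le
  linarith [tanh_pos_of_pos (x := κ * l₁ / 2) (by positivity),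
    tanh_pos_of_pos (x := κ * l₂ / 2) (by positivity)]

theorem nonneg_of_mem_latticeEnergies {l₁ l₂ : ℝ} (h₁ : 0 < l₁) (h₂ : 0 < l₂) {D : ℝ} (hD : 0 ≤ D)
    {E : ℝ} (hE : E ∈ latticeEnergies l₁ l₂ D) : 0 ≤ E := by
  by_contra! hlt
  obtain ⟨κ, hκ, rfl⟩ := exists_eq_neg_sq hlt
  exact neg_sq_notMem_of_nonneg h₁ h₂ hD hκ hE

theorem exists_lt_sq_dirichletSeq {l₁ l₂ : ℝ} (h₁ : 0 < l₁) (h₂ : 0 < l₂) (K : ℝ) :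
    ∃ i, K < dirichletSeq l₁ l₂ i ^ 2 := by
  obtain ⟨i, hi⟩ := exists_lt_dirichletSeq h₁ h₂ (max K 1)
  obtain ⟨hK, h1⟩ := max_lt_iff.1 hi
  exact ⟨i, by nlinarith⟩

theorem latticeEnergies_eq_iUnion_of_pos {l₁ l₂ : ℝ} (h₁ : 0 < l₁) (h₂ : 0 < l₂) {D : ℝ}
    (hD : 0 < D) : ∃ c : ℕ → ℝ,
      (∀ i, dirichletSeq l₁ l₂ i < c i ∧ c i ≤ dirichletSeq l₁ l₂ (i + 1)) ∧
      latticeEnergies l₁ l₂ D = ⋃ i, Icc (dirichletSeq l₁ l₂ i ^ 2) (c i ^ 2) := by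
  choose c hc using fun i =>
    (isDirichletInterval_dirichletSeq h₁ h₂ i).exists_upper_of_pos h₁ h₂ hD
  have p0 := dirichletSeq_nonneg h₁ h₂
  refine ⟨c, fun i => ⟨(hc i).1, (hc i).2.1⟩, ?_⟩
  ext E
  rw [mem_iUnion]
  constructor
  · intro hE
    have hE0 := nonneg_of_mem_latticeEnergies h₁ h₂ hD.le hE
    obtain ⟨i, hi, hi'⟩ := exists_mem_Ico_of_unbounded (exists_lt_dirichletSeq h₁ h₂)
      (show dirichletSeq l₁ l₂ 0 ≤ √E from sqrt_nonneg E)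
    rw [← sq_sqrt hE0] at hE ⊢
    refine ⟨i, pow_le_pow_left₀ (p0 i) hi 2, pow_le_pow_left₀ (sqrt_nonneg E) ?_ 2⟩
    rcases hi.eq_or_lt with h | h
    · exact h ▸ (hc i).1.le
    · exact ((hc i).2.2 _ ⟨h, hi'⟩).1 hE
  · rintro ⟨i, hi, hi'⟩
    have hE0 : 0 ≤ E := (sq_nonneg _).trans hi
    rw [← sq_sqrt hE0] at hi hi' ⊢
    have hi := le_of_sq_le_sq hi (sqrt_nonneg E)
    have hi' := le_of_sq_le_sq hi' ((p0 i).trans (hc i).1.le)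
    rcases hi.eq_or_lt with h | h
    · exact h ▸ sq_dirichletSeq_mem h₁ h₂ D i
    -- The threshold may coincide with the next Dirichlet point, which lies in the spectrum for a
    -- different reason.
    rcases (hi'.trans (hc i).2.1).eq_or_lt with h' | h'
    · exact h' ▸ sq_dirichletSeq_mem h₁ h₂ D (i + 1)
    · exact ((hc i).2.2 _ ⟨h, h'⟩).2 hi'

theorem latticeEnergies_eq_iUnion_of_neg {l₁ l₂ : ℝ} (h₁ : 0 < l₁) (h₂ : 0 < l₂) {D : ℝ}
    (hD : D < 0) : ∃ (κ₁ κ₀ : ℝ) (d : ℕ → ℝ), 0 ≤ κ₁ ∧ κ₁ < κ₀ ∧ (0 < κ₁ ↔ -l₁ - l₂ < D) ∧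
      (-l₁ - l₂ < D → d 0 = 0) ∧
      (∀ i, dirichletSeq l₁ l₂ i ≤ d i ∧ d i < dirichletSeq l₁ l₂ (i + 1)) ∧
      latticeEnergies l₁ l₂ D =
        Icc (-κ₀ ^ 2) (-κ₁ ^ 2) ∪ ⋃ i, Icc (d i ^ 2) (dirichletSeq l₁ l₂ (i + 1) ^ 2) := by
  obtain ⟨κ₁, κ₀, h0, h01, hpos, hκ₁, hκ₀⟩ := exists_negative_band h₁ h₂ hD
  choose d hd using fun i =>
    (isDirichletInterval_dirichletSeq h₁ h₂ i).exists_lower_of_neg h₁ h₂ hD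
  have p0 := dirichletSeq_nonneg h₁ h₂
  have hd0 : -l₁ - l₂ < D → d 0 = 0 := by
    intro hDl
    have hI := isDirichletInterval_dirichletSeq h₁ h₂ 0
    refine le_antisymm (le_of_forall_gt_imp_ge_of_dense fun k hk => ?_) (hd 0).1
    rcases lt_or_ge k (dirichletSeq l₁ l₂ (0 + 1)) with h | h
    · exact ((hd 0).2.2 k ⟨hk, h⟩).1 (IsDirichletInterval.sq_mem_of_left_eq_zero hI h₁ h₂ hD hDl.le
        ⟨hk, h⟩)
    · exact (hd 0).2.1.le.trans h
  refine ⟨κ₁, κ₀, d, h0, h01, hpos, hd0, fun i => ⟨(hd i).1, (hd i).2.1⟩, ?_⟩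
  have hneg : ∀ κ, 0 < κ → (-κ ^ 2 ∈ latticeEnergies l₁ l₂ D ↔ κ₁ ≤ κ ∧ κ ≤ κ₀) := fun κ hκ => by
    rw [neg_sq_mem_latticeEnergies_iff h₁ h₂ D hκ, hκ₁ κ hκ, hκ₀ κ hκ]
  ext E
  rw [mem_union, mem_iUnion]
  constructor
  · intro hE
    rcases lt_trichotomy E 0 with hE0 | rfl | hE0
    · obtain ⟨κ, hκ, rfl⟩ := exists_eq_neg_sq hE0
      obtain ⟨h, h'⟩ := (hneg κ hκ).1 hE
      exact Or.inl ⟨neg_le_neg (pow_le_pow_left₀ hκ.le h' 2), neg_le_neg (pow_le_pow_left₀ h0 h 2)⟩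
    -- Zero ends the negative band if `κ₁ = 0`, and otherwise begins the first band of the positive
    -- axis.
    · rcases h0.eq_or_lt with h | h
      · exact Or.inl ⟨by nlinarith, by rw [← h]; simp⟩
      · exact Or.inr ⟨0, by rw [hd0 (hpos.1 h)]; simp, sq_nonneg _⟩
    · obtain ⟨i, hi, hi'⟩ := exists_mem_Ico_of_unbounded (exists_lt_dirichletSeq h₁ h₂)
        (show dirichletSeq l₁ l₂ 0 ≤ √E from sqrt_nonneg E)
      rw [← sq_sqrt hE0.le] at hE ⊢
      refine Or.inr ?_
      rcases hi.eq_or_lt with h | h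
      · rw [← h]
        -- A Dirichlet point closes the band of the preceding interval; the band of its own interval
        -- may start later.
        cases i with
        | zero => exact absurd h (sqrt_pos.2 hE0).ne
        | succ i =>
          exact ⟨i, pow_le_pow_left₀ ((p0 i).trans (hd i).1) (hd i).2.1.le 2, le_rfl⟩
      · exact ⟨i, pow_le_pow_left₀ ((p0 i).trans (hd i).1) (((hd i).2.2 _ ⟨h, hi'⟩).1 hE) 2,
          pow_le_pow_left₀ (sqrt_nonneg E) hi'.le 2⟩
  · rintro (⟨h, h'⟩ | ⟨i, hi, hi'⟩)
    · rcases (h'.trans (neg_nonpos.2 (sq_nonneg κ₁))).eq_or_lt with rfl | hE0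
      · exact zero_mem_latticeEnergies h₁ h₂ D
      · obtain ⟨κ, hκ, rfl⟩ := exists_eq_neg_sq hE0
        exact (hneg κ hκ).2 ⟨le_of_sq_le_sq (neg_le_neg_iff.1 h') hκ.le,
          le_of_sq_le_sq (neg_le_neg_iff.1 h) (h0.trans h01.le)⟩
    · have hE0 : 0 ≤ E := (sq_nonneg _).trans hi
      rw [← sq_sqrt hE0] at hi hi' ⊢
      have hi := le_of_sq_le_sq hi (sqrt_nonneg E)
      have hi' := le_of_sq_le_sq hi' (p0 _)
      rcases ((hd i).1.trans hi).eq_or_lt with h | h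
      · exact h ▸ sq_dirichletSeq_mem h₁ h₂ D i
      rcases hi'.eq_or_lt with h' | h'
      · exact h' ▸ sq_dirichletSeq_mem h₁ h₂ D (i + 1)
      · exact ((hd i).2.2 _ ⟨h, h'⟩).2 hi

theorem latticeEnergies_zero {l₁ l₂ : ℝ} (h₁ : 0 < l₁) (h₂ : 0 < l₂) :
    latticeEnergies l₁ l₂ 0 = Ici 0 := by
  ext E
  refine ⟨nonneg_of_mem_latticeEnergies h₁ h₂ le_rfl, fun hE => ?_⟩
  rcases (mem_Ici.1 hE).eq_or_lt with rfl | hE0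
  · exact zero_mem_latticeEnergies h₁ h₂ 0
  rw [← sq_sqrt hE0.le]
  by_cases hs : sin (√E * l₁) = 0 ∨ sin (√E * l₂) = 0
  · exact sq_mem_latticeEnergies_of_sin h₁ h₂ 0 hs
  rw [not_or] at hs
  rw [sq_mem_latticeEnergies_iff h₁ h₂ 0 (sqrt_pos.2 hE0) hs.1 hs.2]
  constructor
  · linarith [cotHalf_nonneg (√E * l₁), cotHalf_nonneg (√E * l₂)]
  · linarith [tanHalf_nonneg (√E * l₁), tanHalf_nonneg (√E * l₂)]

theorem latticeEnergies_bands_of_pos {l₁ l₂ : ℝ} (h₁ : 0 < l₁) (h₂ : 0 < l₂) {D : ℝ} (hD : 0 < D) :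
    ∃ α β : ℕ → ℝ, (∀ r, α r < β r ∧ β r < α (r + 1)) ∧
      latticeEnergies l₁ l₂ D = ⋃ r, Icc (α r) (β r) ∧
      (∀ r, ∃ n : ℤ, α r = (π * n / l₁) ^ 2 ∨ α r = (π * n / l₂) ^ 2) ∧ α 0 = 0 := by
  obtain ⟨c, hc, hS⟩ := latticeEnergies_eq_iUnion_of_pos h₁ h₂ hD
  have p0 := dirichletSeq_nonneg h₁ h₂
  obtain ⟨α, β, hαβ, hU, hα0, hα, -, -⟩ := exists_separated_bands
    (a := fun i => dirichletSeq l₁ l₂ i ^ 2) (b := fun i => c i ^ 2)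
    (fun i => sq_lt_sq_of_nonneg (p0 i) (hc i).1)
    (fun i => pow_le_pow_left₀ ((p0 i).trans (hc i).1.le) (hc i).2 2)
    (exists_lt_sq_dirichletSeq h₁ h₂)
    (fun K => by rw [← hS]; exact exists_gt_notMem_latticeEnergies h₁ h₂ hD.ne' K)
  refine ⟨α, β, hαβ, hS.trans hU.symm, fun r => ?_, by rw [hα0]; simp [dirichletSeq]⟩
  obtain ⟨i, hi⟩ := hα r
  rw [hi]
  exact exists_dirichletSeq_sq_eq h₁ h₂ i

theorem latticeEnergies_bands_of_neg {l₁ l₂ : ℝ} (h₁ : 0 < l₁) (h₂ : 0 < l₂) {D : ℝ} (hD : D < 0) :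
    ∃ α β : ℕ → ℝ, (∀ r, α r < β r ∧ β r < α (r + 1)) ∧
      latticeEnergies l₁ l₂ D = ⋃ r, Icc (α r) (β r) ∧
      (∀ r, 1 ≤ r → ∃ n : ℤ, β r = (π * n / l₁) ^ 2 ∨ β r = (π * n / l₂) ^ 2) ∧ α 0 < 0 ∧
      (-l₁ - l₂ < D → β 0 < 0 ∧ α 1 = 0) := by
  obtain ⟨κ₁, κ₀, d, h0, h01, hpos, hd0, hd, hS⟩ := latticeEnergies_eq_iUnion_of_neg h₁ h₂ hD
  have p0 := dirichletSeq_nonneg h₁ h₂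
  -- Index 0 is the negative band and index `i + 1` the band of the `i`-th Dirichlet interval.
  set a : ℕ → ℝ := fun i => Nat.casesOn i (-κ₀ ^ 2) fun i => d i ^ 2
  set b : ℕ → ℝ := fun i => Nat.casesOn i (-κ₁ ^ 2) fun i => dirichletSeq l₁ l₂ (i + 1) ^ 2
  have hS' : latticeEnergies l₁ l₂ D = ⋃ i, Icc (a i) (b i) :=
    hS.trans (union_iUnion_nat_succ fun i => Icc (a i) (b i))
  obtain ⟨α, β, hαβ, hU, hα0, -, hβ, h1⟩ := exists_separated_bands (a := a) (b := b)
    (fun i => by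
      cases i with
      | zero => exact neg_lt_neg (sq_lt_sq_of_nonneg h0 h01)
      | succ i => exact sq_lt_sq_of_nonneg ((p0 i).trans (hd i).1) (hd i).2)
    (fun i => by
      cases i with
      | zero => exact (neg_nonpos.2 (sq_nonneg κ₁)).trans (sq_nonneg (d 0))
      | succ i => exact pow_le_pow_left₀ (p0 _) (hd _).1 2)
    (fun K => by
      obtain ⟨i, hi⟩ := exists_lt_sq_dirichletSeq h₁ h₂ K
      exact ⟨i + 1, hi.trans_le (pow_le_pow_left₀ (p0 i) (hd i).1 2)⟩)
    (fun K => by rw [← hS']; exact exists_gt_notMem_latticeEnergies h₁ h₂ hD.ne K)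
  refine ⟨α, β, hαβ, hS'.trans hU.symm, fun r hr => ?_, ?_, fun hDl => ?_⟩
  · obtain ⟨i, hi, hβi⟩ := hβ r
    rw [hβi]
    obtain ⟨j, rfl⟩ := Nat.exists_eq_succ_of_ne_zero (by omega : i ≠ 0)
    exact exists_dirichletSeq_sq_eq h₁ h₂ (j + 1)
  · rw [hα0]
    exact neg_neg_of_pos (pow_pos (h0.trans_lt h01) 2)
  · have b0 : b 0 < 0 := neg_neg_of_pos (pow_pos (hpos.2 hDl) 2)
    have a1 : a 1 = 0 := by
      change d 0 ^ 2 = 0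
      rw [hd0 hDl]
      simp
    obtain ⟨e, e'⟩ := h1 (b0.trans_eq a1.symm)
    exact ⟨by rw [e]; exact b0, by rw [e', a1]⟩

/-- Supplies the real point of the resolvent set from which the reality of the whole spectrum
follows. -/
theorem exists_neg_sq_notMem_latticeEnergies {l₁ l₂ : ℝ} (h₁ : 0 < l₁) (h₂ : 0 < l₂) (D : ℝ) :
    ∃ κ, 0 < κ ∧ -κ ^ 2 ∉ latticeEnergies l₁ l₂ D := by
  rcases le_or_gt 0 D with hD | hD
  · exact ⟨1, one_pos, neg_sq_notMem_of_nonneg h₁ h₂ hD one_pos⟩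
  · obtain ⟨κ₁, κ₀, h0, h01, -, -, h⟩ := exists_negative_band h₁ h₂ hD
    refine ⟨κ₀ + 1, by linarith, fun hmem => ?_⟩
    have := (h _ (by linarith)).1
      ((neg_sq_mem_latticeEnergies_iff h₁ h₂ D (by linarith)).1 hmem).2
    linarith

theorem latticeSpectrum_eq_image {l₁ l₂ : ℝ} (h₁ : 0 < l₁) (h₂ : 0 < l₂) (D : ℝ) :
    latticeSpectrum l₁ l₂ D = Complex.ofReal '' latticeEnergies l₁ l₂ D := by
  obtain ⟨κ, hκ, h⟩ := exists_neg_sq_notMem_latticeEnergies h₁ h₂ D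
  exact latticeSpectrum_eq_ofReal_image h₁ h₂ D hκ h

/-! ### Monotonicity in the coupling and comparison with the Kronig–Penney model -/

theorem latticeEnergies_inter_subset {l₁ l₂ : ℝ} (h₁ : 0 < l₁) (h₂ : 0 < l₂) {D D' : ℝ}
    (hDD : 0 ≤ D * D') (habs : |D| < |D'|) :
    latticeEnergies l₁ l₂ D' ∩ Ici 0 ⊆ latticeEnergies l₁ l₂ D ∩ Ici 0 := by
  rintro E ⟨hE, hE0⟩
  refine ⟨?_, hE0⟩
  rcases (mem_Ici.1 hE0).eq_or_lt with rfl | hE0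
  · exact zero_mem_latticeEnergies h₁ h₂ D
  rw [← sq_sqrt hE0.le] at hE ⊢
  have hk := sqrt_pos.2 hE0
  by_cases hs : sin (√E * l₁) = 0 ∨ sin (√E * l₂) = 0
  · exact sq_mem_latticeEnergies_of_sin h₁ h₂ D hs
  rw [not_or] at hs
  rw [sq_mem_latticeEnergies_iff h₁ h₂ _ hk hs.1 hs.2] at hE ⊢
  have c₁ := cotHalf_nonneg (√E * l₁)
  have c₂ := cotHalf_nonneg (√E * l₂)
  have t₁ := tanHalf_nonneg (√E * l₁)
  have t₂ := tanHalf_nonneg (√E * l₂)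
  rcases lt_trichotomy D' 0 with h | rfl | h
  · have hD : D ≤ 0 := by
      by_contra! hlt
      exact hDD.not_gt (mul_neg_of_pos_of_neg hlt h)
    rw [abs_of_neg h, abs_of_nonpos hD] at habs
    have := mul_lt_mul_of_pos_right habs hk
    have := mul_nonneg (neg_nonneg.2 hD) hk.le
    constructor <;> linarith [hE.2]
  · exact absurd habs (by simp)
  · have hD : 0 ≤ D := by
      by_contra! hlt
      exact hDD.not_gt (mul_neg_of_neg_of_pos hlt h)
    rw [abs_of_pos h, abs_of_nonneg hD] at habs
    have := mul_lt_mul_of_pos_right habs hk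
    have := mul_nonneg hD hk.le
    constructor <;> linarith [hE.1]

/-- The half-angle functions are nonnegative, so an inequality violated with the sum over both
lengths is violated with either summand alone. -/
theorem notMem_kronigPenneyEnergies_of_pos {l₁ l₂ : ℝ} (h₁ : 0 < l₁) (h₂ : 0 < l₂) {D E : ℝ}
    (hE0 : 0 ≤ E) (hE : E ∉ latticeEnergies l₁ l₂ D) :
    E ∉ kronigPenneyEnergies l₁ D ∧ E ∉ kronigPenneyEnergies l₂ D := by
  rcases hE0.eq_or_lt with rfl | hE0
  · exact absurd (zero_mem_latticeEnergies h₁ h₂ D) hE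
  rw [← sq_sqrt hE0.le] at hE ⊢
  have hk := sqrt_pos.2 hE0
  by_cases hs : sin (√E * l₁) = 0 ∨ sin (√E * l₂) = 0
  · exact absurd (sq_mem_latticeEnergies_of_sin h₁ h₂ D hs) hE
  rw [not_or] at hs
  rw [sq_mem_latticeEnergies_iff h₁ h₂ _ hk hs.1 hs.2, not_and_or, not_le, not_le] at hE
  have c₁ := cotHalf_nonneg (√E * l₁)
  have c₂ := cotHalf_nonneg (√E * l₂)
  have t₁ := tanHalf_nonneg (√E * l₁)
  have t₂ := tanHalf_nonneg (√E * l₂)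
  exact ⟨sq_notMem_kronigPenneyEnergies h₁ D hk hs.1
      (hE.imp (fun h => by linarith) fun h => by linarith),
    sq_notMem_kronigPenneyEnergies h₂ D hk hs.2
      (hE.imp (fun h => by linarith) fun h => by linarith)⟩

/-- A violation of the `tanh` inequality means `κ < κ₁`; both `-κ₁ ^ 2` and 0 are in the spectrum
and bound the gap. -/
theorem gap_eq_Ioo_zero {l₁ l₂ : ℝ} (h₁ : 0 < l₁) (h₂ : 0 < l₂) {D κ x : ℝ} (hκ : 0 < κ)
    (hD : D < 0) (hlt : -(D * κ) < 2 * (tanh (κ * l₁ / 2) + tanh (κ * l₂ / 2)))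
    (hmem : -κ ^ 2 ∈ connectedComponentIn (latticeEnergies l₁ l₂ D)ᶜ x) :
    ∃ b < 0, connectedComponentIn (latticeEnergies l₁ l₂ D)ᶜ x = Ioo b 0 := by
  obtain ⟨κ₁, κ₀, h0, h01, -, hκ₁, hκ₀⟩ := exists_negative_band h₁ h₂ hD
  have hκκ : κ < κ₁ := not_le.1 fun h => hlt.not_ge ((hκ₁ κ hκ).2 h)
  have hκ₁0 := hκ.trans hκκ
  have hb : -κ₁ ^ 2 ∈ latticeEnergies l₁ l₂ D :=
    (neg_sq_mem_latticeEnergies_iff h₁ h₂ D hκ₁0).2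
      ⟨(hκ₁ _ hκ₁0).2 le_rfl, (hκ₀ _ hκ₁0).2 h01.le⟩
  have hneg : -κ ^ 2 < 0 := neg_neg_of_pos (pow_pos hκ 2)
  have hlt' : -κ₁ ^ 2 < -κ ^ 2 := neg_lt_neg (sq_lt_sq_of_nonneg hκ.le hκκ)
  refine ⟨-κ₁ ^ 2, neg_neg_of_pos (pow_pos hκ₁0 2), Subset.antisymm (fun y hy => ?_) ?_⟩
  · have hoc := (isPreconnected_connectedComponentIn
      (F := (latticeEnergies l₁ l₂ D)ᶜ) (x := x)).ordConnected
    have hsub := connectedComponentIn_subset (latticeEnergies l₁ l₂ D)ᶜ x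
    constructor
    · by_contra! hle
      exact hsub (hoc.out hy hmem ⟨hle, hlt'.le⟩) hb
    · by_contra! hle
      exact hsub (hoc.out hmem hy ⟨hneg.le, hle⟩) (zero_mem_latticeEnergies h₁ h₂ D)
  · rw [connectedComponentIn_eq hmem]
    refine isPreconnected_Ioo.subset_connectedComponentIn ⟨hlt', hneg⟩ fun y hy hyS => ?_
    obtain ⟨μ, hμ, rfl⟩ := exists_eq_neg_sq hy.2
    have h := (hκ₁ μ hμ).1 ((neg_sq_mem_latticeEnergies_iff h₁ h₂ D hμ).1 hyS).1
    exact (neg_le_neg (pow_le_pow_left₀ h0 h 2)).not_gt hy.1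

/-- At negative energies with `D < 0`, a violated `coth` inequality passes to each summand. A
violated `tanh` inequality need not, but it occurs only in the excluded gap. For `D ≥ 0` the
Kronig–Penney operators have no negative spectrum. -/
theorem gap_subset_compl_kronigPenneyEnergies {l₁ l₂ : ℝ} (h₁ : 0 < l₁) (h₂ : 0 < l₂) {D x : ℝ}
    (hI : ¬ ∃ b < 0, connectedComponentIn (latticeEnergies l₁ l₂ D)ᶜ x = Ioo b 0) :
    ∀ E ∈ connectedComponentIn (latticeEnergies l₁ l₂ D)ᶜ x,
      E ∉ kronigPenneyEnergies l₁ D ∧ E ∉ kronigPenneyEnergies l₂ D := by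
  intro E hEI
  have hE : E ∉ latticeEnergies l₁ l₂ D := connectedComponentIn_subset _ _ hEI
  rcases le_or_gt 0 E with hE0 | hE0
  · exact notMem_kronigPenneyEnergies_of_pos h₁ h₂ hE0 hE
  obtain ⟨κ, hκ, rfl⟩ := exists_eq_neg_sq hE0
  have t₁ := tanh_pos_of_pos (x := κ * l₁ / 2) (by positivity)
  have t₂ := tanh_pos_of_pos (x := κ * l₂ / 2) (by positivity)
  rcases le_or_gt 0 D with hD | hD
  · have := mul_nonneg hD hκ.le
    exact ⟨neg_sq_notMem_kronigPenneyEnergies h₁ D hκ (Or.inl (by linarith)),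
      neg_sq_notMem_kronigPenneyEnergies h₂ D hκ (Or.inl (by linarith))⟩
  rw [neg_sq_mem_latticeEnergies_iff h₁ h₂ D hκ, not_and_or, not_le, not_le] at hE
  rcases hE with hE | hE
  · exact absurd (gap_eq_Ioo_zero h₁ h₂ hκ hD hE hEI) hI
  · have i₁ := inv_pos.2 t₁
    have i₂ := inv_pos.2 t₂
    exact ⟨neg_sq_notMem_kronigPenneyEnergies h₁ D hκ (Or.inr (by linarith)),
      neg_sq_notMem_kronigPenneyEnergies h₂ D hκ (Or.inr (by linarith))⟩

theorem exists_isGap_kronigPenneyEnergies {l₁ l₂ : ℝ} (h₁ : 0 < l₁) (h₂ : 0 < l₂) {D : ℝ} {I : Set ℝ}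
    (hgap : IsGap (latticeEnergies l₁ l₂ D) I) (hI : ¬ ∃ b : ℝ, b < 0 ∧ I = Ioo b 0) :
    ∃ I₁ I₂ : Set ℝ, IsGap (kronigPenneyEnergies l₁ D) I₁ ∧
      IsGap (kronigPenneyEnergies l₂ D) I₂ ∧ I ⊆ I₁ ∩ I₂ := by
  obtain ⟨x, hx, rfl⟩ := hgap
  have h := gap_subset_compl_kronigPenneyEnergies h₁ h₂ hI
  have hxI := mem_connectedComponentIn hx
  refine ⟨_, _, ⟨x, (h x hxI).1, rfl⟩, ⟨x, (h x hxI).2, rfl⟩, subset_inter ?_ ?_⟩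
  · exact isPreconnected_connectedComponentIn.subset_connectedComponentIn hxI fun E hE => (h E hE).1
  · exact isPreconnected_connectedComponentIn.subset_connectedComponentIn hxI fun E hE => (h E hE).2

theorem mainTheorem3 (l₁ l₂ : ℝ) (hl₁ : 0 < l₁) (hl₂ : 0 < l₂) :
    -- parts (a), (c), (d), (e) for nonzero coupling; the sequences are indexed from 0
    (∀ D : ℝ, D ≠ 0 → ∃ α β : ℕ → ℝ,
      (∀ r, α r < β r ∧ β r < α (r + 1)) ∧
      latticeSpectrum l₁ l₂ D = Complex.ofReal '' (⋃ r, Icc (α r) (β r)) ∧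
      {I : Set ℝ | IsGap (latticeEnergies l₁ l₂ D) I}.Infinite ∧
      (0 < D → ∀ r, ∃ n : ℤ, α r = (π * n / l₁) ^ 2 ∨ α r = (π * n / l₂) ^ 2) ∧
      (D < 0 → ∀ r, 1 ≤ r → ∃ n : ℤ, β r = (π * n / l₁) ^ 2 ∨ β r = (π * n / l₂) ^ 2) ∧
      (0 < D → α 0 = 0) ∧
      (D < 0 → α 0 < 0) ∧
      (-l₁ - l₂ < D → D < 0 → β 0 < 0 ∧ α 1 = 0)) ∧
    -- part (b), which contains the case of vanishing coupling in (a) and (d)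
    latticeSpectrum l₁ l₂ 0 = Complex.ofReal '' Ici (0 : ℝ) ∧
    -- part (f)
    (∀ D D' : ℝ, 0 ≤ D * D' → |D| < |D'| →
      latticeEnergies l₁ l₂ D' ∩ Ici 0 ⊆ latticeEnergies l₁ l₂ D ∩ Ici 0) ∧
    -- part (g): the gaps, except the negative one ending at zero which occurs in (e)
    (∀ (D : ℝ) (I : Set ℝ), IsGap (latticeEnergies l₁ l₂ D) I →
      (¬ ∃ b : ℝ, b < 0 ∧ I = Ioo b 0) →
      ∃ I₁ I₂ : Set ℝ, IsGap (kronigPenneyEnergies l₁ D) I₁ ∧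
        IsGap (kronigPenneyEnergies l₂ D) I₂ ∧ I ⊆ I₁ ∩ I₂) := by
  refine ⟨fun D hD => ?_, ?_, fun D D' => latticeEnergies_inter_subset hl₁ hl₂,
    fun D I => exists_isGap_kronigPenneyEnergies hl₁ hl₂⟩
  · rcases lt_or_gt_of_ne hD with hD | hD
    · obtain ⟨α, β, h, hS, hβ, hα0, he⟩ := latticeEnergies_bands_of_neg hl₁ hl₂ hD
      exact ⟨α, β, h, by rw [latticeSpectrum_eq_image hl₁ hl₂, hS], infinite_isGap_of_bands h hS,
        fun h' => absurd h' hD.not_gt, fun _ => hβ, fun h' => absurd h' hD.not_gt, fun _ => hα0,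
        fun h' _ => he h'⟩
    · obtain ⟨α, β, h, hS, hα, hα0⟩ := latticeEnergies_bands_of_pos hl₁ hl₂ hD
      exact ⟨α, β, h, by rw [latticeSpectrum_eq_image hl₁ hl₂, hS], infinite_isGap_of_bands h hS,
        fun _ => hα, fun h' => absurd h' hD.not_gt, fun _ => hα0, fun h' => absurd h' hD.not_gt,
        fun _ h' => absurd h' hD.not_gt⟩
  · rw [latticeSpectrum_eq_image hl₁ hl₂, latticeEnergies_zero hl₁ hl₂]
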